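/- **Conventions.** A rooted planar map carries a root, which is an additional half-edge placed in a corner and not part of an edge; it is drawn as a head pointing to the root-vertex. A *tree* (planted plane tree) is a rooted planar map with a single face. The tour of a tree follows its border counterclockwise, starting and ending at the root. Rooted maps are considered up to orientation-preserving isomorphism. A *prefix-shuffle* is a word $w$ on $\{a,\bar a,b,\bar b\}$ such that every prefix $w'$ satisfies $|w'|_a\ge|w'|_{\bar a}$ and $|w'|_b\ge|w'|_{\bar b}$. Letters $a,\bar a$ (resp. $b,\bar b$) are paired as matching parentheses. Let $w^+$ be $w$ followed by $|w|_a-|w|_{\bar a}$ letters $\bar a$. **The prefix-map $M_w$.** Let $T_w$ be the tree whose tour is coded by the letters $a,\bar a$ of $w^+$ ($a$ when an edge is first followed, $\bar a$ the second time), with edges oriented away from the root. Reading $w$ during the tour of $T_w$, insert a head for each $b$ and a tail for each $\bar b$, and connect the heads and tails of paired letters. This gives $M_w$; the heads $h_1,\dots,h_k$ of the non-paired letters $b$ are *dangling*. The root counts as a head. The *rooting vertices* are the root-vertex and the ends of the edges of $T_w$ whose letter $a$ is not paired in $w$, ordered by first appearance in the tour of $T_w$. **The map $M_w^\bigstar$.**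 Replace each vertex $v$ of $M_w$ by a cell (a *black* face) with one vertex $x_h$ on its border for each head $h$ at $v$, in the cyclic order of these heads. The border of the cell consists of *permeable* edges, one from each $x_h$ to the $x_{h'}$ of the next head $h'$ counterclockwise around $v$. Each head $h$ is attached to $x_h$, and each tail at $v$ is attached to $x_h$ for the first head $h$ that follows it counterclockwise around $v$. The other faces are *white*; they correspond to the faces of $M_w$. The root and the root-face are inherited from $M_w$. The dangling heads are numbered $h_1,\dots,h_k$ in the order in which they are met around the root-face from the root. **The partition-tree $P_w$.** Its vertices are one vertex in each face of $M_w^\bigstar$ (the one in the root-face is $v_0$) and additional vertices $v_1,\dots,v_k$ in the root-face, with $v_i$ associated with $h_i$. Its edges are the duals of the permeable edges; at the root-face, the dual of a permeable edge $e$ ends at $v_i$ if $h_i$ is the last dangling head met before $e$ around the root-face, and at $v_0$ if no dangling head precedes $e$. The edges at a vertex drawn in a face are in the cyclic order induced by the border of the face. The root of $P_w$ is at $v_0$ and follows, in counterclockwise order, the dual of the first edge around the root-face. Vertices in black faces are *black*, the others (including $v_0,\dots,v_k$) are *white*. The *active* vertices are $v_0,\dots,v_k$, in this order, and the black vertices corresponding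 to rooting vertices, in the order of the rooting vertices. **The binary tree $\lambda_1(w)$.** Let $B_1$ be the binary tree with one node and two active leaves. Put $\lambda_1(\epsilon)=B_1$. The tree $\lambda_1(wa)$ (resp. $\lambda_1(wb)$) is obtained from $\lambda_1(w)$ by replacing the last active left leaf (resp. the first active right leaf) by $B_1$; the tree $\lambda_1(w\bar a)$ (resp. $\lambda_1(w\bar b)$) is obtained by inactivating the first active right leaf (resp. the last active left leaf). Counterclockwise around a node one finds the father (or the root), the left son and the right son. **The map $\theta$.** An edge of a binary tree $B$ is *branching* if one of its ends is a right son and the other is a left son or the root-vertex. The tree $\theta(B)$ is obtained from $B$ by contracting every non-branching edge. A leaf of $B$ is associated with the vertex of $\theta(B)$ into which it is contracted. **Proposition.** For every prefix-shuffle $w$: 1. the partition-tree $P_w$ is a tree; 2. each vertex of $\theta(\lambda_1(w))$ is associated with exactly one leaf of $\lambda_1(w)$; 3. $P_w=\theta(\lambda_1(w))$ as rooted plane trees. Moreover, if a vertex $x$ of $P_w$ is identified with the vertex of $\theta(\lambda_1(w))$ that is associated with the leaf $l$, then $x$ is active if and only if $l$ is active, $x$ is white if and only if $l$ is a left leaf,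 and $x$ is black if and only if $l$ is a right leaf. The order of the active white vertices is the order of appearance of the corresponding leaves around $\lambda_1(w)$, and the order of the active black vertices is the inverse of the order of appearance of the corresponding leaves. -/

import Mathlib

open Equiv

/-! ### Words -/

/-- The alphabet `{a, ā, b, b̄}`. -/
inductive Letter
  | a | abar | b | bbar
  deriving DecidableEq

/-- `u` is a parenthesis system on `{c, c'}` (`c` opens, `c'` closes). -/
def IsParenSystem (c c' : Letter) (u : List Letter) : Prop :=
  (∀ x ∈ u, x = c ∨ x = c') ∧ u.count c = u.count c' ∧ ∀ v, v <+: u → v.count c' ≤ v.count c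

/-- Every prefix has at least as many `a` as `ā` and at least as many `b` as `b̄`. -/
def IsPrefixShuffle (w : List Letter) : Prop :=
  ∀ v, v <+: w → v.count .abar ≤ v.count .a ∧ v.count .bbar ≤ v.count .b

/-- The subword on `{c, c'}` of the part of `u` strictly between the positions `i` and `j`. -/
def subwordBetween (c c' : Letter) (u : List Letter) (i j : ℕ) : List Letter :=
  ((u.drop (i + 1)).take (j - (i + 1))).filter (fun x => x = c ∨ x = c')

/-- The letter `c` at position `i` of `u` is paired with the letter `c'` at position `j`. -/
def IsPaired (c c' : Letter) (u : List Letter) (i j : ℕ) : Prop :=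
  i < j ∧ u[i]? = some c ∧ u[j]? = some c' ∧ IsParenSystem c c' (subwordBetween c c' u i j)

theorem drop_take_split (u : List Letter) {i j k : ℕ} (hij : i < j) (hjk : j < k)
    {x : Letter} (hx : u[j]? = some x) :
    (u.drop (i + 1)).take (k - (i + 1)) =
      (u.drop (i + 1)).take (j - (i + 1)) ++ x :: (u.drop (j + 1)).take (k - (j + 1)) := by
  have hj : j < u.length := by
    by_contra h
    rw [List.getElem?_eq_none (by omega)] at hx
    cases hx
  have e1 : k - (i + 1) = (j - (i + 1)) + ((k - (j + 1)) + 1) := by omega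
  rw [e1, List.take_add, List.drop_drop]
  have e2 : i + 1 + (j - (i + 1)) = j := by omega
  rw [e2, List.drop_eq_getElem_cons hj, List.take_succ_cons]
  rw [List.getElem?_eq_getElem hj] at hx
  cases hx
  rfl

theorem IsPaired.right_unique {c c' : Letter} (hc : c ≠ c') {u : List Letter} {i j k : ℕ}
    (h : IsPaired c c' u i j) (h' : IsPaired c c' u i k) : j = k := by
  have key : ∀ {j k : ℕ}, IsPaired c c' u i j → IsPaired c c' u i k → ¬ j < k := by
    intro j k h h' hjk
    obtain ⟨hij, -, hj, -, hbal, -⟩ := h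
    obtain ⟨-, -, -, -, -, hpre⟩ := h'
    have hs := drop_take_split u hij hjk hj
    have := hpre (subwordBetween c c' u i j ++ [c']) (by
      unfold subwordBetween
      rw [hs, List.filter_append, List.filter_cons]
      simp)
    simp [List.count_append, hbal, hc.symm] at this
  rcases lt_trichotomy j k with h1 | h1 | h1
  · exact absurd h1 (key h h')
  · exact h1
  · exact absurd h1 (key h' h)

theorem IsPaired.left_unique {c c' : Letter} (hc : c ≠ c') {u : List Letter} {i j k : ℕ}
    (h : IsPaired c c' u i k) (h' : IsPaired c c' u j k) : i = j := by
  have key : ∀ {i j : ℕ}, IsPaired c c' u i k → IsPaired c c' u j k → ¬ i < j := by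
    intro i j h h' hij
    obtain ⟨-, -, -, -, hbal, hpre⟩ := h
    obtain ⟨hjk, hj, -, -, hbal', -⟩ := h'
    have hs := drop_take_split u hij hjk hj
    have e : subwordBetween c c' u i k =
        subwordBetween c c' u i j ++ c :: subwordBetween c c' u j k := by
      unfold subwordBetween
      rw [hs, List.filter_append, List.filter_cons]
      simp
    have := hpre (subwordBetween c c' u i j) (by rw [e]; exact List.prefix_append _ _)
    rw [e] at hbal
    simp [List.count_append, hc] at hbal
    omega
  rcases lt_trichotomy i j with h1 | h1 | h1
  · exact absurd h1 (key h h')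
  · exact h1
  · exact absurd h1 (key h' h)

/-! ### Permutations -/

open Classical in
/-- The partner of `x` in a partial matching `R`, or `x` itself if it is unmatched. -/
noncomputable def partner {X : Type} (R : X → X → Prop) (x : X) : X :=
  if h : ∃ y, R x y then h.choose else x

theorem partner_eq {X : Type} {R : X → X → Prop} (hu : ∀ x y z, R x y → R x z → y = z) {x y : X}
    (h : R x y) : partner R x = y := by
  have h' : ∃ y, R x y := ⟨y, h⟩
  unfold partner
  rw [dif_pos h']
  exact hu _ _ _ h'.choose_spec h

theorem partner_of_not {X : Type} {R : X → X → Prop} {x : X} (h : ¬ ∃ y, R x y) :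
    partner R x = x := by
  unfold partner
  rw [dif_neg h]

theorem partner_involutive {X : Type} {R : X → X → Prop} (hs : ∀ x y, R x y → R y x)
    (hu : ∀ x y z, R x y → R x z → y = z) : Function.Involutive (partner R) := by
  intro x
  by_cases h : ∃ y, R x y
  · obtain ⟨y, hy⟩ := h
    rw [partner_eq hu hy, partner_eq hu (hs _ _ hy)]
  · rw [partner_of_not h, partner_of_not h]

/-- The involution exchanging the pairs of a partial matching `R` and fixing the unmatched
elements. -/
noncomputable def matchPerm {X : Type} (R : X → X → Prop) (hs : ∀ x y, R x y → R y x)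
    (hu : ∀ x y z, R x y → R x z → y = z) : Perm X :=
  (partner_involutive hs hu).toPerm

/-- The least `n ≥ 1` such that `(σ ^ n) x` carries the same label as `x`. -/
noncomputable def returnTime {X Y : Type} (σ : Perm X) (f : X → Y) (x : X) : ℕ :=
  sInf {n | 1 ≤ n ∧ f ((σ ^ n) x) = f x}

theorem returnTime_spec {X Y : Type} [Finite X] (σ : Perm X) (f : X → Y) (x : X) :
    1 ≤ returnTime σ f x ∧ f ((σ ^ returnTime σ f x) x) = f x :=
  Nat.sInf_mem (s := {n | 1 ≤ n ∧ f ((σ ^ n) x) = f x})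
    ⟨orderOf σ, orderOf_pos σ, by simp [pow_orderOf_eq_one]⟩

theorem returnTime_inv {X Y : Type} [Finite X] (σ : Perm X) (f : X → Y) (x : X) :
    returnTime σ⁻¹ f ((σ ^ returnTime σ f x) x) = returnTime σ f x := by
  obtain ⟨h1, h2⟩ := returnTime_spec σ f x
  have back : ∀ m ≤ returnTime σ f x,
      (σ⁻¹ ^ m) ((σ ^ returnTime σ f x) x) = (σ ^ (returnTime σ f x - m)) x := by
    intro m hm
    conv_lhs => rw [← Nat.add_sub_cancel' hm, pow_add]
    simp [Perm.mul_apply]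
  apply le_antisymm
  · refine Nat.sInf_le ⟨h1, ?_⟩
    rw [back _ le_rfl, h2]
    simp
  · obtain ⟨h3, h4⟩ := returnTime_spec σ⁻¹ f ((σ ^ returnTime σ f x) x)
    by_contra hlt
    push Not at hlt
    rw [back _ hlt.le, h2] at h4
    have := Nat.sInf_le (s := {n | 1 ≤ n ∧ f ((σ ^ n) x) = f x}) ⟨by omega, h4⟩
    change returnTime σ f x ≤ _ at this
    omega

/-- The first-return permutation: `x` goes to the first of `σ x`, `σ (σ x)`, … that carries the
same label as `x`. -/
noncomputable def returnPerm {X Y : Type} [Finite X] (σ : Perm X) (f : X → Y) : Perm X where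
  toFun x := (σ ^ returnTime σ f x) x
  invFun x := (σ⁻¹ ^ returnTime σ⁻¹ f x) x
  left_inv x := by
    beta_reduce
    rw [returnTime_inv]
    simp
  right_inv x := by
    have := returnTime_inv σ⁻¹ f x
    rw [inv_inv] at this
    beta_reduce
    rw [this]
    simp

theorem returnPerm_label {X Y : Type} [Finite X] (σ : Perm X) (f : X → Y) (x : X) :
    f (returnPerm σ f x) = f x :=
  (returnTime_spec σ f x).2

/-- The orbits (cycles, including fixed points) of a permutation. -/
abbrev Orbit {X : Type} (σ : Perm X) : Type := Quotient (Perm.SameCycle.setoid σ)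

/-- The orbit of `x`. -/
def orbitOf {X : Type} (σ : Perm X) (x : X) : Orbit σ := Quotient.mk _ x

/-! ### Rooted maps -/

/-- The data of a rooted map on a surface, as a rotation system: vertices `V`, half-edges `D`, the
vertex to which a half-edge is incident, the half-edge `cw d` following `d` in clockwise order
around its vertex, the other half `opp d` of the edge of `d`, and the root, which is a half-edge
that is not part of an edge. -/
structure RootedMap where
  V : Type
  D : Type
  finV : Finite V
  finD : Finite D
  vert : D → V
  cw : Perm D
  opp : Perm D
  root : D

attribute [instance] RootedMap.finV RootedMap.finD

namespace RootedMap

/-- Following a border: cross to the other half of the edge, then turn to the next half-edge around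
the vertex reached. The faces are the orbits. -/
def face (M : RootedMap) : Perm M.D := M.cw * M.opp

/-- The edges: the pairs `{d, opp d}`, with the root left out. -/
abbrev Edge (M : RootedMap) : Type := {e : Orbit M.opp // e ≠ orbitOf M.opp M.root}

/-- `M` is a rooted planar map: `opp` is an involution whose only fixed point is the root, `cw`
turns through all the half-edges of each vertex, `M` is connected, and Euler's formula holds. -/
structure IsPlanarMap (M : RootedMap) : Prop where
  opp_opp : ∀ d, M.opp (M.opp d) = d
  opp_eq_self : ∀ d, M.opp d = d ↔ d = M.root
  rotation : ∀ d e, M.vert d = M.vert e ↔ M.cw.SameCycle d e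
  connected : ∀ x y, Relation.ReflTransGen
    (fun x y => ∃ d, M.vert d = x ∧ M.vert (M.opp d) = y) x y
  euler : Nat.card M.V + Nat.card (Orbit M.face) = Nat.card M.Edge + 2

/-- A (planted plane) tree is a rooted planar map with a single face. -/
structure IsTree (M : RootedMap) : Prop extends M.IsPlanarMap where
  one_face : Nat.card (Orbit M.face) = 1

/-- Isomorphisms of rooted maps (they preserve the orientation). -/
structure Iso (M N : RootedMap) where
  onV : M.V ≃ N.V
  onD : M.D ≃ N.D
  vert_eq : ∀ d, N.vert (onD d) = onV (M.vert d)
  cw_eq : ∀ d, N.cw (onD d) = onD (M.cw d)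
  opp_eq : ∀ d, N.opp (onD d) = onD (M.opp d)
  root_eq : onD M.root = N.root

/-- The map obtained by contracting the edges whose half-edges are in `S`: the ends of these edges
are identified, and turning around a vertex one crosses the contracted edges. -/
noncomputable def contract (M : RootedMap) (S : M.D → Prop) (hS : ∀ d, S (M.opp d) ↔ S d)
    (hroot : ¬ S M.root) : RootedMap where
  V := Quot (fun x y => ∃ d, S d ∧ M.vert d = x ∧ M.vert (M.opp d) = y)
  D := {d // ¬ S d}
  finV := Quot.finite _
  finD := inferInstance
  vert d := Quot.mk _ (M.vert d.1)
  cw := (returnPerm M.face S).subtypePerm (p := fun d => ¬ S d)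
      (fun d => not_congr (iff_of_eq (returnPerm_label M.face S d)))
    * (M.opp.subtypePerm (p := fun d => ¬ S d) (fun d => not_congr (hS d)))⁻¹
  opp := M.opp.subtypePerm (p := fun d => ¬ S d) (fun d => not_congr (hS d))
  root := ⟨M.root, hroot⟩

end RootedMap

/-! ### Binary trees -/

inductive Side
  | left | right
  deriving DecidableEq

/-- A binary tree whose leaves are active (`true`) or inactive (`false`). -/
inductive BinTree
  | leaf (active : Bool)
  | node (l r : BinTree)

namespace BinTree

/-- A vertex is addressed by the sides taken on the way from it up to the root-vertex: `s :: p` is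
the son on side `s` of `p`, and `[]` is the root-vertex. -/
abbrev Address := List Side

/-- The subtree hanging from the root-vertex on a side, if this is a node. -/
def son : BinTree → Side → Option BinTree
  | leaf _, _ => none
  | node l _, .left => some l
  | node _ r, .right => some r

/-- The subtree hanging at an address. -/
def sub (B : BinTree) : Address → Option BinTree
  | [] => some B
  | s :: p => (sub B p).bind (fun C => C.son s)

def IsVertex (B : BinTree) (p : Address) : Prop := (B.sub p).isSome

def IsNode (B : BinTree) (p : Address) : Prop := ∃ l r, B.sub p = some (node l r)

def IsLeaf (B : BinTree) (p : Address) : Prop := ∃ act, B.sub p = some (leaf act)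

theorem isVertex_cons (B : BinTree) (s : Side) (p : Address) :
    B.IsVertex (s :: p) ↔ B.IsNode p := by
  unfold IsVertex IsNode
  rw [sub]
  rcases B.sub p with _ | ⟨_ | ⟨l, r⟩⟩ <;> cases s <;> simp [son]

theorem IsNode.isVertex {B : BinTree} {p : Address} (h : B.IsNode p) : B.IsVertex p := by
  obtain ⟨l, r, h⟩ := h
  simp [IsVertex, h]

theorem IsLeaf.isVertex {B : BinTree} {p : Address} (h : B.IsLeaf p) : B.IsVertex p := by
  obtain ⟨_, h⟩ := h
  simp [IsVertex, h]

theorem isVertex_tail {B : BinTree} {p : Address} (h : B.IsVertex p) : B.IsVertex p.tail := by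
  cases p with
  | nil => exact h
  | cons s p => exact ((isVertex_cons B s p).1 h).isVertex

def depth : BinTree → ℕ
  | leaf _ => 0
  | node l r => max l.depth r.depth + 1

theorem length_add_depth_le (B : BinTree) :
    ∀ (p : Address) (C : BinTree), B.sub p = some C → p.length + C.depth ≤ B.depth := by
  intro p
  induction p with
  | nil => intro C h; simp only [sub, Option.some.injEq] at h; subst h; simp
  | cons s p ih =>
    intro C h
    rw [sub] at h
    rcases hp : B.sub p with _ | ⟨_ | ⟨l, r⟩⟩ <;> simp only [hp, Option.bind] at h <;>
      cases s <;> simp [son] at h <;>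
      subst h <;> have := ih _ hp <;> simp only [depth, List.length_cons] at this ⊢ <;> omega

instance : Finite Side :=
  Finite.of_injective (fun s : Side => decide (s = .left)) (by
    intro s t; cases s <;> cases t <;> simp)

instance (B : BinTree) : Finite {p // B.IsVertex p} :=
  Set.Finite.subset (List.finite_length_le Side B.depth) (by
    intro p hp
    obtain ⟨C, hC⟩ := Option.isSome_iff_exists.1 hp
    have := B.length_add_depth_le p C hC
    simp only [Set.mem_ofPred_eq]
    omega)

/-- The half-edges of `B`: the half-edge `(p, false)` of the vertex `p` in the direction of its
father (this is the root for `p = []`), and the half-edge `(p, true)` of the father of `p ≠ []` in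
the direction of `p`. -/
abbrev HalfEdge (B : BinTree) : Type :=
  {d : Address × Bool // B.IsVertex d.1 ∧ (d.2 = true → d.1 ≠ [])}

open Classical in
/-- Clockwise around a node: father (or root), right son, left son. -/
noncomputable def cwFun (B : BinTree) : Address × Bool → Address × Bool
  | (p, false) => if B.IsNode p then (.right :: p, true) else (p, false)
  | (.right :: p, true) => (.left :: p, true)
  | (.left :: p, true) => (p, false)
  | ([], true) => ([], true)

open Classical in
/-- Counterclockwise around a node: father (or root), left son, right son. -/
noncomputable def ccwFun (B : BinTree) : Address × Bool → Address × Bool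
  | (p, false) => if B.IsNode p then (.left :: p, true) else (p, false)
  | (.left :: p, true) => (.right :: p, true)
  | (.right :: p, true) => (p, false)
  | ([], true) => ([], true)

noncomputable def cw (B : BinTree) : Perm B.HalfEdge where
  toFun d := ⟨B.cwFun d.1, by
    obtain ⟨⟨p, _ | _⟩, h1, h2⟩ := d
    · by_cases h : B.IsNode p
      · simp [cwFun, h, isVertex_cons]
      · simpa [cwFun, h] using h1
    · rcases p with _ | ⟨_ | _, p⟩
      · simp at h2
      · simpa [cwFun] using isVertex_tail h1
      · simpa [cwFun, isVertex_cons] using h1⟩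
  invFun d := ⟨B.ccwFun d.1, by
    obtain ⟨⟨p, _ | _⟩, h1, h2⟩ := d
    · by_cases h : B.IsNode p
      · simp [ccwFun, h, isVertex_cons]
      · simpa [ccwFun, h] using h1
    · rcases p with _ | ⟨_ | _, p⟩
      · simp at h2
      · simpa [ccwFun, isVertex_cons] using h1
      · simpa [ccwFun] using isVertex_tail h1⟩
  left_inv d := by
    obtain ⟨⟨p, _ | _⟩, h1, h2⟩ := d
    · by_cases h : B.IsNode p
      · simp [cwFun, ccwFun, h]
      · simp [cwFun, ccwFun, h]
    · rcases p with _ | ⟨_ | _, p⟩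
      · simp at h2
      · have h : B.IsNode p := (isVertex_cons B _ p).1 h1
        simp [cwFun, ccwFun, h]
      · simp [cwFun, ccwFun]
  right_inv d := by
    obtain ⟨⟨p, _ | _⟩, h1, h2⟩ := d
    · by_cases h : B.IsNode p
      · simp [cwFun, ccwFun, h]
      · simp [cwFun, ccwFun, h]
    · rcases p with _ | ⟨_ | _, p⟩
      · simp at h2
      · simp [cwFun, ccwFun]
      · have h : B.IsNode p := (isVertex_cons B _ p).1 h1
        simp [cwFun, ccwFun, h]

open Classical in
/-- The other half of the edge of a half-edge; the root is fixed. -/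
noncomputable def oppFun (B : BinTree) (d : B.HalfEdge) : B.HalfEdge :=
  if h : d.1.1 = [] then d else ⟨(d.1.1, !d.1.2), d.2.1, fun _ => h⟩

theorem oppFun_fst (B : BinTree) (d : B.HalfEdge) : (B.oppFun d).1.1 = d.1.1 := by
  unfold oppFun
  split_ifs <;> rfl

theorem oppFun_involutive (B : BinTree) : Function.Involutive B.oppFun := by
  intro d
  by_cases h : d.1.1 = []
  · simp [oppFun, h]
  · simp [oppFun, h]

noncomputable def opp (B : BinTree) : Perm B.HalfEdge := B.oppFun_involutive.toPerm

theorem opp_fst (B : BinTree) (d : B.HalfEdge) : (B.opp d).1.1 = d.1.1 := B.oppFun_fst d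

/-- The binary tree as a rooted map. -/
noncomputable def toMap (B : BinTree) : RootedMap where
  V := {p // B.IsVertex p}
  D := B.HalfEdge
  finV := inferInstance
  finD := Finite.of_injective
    (fun d : B.HalfEdge => ((⟨d.1.1, d.2.1⟩ : {p // B.IsVertex p}), d.1.2)) (by
      intro d e h
      simp only [Prod.mk.injEq, Subtype.mk.injEq] at h
      exact Subtype.ext (Prod.ext h.1 h.2))
  vert d := if d.1.2 then ⟨d.1.1.tail, isVertex_tail d.2.1⟩ else ⟨d.1.1, d.2.1⟩
  cw := B.cw
  opp := B.opp
  root := ⟨([], false), by simp [IsVertex, sub]⟩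

def IsLeftSon (p : Address) : Prop := p.head? = some .left

def IsRightSon (p : Address) : Prop := p.head? = some .right

/-- The edge from `p ≠ []` to its father is branching: one of its ends is a right son and the other
is a left son or the root-vertex. -/
def IsBranching (p : Address) : Prop :=
  p ≠ [] ∧ ((IsRightSon p ∧ (IsLeftSon p.tail ∨ p.tail = [])) ∨
    (IsRightSon p.tail ∧ IsLeftSon p))

/-- The half-edges of the non-branching edges. -/
def IsNonBranching {B : BinTree} (d : B.HalfEdge) : Prop := d.1.1 ≠ [] ∧ ¬ IsBranching d.1.1

theorem isNonBranching_opp {B : BinTree} (d : B.HalfEdge) :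
    IsNonBranching (B.opp d) ↔ IsNonBranching d := by
  unfold IsNonBranching
  rw [opp_fst]

/-- The tree `θ(B)`: every non-branching edge of `B` is contracted. -/
noncomputable def theta (B : BinTree) : RootedMap :=
  B.toMap.contract IsNonBranching isNonBranching_opp (fun h => h.1 rfl)

/-- The leaves of `B`. -/
abbrev Leaf (B : BinTree) : Type := {p // B.IsLeaf p}

def Leaf.IsActive {B : BinTree} (l : B.Leaf) : Prop := B.sub l.1 = some (leaf true)

/-- The vertex of `θ(B)` associated with a leaf `l`: the vertex into which `l` is contracted. (The
edges on the way up from `l` are contracted until the branching edge `e(l)` is met, if any, so this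
is the son of `e(l)`, or the root-vertex if there is no such edge.) -/
noncomputable def Leaf.vertex {B : BinTree} (l : B.Leaf) : B.theta.V :=
  Quot.mk _ (⟨l.1, l.2.isVertex⟩ : {p // B.IsVertex p})

/-- The leaves with their activities, in the order of appearance around the tree; `p` is the address
of the root-vertex of `B` in an ambient tree. -/
def leavesFrom (p : Address) : BinTree → List (Address × Bool)
  | leaf act => [(p, act)]
  | node l r => leavesFrom (.left :: p) l ++ leavesFrom (.right :: p) r

/-- All the leaves in the order of appearance around the tree. -/
def leafList (B : BinTree) : List Address := (leavesFrom [] B).map Prod.fst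

/-- The active leaves on side `s` in the order of appearance around the tree. -/
def activeLeaves (B : BinTree) (s : Side) : List Address :=
  ((leavesFrom [] B).filter (fun x => x.2 && decide (x.1.head? = some s))).map Prod.fst

/-- The leaf `l` precedes the leaf `l'` around `B`. -/
def Leaf.Precedes {B : BinTree} (l l' : B.Leaf) : Prop :=
  B.leafList.idxOf l.1 < B.leafList.idxOf l'.1

/-- Replace by `C` the subtree to which one descends along the given sides. -/
def replaceDown : BinTree → List Side → BinTree → BinTree
  | _, [], C => C
  | node l r, .left :: q, C => node (replaceDown l q C) r
  | node l r, .right :: q, C => node l (replaceDown r q C)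
  | leaf act, _ :: _, _ => leaf act

/-- Replace the subtree at an address, if there is one. -/
def replaceAt (B : BinTree) (p : Option Address) (C : BinTree) : BinTree :=
  match p with
  | some p => B.replaceDown p.reverse C
  | none => B

/-- The binary tree `B₁` with one node and two active leaves. -/
def B₁ : BinTree := node (leaf true) (leaf true)

/-- The effect of a letter appended to the word. -/
def step (B : BinTree) : Letter → BinTree
  | .a => B.replaceAt (B.activeLeaves .left).getLast? B₁
  | .b => B.replaceAt (B.activeLeaves .right).head? B₁
  | .abar => B.replaceAt (B.activeLeaves .right).head? (leaf false)
  | .bbar => B.replaceAt (B.activeLeaves .left).getLast? (leaf false)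

end BinTree

/-- The binary tree `λ₁(w)`. -/
def lambda₁ (w : List Letter) : BinTree := w.foldl BinTree.step BinTree.B₁

/-! ### The prefix-map `M_w` -/

namespace PrefixMap

/-- The word `w⁺`: `w` followed by as many letters `ā` as there are non-paired letters `a`. -/
def plus (w : List Letter) : List Letter :=
  w ++ List.replicate (w.count .a - w.count .abar) .abar

/-- The half-edges of `M_w`, in the order in which the tour of `T_w` meets them: `0` is the root,
and `i + 1` is the half-edge that is met when the letter at position `i` of `w⁺` is written. This is
the tail of a tree edge for `a` (the edge is followed for the first time, from the father to the
son), the head of a tree edge for `ā`, a head not in the tree for `b`, a tail not in the tree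
for `b̄`. -/
abbrev HalfEdge (w : List Letter) : Type := Fin ((plus w).length + 1)

def root (w : List Letter) : HalfEdge w := 0

/-- `d` carries the letter `c`. -/
def HasLetter (w : List Letter) (d : HalfEdge w) (c : Letter) : Prop :=
  ∃ i, d.val = i + 1 ∧ (plus w)[i]? = some c

/-- The letters of `d` and `e` are paired, in one order or the other. -/
def Linked (w : List Letter) (c c' : Letter) (d e : HalfEdge w) : Prop :=
  ∃ i j, d.val = i + 1 ∧ e.val = j + 1 ∧
    (IsPaired c c' (plus w) i j ∨ IsPaired c c' (plus w) j i)

theorem Linked.symm {w : List Letter} {c c' : Letter} {d e : HalfEdge w}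
    (h : Linked w c c' d e) : Linked w c c' e d := by
  obtain ⟨i, j, h1, h2, h3⟩ := h
  exact ⟨j, i, h2, h1, h3.symm⟩

theorem Linked.letter {w : List Letter} {c c' : Letter} {d e : HalfEdge w}
    (h : Linked w c c' d e) : HasLetter w d c ∨ HasLetter w d c' := by
  obtain ⟨i, j, h1, h2, h3 | h3⟩ := h
  · exact Or.inl ⟨i, h1, h3.2.1⟩
  · exact Or.inr ⟨i, h1, h3.2.2.1⟩

theorem HasLetter.unique {w : List Letter} {c c' : Letter} {d : HalfEdge w}
    (h : HasLetter w d c) (h' : HasLetter w d c') : c = c' := by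
  obtain ⟨i, h1, h2⟩ := h
  obtain ⟨j, h3, h4⟩ := h'
  obtain rfl : i = j := by omega
  rw [h2] at h4
  exact Option.some.inj h4

theorem Linked.unique {w : List Letter} {c c' : Letter} (hc : c ≠ c') {d e f : HalfEdge w}
    (h : Linked w c c' d e) (h' : Linked w c c' d f) : e = f := by
  obtain ⟨i, j, h1, h2, h3⟩ := h
  obtain ⟨i', k, h1', h2', h3'⟩ := h'
  obtain rfl : i = i' := by omega
  have : j = k := by
    rcases h3 with h3 | h3 <;> rcases h3' with h3' | h3'
    · exact h3.right_unique hc h3'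
    · exact absurd (Option.some.inj (h3.2.1.symm.trans h3'.2.2.1)) hc
    · exact absurd (Option.some.inj (h3'.2.1.symm.trans h3.2.2.1)) hc
    · exact h3.left_unique hc h3'
  subst this
  exact Fin.ext (by omega)

/-- The involution exchanging the two halves of each edge of the tree `T_w`. -/
noncomputable def treeOpp (w : List Letter) : Perm (HalfEdge w) :=
  matchPerm (Linked w .a .abar) (fun _ _ h => h.symm) (fun _ _ _ h h' => h.unique (by simp) h')

/-- The half-edge following `d` in counterclockwise order around its vertex. The tour of `T_w` goes
counterclockwise around the tree. When it meets a half-edge `d`, it follows the edge of `d` if this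
is in the tree, crosses `d` otherwise, and then meets the next half-edge in counterclockwise order
after the half-edge `treeOpp w d` on which it has arrived. As the tour meets the half-edges in
cyclic order, `ccw w (treeOpp w d) = d + 1`. -/
noncomputable def ccw (w : List Letter) : Perm (HalfEdge w) :=
  finRotate _ * (treeOpp w)⁻¹

/-- The involution exchanging the two halves of each edge of `M_w`: the edges in `T_w`, and the
edges made of the heads and tails of paired letters `b` and `b̄`. -/
noncomputable def opp (w : List Letter) : Perm (HalfEdge w) :=
  matchPerm (fun d e => Linked w .a .abar d e ∨ Linked w .b .bbar d e)
    (fun _ _ h => h.imp Linked.symm Linked.symm) (by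
      rintro d e f (h | h) (h' | h')
      · exact h.unique (by simp) h'
      · exfalso
        rcases h.letter with h | h <;> rcases h'.letter with h' | h' <;> cases h.unique h'
      · exfalso
        rcases h.letter with h | h <;> rcases h'.letter with h' | h' <;> cases h.unique h'
      · exact h.unique (by simp) h')

theorem opp_root (w : List Letter) : opp w (root w) = root w := by
  change partner (fun d e => Linked w .a .abar d e ∨ Linked w .b .bbar d e) (root w) = root w
  refine partner_of_not ?_
  rintro ⟨y, h | h⟩ <;>
  · obtain ⟨i, _, h, _⟩ := h
    simp [root] at h

/-- The heads; the root is one of them. The other half-edges are tails. -/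
def IsHead (w : List Letter) (d : HalfEdge w) : Prop :=
  d = root w ∨ HasLetter w d .abar ∨ HasLetter w d .b

abbrev Head (w : List Letter) : Type := {d : HalfEdge w // IsHead w d}

def rootHead (w : List Letter) : Head w := ⟨root w, Or.inl rfl⟩

/-- The dangling heads: the heads of the non-paired letters `b`. -/
def IsDangling (w : List Letter) (d : HalfEdge w) : Prop :=
  HasLetter w d .b ∧ ¬ ∃ e, Linked w .b .bbar d e

/-- The rooting heads: the root, and the heads of the active edges, that is, of the tree edges of
which the letter `a` is not paired in `w`. -/
def IsRooting (w : List Letter) (d : HalfEdge w) : Prop :=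
  d = root w ∨ ∃ i j, d.val = j + 1 ∧ IsPaired .a .abar (plus w) i j ∧
    ¬ ∃ k, IsPaired .a .abar w i k

/-- The time at which the vertex of `d` first appears in the tour of `T_w`. -/
noncomputable def firstVisit (w : List Letter) (d : HalfEdge w) : ℕ :=
  sInf {n | ∃ e : HalfEdge w, (ccw w).SameCycle d e ∧ e.val = n}

/-! ### The exploded map `M★_w` -/

/-- The head following a head in counterclockwise order around its vertex in `M_w`. -/
noncomputable def nextHead (w : List Letter) : Perm (Head w) :=
  (returnPerm (ccw w) (IsHead w)).subtypePerm
    (fun d => iff_of_eq (returnPerm_label (ccw w) (IsHead w) d))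

/-- The half-edges of `M★_w`: those of `M_w`, and two for every permeable edge. A vertex `v` of `M_w`
is replaced by a cell (a black face) with one vertex `x_h` on its border for each head `h` at `v`.
These vertices are in the cyclic order of the heads around `v`, and the border of the cell consists
of one permeable edge from `x_h` to `x_{h'}` for each `h`, where `h' = nextHead h`. `near h` is the
half of this edge at `x_h`, and `far h` the half at `x_{h'}`. -/
abbrev StarHalfEdge (w : List Letter) : Type := HalfEdge w ⊕ (Head w ⊕ Head w)

def old {w : List Letter} (d : HalfEdge w) : StarHalfEdge w := Sum.inl d

def near {w : List Letter} (h : Head w) : StarHalfEdge w := Sum.inr (Sum.inl h)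

def far {w : List Letter} (h : Head w) : StarHalfEdge w := Sum.inr (Sum.inr h)

/-- The two halves of an edge of `M★_w`. -/
noncomputable def starOpp (w : List Letter) : Perm (StarHalfEdge w) :=
  Equiv.sumCongr (opp w) (Equiv.sumComm (Head w) (Head w))

open Classical in
/-- Counterclockwise order around the vertices of `M★_w`. A tail is attached to `x_h` for the first
head `h` that follows it counterclockwise in `M_w`. Around `x_h` there are, in this order: `h`; the
permeable edge to the next head; the black cell; the permeable edge from the previous head `h₀`; the
tails between `h₀` and `h` in the order of `M_w`. -/
noncomputable def starCcw (w : List Letter) : Perm (StarHalfEdge w) where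
  toFun
    | Sum.inl d => if h : IsHead w d then near ⟨d, h⟩ else old (ccw w d)
    | Sum.inr (Sum.inl h) => far ((nextHead w).symm h)
    | Sum.inr (Sum.inr h) => old (ccw w h.1)
  invFun
    | Sum.inl d => if h : IsHead w ((ccw w).symm d) then far ⟨_, h⟩ else old ((ccw w).symm d)
    | Sum.inr (Sum.inl h) => old h.1
    | Sum.inr (Sum.inr h) => near (nextHead w h)
  left_inv := by
    rintro (d | h | h)
    · by_cases hd : IsHead w d <;> simp [hd, near, old]
    · simp [near, far]
    · simp [far, old, h.2]
  right_inv := by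
    rintro (d | h | h)
    · by_cases hd : IsHead w ((ccw w).symm d) <;> simp [hd, far, old]
    · simp [old, near, h.2]
    · simp [near, far]

/-- Following the border of the faces of `M★_w`. The border of the root-face is followed from the
root in the direction of the tour of `T_w`. As one turns to the next half-edge counterclockwise at
each vertex, the face is on the right, and its border is followed clockwise around its inner
points. -/
noncomputable def starFace (w : List Letter) : Perm (StarHalfEdge w) := starCcw w * starOpp w

/-- The faces of `M★_w`. -/
abbrev Face (w : List Letter) : Type := Orbit (starFace w)

noncomputable def faceOf {w : List Letter} (d : StarHalfEdge w) : Face w := orbitOf (starFace w) d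

noncomputable def rootFace (w : List Letter) : Face w := faceOf (old (root w))

/-- The white faces correspond to the faces of `M_w`: there are half-edges of `M_w` on their
border. -/
def IsWhiteFace {w : List Letter} (f : Face w) : Prop := ∃ d : HalfEdge w, f = faceOf (old d)

/-- The black face corresponding to the vertex of `M_w` to which the head `h` is incident. -/
noncomputable def cell {w : List Letter} (h : Head w) : Face w := faceOf (far h)

/-- The black faces correspond to the vertices of `M_w`. -/
def IsBlackFace {w : List Letter} (f : Face w) : Prop := ∃ h : Head w, f = cell h

/-- The number of steps after which `d` is met around the root-face, starting from the root. -/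
noncomputable def rank {w : List Letter} (d : StarHalfEdge w) : ℕ :=
  sInf {n | ((starFace w) ^ n) (old (root w)) = d}

/-! ### The partition-tree `P_w` -/

abbrev Dangling (w : List Letter) : Type := {d : HalfEdge w // IsDangling w d}

/-- The vertices of `P_w`: one in each face of `M★_w`, and one more for each dangling head. -/
abbrev PVertex (w : List Letter) : Type := Face w ⊕ Dangling w

/-- The exterior vertex `v₀`. -/
noncomputable def exterior (w : List Letter) : PVertex w := Sum.inl (rootFace w)

/-- The half-edges of `P_w`: its root, which is identified with the root of `M★_w`, and for each
half `d` of a permeable edge, one half of the dual edge, which is in the face that has `d` on its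
border. -/
def IsPHalfEdge {w : List Letter} (d : StarHalfEdge w) : Prop :=
  d = old (root w) ∨ (∃ h, d = near h) ∨ ∃ h, d = far h

/-- `h` is the last dangling head encountered before `d` around the root-face. -/
def IsLastDanglingBefore {w : List Letter} (h : Dangling w) (d : StarHalfEdge w) : Prop :=
  (faceOf (old h.1) = rootFace w ∧ rank (old h.1) < rank d) ∧
    ∀ h' : Dangling w, faceOf (old h'.1) = rootFace w → rank (old h'.1) < rank d →
      rank (old h'.1) ≤ rank (old h.1)

open Classical in
/-- The vertex of `P_w` to which a half-edge of `P_w` is incident. -/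
noncomputable def pvert {w : List Letter} (d : StarHalfEdge w) : PVertex w :=
  if faceOf d = rootFace w then
    if h : ∃ h : Dangling w, IsLastDanglingBefore h d then Sum.inr h.choose else exterior w
  else Sum.inl (faceOf d)

open Classical in
/-- Half-edges of `P_w` are labelled by the vertex to which they are incident. -/
noncomputable def plabel {w : List Letter} (d : StarHalfEdge w) : Option (PVertex w) :=
  if IsPHalfEdge d then some (pvert d) else none

theorem plabel_isSome {w : List Letter} (d : StarHalfEdge w) :
    (plabel d).isSome ↔ IsPHalfEdge d := by
  unfold plabel
  split_ifs with h <;> simp [h]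

theorem isPHalfEdge_return {w : List Letter} (d : StarHalfEdge w) :
    IsPHalfEdge (returnPerm (starFace w) plabel d) ↔ IsPHalfEdge d := by
  rw [← plabel_isSome, ← plabel_isSome, returnPerm_label (starFace w) plabel d]

theorem isPHalfEdge_starOpp {w : List Letter} (d : StarHalfEdge w) :
    IsPHalfEdge (starOpp w d) ↔ IsPHalfEdge d := by
  rcases d with d | h | h
  · have : opp w d = root w ↔ d = root w := by
      rw [← (opp w).injective.eq_iff (a := d), opp_root]
    simp [IsPHalfEdge, starOpp, old, near, far, this]
  · simp [IsPHalfEdge, starOpp, old, near, far]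
  · simp [IsPHalfEdge, starOpp, old, near, far]

/-- The partition-tree `P_w`. The half-edges at a vertex drawn in a face are in the order in which
the border of the face is followed, which is clockwise. In particular the dual of the first edge
around the root-face follows the root in clockwise order around `v₀`. -/
noncomputable def partitionTree (w : List Letter) : RootedMap where
  V := PVertex w
  D := {d : StarHalfEdge w // IsPHalfEdge d}
  finV := inferInstance
  finD := inferInstance
  vert d := pvert d.1
  cw := (returnPerm (starFace w) plabel).subtypePerm isPHalfEdge_return
  opp := (starOpp w).subtypePerm isPHalfEdge_starOpp
  root := ⟨old (root w), Or.inl rfl⟩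

/-- The white vertices of `P_w`. -/
def IsWhite {w : List Letter} : PVertex w → Prop
  | Sum.inl f => IsWhiteFace f
  | Sum.inr _ => True

/-- The black vertices of `P_w`. -/
def IsBlack {w : List Letter} : PVertex w → Prop
  | Sum.inl f => IsBlackFace f
  | Sum.inr _ => False

/-- The active vertices: `v₀`, the vertices associated with the dangling heads, and the black
vertices corresponding to the rooting vertices of `M_w`. -/
def IsActive {w : List Letter} : PVertex w → Prop
  | Sum.inl f => f = rootFace w ∨ ∃ h : Head w, IsRooting w h.1 ∧ f = cell h
  | Sum.inr _ => True

/-- The position of an active white vertex around the root-face: that of its dangling head, and `0`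
for `v₀`. -/
noncomputable def whiteRank {w : List Letter} : PVertex w → ℕ
  | Sum.inl _ => 0
  | Sum.inr h => rank (old h.1)

/-- The order on active white vertices: `v₀` comes first, and the others are in the order in which
their dangling heads are encountered around the root-face. -/
def WhitePrecedes {w : List Letter} (x y : PVertex w) : Prop :=
  (IsWhite x ∧ IsActive x) ∧ (IsWhite y ∧ IsActive y) ∧ whiteRank x < whiteRank y

/-- The order on active black vertices: the order of appearance of the rooting vertices around
`T_w`. -/
def BlackPrecedes {w : List Letter} (x y : PVertex w) : Prop :=
  ∃ h h' : Head w, IsRooting w h.1 ∧ IsRooting w h'.1 ∧ x = Sum.inl (cell h) ∧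
    y = Sum.inl (cell h') ∧ firstVisit w h.1 < firstVisit w h'.1

end PrefixMap

/-!
Label the letter at position `i` of `w⁺` by `i + 1`, and the start by `0`. The root has label `0`,
and each other head of `M_w` that of the letter `a` or `b` of its edge. So `0` and the labels of the
letters `a` and `b` index the permeable edges of `M★_w`, hence the edges of `P_w`, and also the
nodes of `λ₁(w)`, since each of these letters creates one node.

While reading the word, keep for each colour a stack of active vertices `(k, e)`, where `k` is the
label that opens the vertex and `e` the last label of an edge attached to it. On the white stack `b`
pushes, `b̄` pops and `a` attaches an edge to the top; on the black stack `a` pushes, `ā` pops and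
`b` attaches an edge to the top. The two stacks govern both sides of the correspondence: they give
the active leaves of `λ₁` in their order, together with the nodes carrying them, and around each
vertex of `P_w` the edges follow each other in the order in which they are attached to it. Hence the
two halves of the edge of label `e` can be sent to the two halves of the unique branching edge from
the node of label `e` to one of its sons. This respects the vertices and, the contraction being
expressed by first-return permutations, also the rotations around them.

It follows that `P_w` is connected with a single face. It has one more vertex than it has edges,
because each vertex other than the root-vertex is opened by the label of exactly one edge.
-/

/-! ### First-return permutations -/

section Via

variable {X Y : Type*} {σ : Perm X} {S : X → Prop} {x y z : X}

/-- `Via σ S x y`: the point `y` is reached from `x` by applying `σ` at least once, all the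
intermediate points being in `S`. When `S` is the set of the points that are skipped by a
first-return permutation of `σ`, this permutation sends `x` to `y`. -/
inductive Via (σ : Perm X) (S : X → Prop) (x : X) : X → Prop
  | single {y : X} (h : σ x = y) : Via σ S x y
  | tail {y z : X} (hxy : Via σ S x y) (hS : S y) (hyz : σ y = z) : Via σ S x z

theorem Via.exists_pow (h : Via σ S x y) :
    ∃ n, 1 ≤ n ∧ (σ ^ n) x = y ∧ ∀ m, 1 ≤ m → m < n → S ((σ ^ m) x) := by
  induction h with
  | single h => exact ⟨1, le_rfl, by simpa using h, fun m h1 h2 => by omega⟩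
  | tail _ hS hyz ih =>
    obtain ⟨n, -, hn, hmem⟩ := ih
    refine ⟨n + 1, by omega, by rw [pow_succ', Perm.mul_apply, hn, hyz], fun m hm1 hmn => ?_⟩
    rcases Nat.lt_succ_iff_lt_or_eq.1 hmn with h | rfl
    · exact hmem m hm1 h
    · rwa [hn]

theorem Via.apply_eq_apply_of_invariant (h : Via σ S x y) (g : X → Y)
    (hg : ∀ z, S z → g (σ z) = g z) : g y = g (σ x) := by
  induction h with
  | single h => rw [h]
  | tail _ hS hyz ih => rw [← hyz, hg _ hS, ih]

theorem apply_eq_of_sameCycle {g : X → Y} (hg : ∀ x, g (σ x) = g x) (h : σ.SameCycle x y) :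
    g x = g y := by
  obtain ⟨n, rfl⟩ := h
  induction n with
  | zero => simp
  | succ n ih => rw [add_comm, zpow_add, zpow_one, Perm.mul_apply, hg, ih]
  | pred n ih =>
    rw [ih, ← hg ((σ ^ (-(n : ℤ) - 1)) x), ← Perm.mul_apply, ← zpow_one_add]
    congr 3
    omega

/-- Two permutations that preserve `g` map `x` to points of the same fibre of `g`; they can only
differ if both images are exceptional points, and a fibre has at most one of these. -/
theorem perm_apply_eq_of_common_preimage {C T : Perm X} {g : X → Y} {s f : X → Prop}
    (hC : ∀ x, g (C x) = g x) (hT : ∀ x, g (T x) = g x)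
    (hCs : ∀ x, s x → s (C x)) (hTs : ∀ x, s x → s (T x))
    (hf : ∀ y z, s y → s z → f y → f z → g y = g z → y = z)
    (h : ∀ y, s y → f y ∨ ∃ x, C x = y ∧ T x = y) (hx : s x) : C x = T x := by
  rcases h _ (hCs x hx) with hfC | ⟨x', hC', hT'⟩
  · rcases h _ (hTs x hx) with hfT | ⟨x', hC', hT'⟩
    · exact hf _ _ (hCs x hx) (hTs x hx) hfC hfT (by rw [hC, hT])
    · rwa [T.injective hT'] at hC'
  · rw [C.injective hC'] at hT'
    exact hT'.symm

end Via

section ReturnPerm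

variable {X Y : Type} {σ : Perm X} {f : X → Y} {x y : X}

theorem returnTime_le {n : ℕ} (hn : 1 ≤ n) (h : f ((σ ^ n) x) = f x) : returnTime σ f x ≤ n :=
  Nat.sInf_le ⟨hn, h⟩

variable [Finite X]

theorem Via.returnPerm_eq {S : X → Prop} (h : Via σ S x y) (hS : ∀ z, S z → f z ≠ f x)
    (hy : f y = f x) : returnPerm σ f x = y := by
  obtain ⟨n, hn1, hn, hmem⟩ := h.exists_pow
  have htime : returnTime σ f x = n := by
    refine le_antisymm (returnTime_le hn1 (by rw [hn, hy])) (not_lt.1 fun hlt => ?_)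
    obtain ⟨h1, hret⟩ := returnTime_spec σ f x
    exact hS _ (hmem _ h1 hlt) hret
  change (σ ^ returnTime σ f x) x = y
  rw [htime, hn]

theorem via_returnPerm (σ : Perm X) (f : X → Y) (x : X) :
    Via σ (fun z => f z ≠ f x) x (returnPerm σ f x) := by
  have via_pow : ∀ n, n + 1 ≤ returnTime σ f x →
      Via σ (fun z => f z ≠ f x) x ((σ ^ (n + 1)) x) := by
    intro n
    induction n with
    | zero => exact fun _ => .single (by simp)
    | succ n ih =>
      refine fun h => (ih (by omega)).tail (fun he => ?_) (by rw [← Perm.mul_apply, ← pow_succ'])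
      have := returnTime_le (by omega) he
      omega
  have h1 := (returnTime_spec σ f x).1
  have := via_pow (returnTime σ f x - 1) (by omega)
  rwa [Nat.sub_add_cancel h1] at this

theorem sameCycle_returnPerm_apply (σ : Perm X) (f : X → Y) (x : X) :
    σ.SameCycle x (returnPerm σ f x) :=
  ⟨returnTime σ f x, by simp [returnPerm]⟩

theorem sameCycle_returnPerm (h : σ.SameCycle x y) (hf : f x = f y) :
    (returnPerm σ f).SameCycle x y := by
  obtain ⟨n, -, hn⟩ := h.exists_pow_eq'
  induction n using Nat.strong_induction_on generalizing x with
  | _ n ih =>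
    rcases Nat.eq_zero_or_pos n with rfl | hpos
    · obtain rfl : x = y := hn
      exact Perm.SameCycle.refl _ _
    · have hle : returnTime σ f x ≤ n := returnTime_le hpos (by rw [hn, hf])
      have h1 := (returnTime_spec σ f x).1
      have hrest : (σ ^ (n - returnTime σ f x)) (returnPerm σ f x) = y := by
        change (σ ^ (n - returnTime σ f x)) ((σ ^ returnTime σ f x) x) = y
        rw [← Perm.mul_apply, ← pow_add, Nat.sub_add_cancel hle, hn]
      have hcycle := ih (n - returnTime σ f x) (by omega)
        ((sameCycle_returnPerm_apply σ f x).symm.trans h) ((returnPerm_label σ f x).trans hf) hrest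
      exact Perm.sameCycle_apply_left.1 hcycle

end ReturnPerm

/-! ### Lists -/

theorem iff_of_pairwise_of_asymm {α : Type*} {R S : α → α → Prop} {l : List α}
    (hR : l.Pairwise R) (hS : l.Pairwise S) (hR' : ∀ x y, R x y → ¬ R y x)
    (hS' : ∀ x y, S x y → ¬ S y x) : ∀ x ∈ l, ∀ y ∈ l, (R x y ↔ S x y) := by
  have hpair : l.Pairwise (fun x y => (R x y ↔ S x y) ∧ (R y x ↔ S y x)) :=
    (hR.and hS).imp fun h =>
      ⟨iff_of_true h.1 h.2, iff_of_false (hR' _ _ h.1) (hS' _ _ h.2)⟩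
  have hsymm : Std.Symm fun x y => (R x y ↔ S x y) ∧ (R y x ↔ S y x) := { symm _ _ h := ⟨h.2, h.1⟩ }
  have hrefl : ∀ x ∈ l, (R x x ↔ S x x) ∧ (R x x ↔ S x x) := fun x _ =>
    have h := iff_of_false (fun h => hR' x x h h) (fun h => hS' x x h h)
    ⟨h, h⟩
  exact fun x hx y hy => (List.Pairwise.forall_of_forall hrefl hpair hx hy).1

theorem pairwise_idxOf_of_nodup {α : Type*} [BEq α] [LawfulBEq α] {l : List α} (h : l.Nodup) :
    l.Pairwise (fun x y => l.idxOf x < l.idxOf y) := by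
  rw [List.pairwise_iff_getElem]
  intro i j hi hj hij
  rwa [h.idxOf_getElem, h.idxOf_getElem]

/-! ### The stacks of non-paired letters -/

/-- The other side. -/
def Side.other : Side → Side
  | .left => .right
  | .right => .left

@[simp] theorem Side.other_other (s : Side) : s.other.other = s := by cases s <;> rfl

theorem Side.other_ne (s : Side) : s.other ≠ s := by cases s <;> simp [Side.other]

theorem Side.eq_other_of_ne {s t : Side} (h : t ≠ s) : t = s.other := by
  cases s <;> cases t <;> simp_all [Side.other]

/-- The letter that opens an active vertex: `b` for white (left), `a` for black (right). -/
def Side.openLetter : Side → Letter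
  | .left => .b
  | .right => .a

/-- The letter that inactivates an active vertex: `b̄` for white (left), `ā` for black (right). -/
def Side.closeLetter : Side → Letter
  | .left => .bbar
  | .right => .abar

@[simp] theorem Side.closeLetter_ne_openLetter (s t : Side) : s.closeLetter ≠ t.openLetter := by
  cases s <;> cases t <;> simp [Side.closeLetter, Side.openLetter]

@[simp] theorem Side.openLetter_ne_closeLetter (s t : Side) : s.openLetter ≠ t.closeLetter :=
  (Side.closeLetter_ne_openLetter t s).symm

@[simp] theorem Side.openLetter_other_ne (s : Side) : s.other.openLetter ≠ s.openLetter := by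
  cases s <;> simp [Side.other, Side.openLetter]

@[simp] theorem Side.closeLetter_other_ne (s : Side) : s.other.closeLetter ≠ s.closeLetter := by
  cases s <;> simp [Side.other, Side.closeLetter]

theorem Letter.cases_side (s : Side) (x : Letter) :
    x = s.openLetter ∨ x = s.closeLetter ∨ x = s.other.openLetter ∨ x = s.other.closeLetter := by
  cases s <;> cases x <;> simp [Side.other, Side.openLetter, Side.closeLetter]

/-- The stack of the active vertices on side `s` after `n` letters, from the last to the first.
The letter at position `i` has label `i + 1`, and the label `0` stands for the start. An entry
`(k, e)` stands for a vertex opened by the letter of label `k`, such that `e` is the last label of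
an edge attached to it. -/
def activeStack (u : List Letter) (s : Side) : ℕ → List (ℕ × ℕ)
  | 0 => [(0, 0)]
  | n + 1 =>
    if u[n]? = some s.openLetter then (n + 1, n + 1) :: activeStack u s n
    else if u[n]? = some s.closeLetter then (activeStack u s n).tail
    else if u[n]? = some s.other.openLetter then
      match activeStack u s n with
      | [] => []
      | (k, _) :: r => (k, n + 1) :: r
    else activeStack u s n

/-- The labels of the vertices opened on side `s`: `0` and those of the opening letters. -/
def IsOpeningLabel (u : List Letter) (s : Side) (k : ℕ) : Prop :=
  k = 0 ∨ ∃ i, k = i + 1 ∧ u[i]? = some s.openLetter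

/-- The labels of the edges: `0` and those of the letters `a` and `b`. -/
def IsLabel (u : List Letter) (e : ℕ) : Prop :=
  ∃ s, IsOpeningLabel u s e

/-- The label that opens the last active vertex. -/
def opening (u : List Letter) (s : Side) (n : ℕ) : ℕ := ((activeStack u s n).headD (0, 0)).1

/-- The last label at the last active vertex. -/
def latest (u : List Letter) (s : Side) (n : ℕ) : ℕ := ((activeStack u s n).headD (0, 0)).2

/-- The label `k` opens a vertex that is active after `n` letters. -/
def IsActiveAt (u : List Letter) (s : Side) (n k : ℕ) : Prop := ∃ e, (k, e) ∈ activeStack u s n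

/-- The letter at position `i` opens a vertex on side `s`, and the letters of side `s` between it
and position `n` are matched among themselves: it is the last unmatched one before position `n`. -/
def IsLastUnmatched (u : List Letter) (s : Side) (i n : ℕ) : Prop :=
  i < n ∧ u[i]? = some s.openLetter ∧
    IsParenSystem s.openLetter s.closeLetter (subwordBetween s.openLetter s.closeLetter u i n)

section Stack

variable {u : List Letter} {s : Side} {n i j k e : ℕ} {r : List (ℕ × ℕ)}

theorem isLabel_zero (u : List Letter) : IsLabel u 0 := ⟨.left, Or.inl rfl⟩

theorem isLabel_succ (h : u[n]? = some s.openLetter) : IsLabel u (n + 1) := ⟨s, Or.inr ⟨n, rfl, h⟩⟩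

theorem IsLabel.cases (h : IsLabel u e) :
    e = 0 ∨ ∃ n, ∃ s : Side, e = n + 1 ∧ u[n]? = some s.openLetter := by
  obtain ⟨s, h⟩ := h
  exact h.imp_right fun ⟨n, hn⟩ => ⟨n, s, hn⟩

theorem IsLabel.le_length (h : IsLabel u e) : e ≤ u.length := by
  rcases h.cases with rfl | ⟨i, s, rfl, hi⟩
  · exact Nat.zero_le _
  · exact (List.getElem?_eq_some_iff.1 hi).1

theorem IsLabel.le_of_le_succ (he : IsLabel u e) (hen : e ≤ n + 1)
    (hn : ∀ s : Side, u[n]? ≠ some s.openLetter) : e ≤ n := by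
  rcases he.cases with rfl | ⟨i, s, rfl, hi⟩
  · exact Nat.zero_le _
  · rcases hen.lt_or_eq with h | h
    · omega
    · obtain rfl : i = n := by omega
      exact absurd hi (hn s)

theorem Letter.eq_openLetter_or_closeLetter (x : Letter) :
    (∃ s : Side, x = s.other.openLetter) ∨ ∃ s : Side, x = s.closeLetter := by
  cases x
  · exact Or.inl ⟨.left, rfl⟩
  · exact Or.inr ⟨.right, rfl⟩
  · exact Or.inl ⟨.right, rfl⟩
  · exact Or.inr ⟨.left, rfl⟩

theorem getElem?_cases_side (u : List Letter) (s : Side) (n : ℕ) :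
    u[n]? = none ∨ u[n]? = some s.openLetter ∨ u[n]? = some s.closeLetter ∨
      u[n]? = some s.other.openLetter ∨ u[n]? = some s.other.closeLetter := by
  rcases u[n]? with _ | x
  · simp
  · simpa using Letter.cases_side s x

theorem activeStack_open (h : u[n]? = some s.openLetter) :
    activeStack u s (n + 1) = (n + 1, n + 1) :: activeStack u s n := by
  simp [activeStack, h]

theorem activeStack_close (h : u[n]? = some s.closeLetter) :
    activeStack u s (n + 1) = (activeStack u s n).tail := by
  simp [activeStack, h]

theorem activeStack_touch (h : u[n]? = some s.other.openLetter)
    (hr : activeStack u s n = (k, e) :: r) : activeStack u s (n + 1) = (k, n + 1) :: r := by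
  simp [activeStack, h, hr]

theorem activeStack_other (h : u[n]? = some s.other.closeLetter) :
    activeStack u s (n + 1) = activeStack u s n := by
  simp [activeStack, h]

theorem activeStack_none (h : u[n]? = none) : activeStack u s (n + 1) = activeStack u s n := by
  simp [activeStack, h]

theorem IsPrefixShuffle.count_le (hu : IsPrefixShuffle u) (s : Side) (n : ℕ) :
    (u.take n).count s.closeLetter ≤ (u.take n).count s.openLetter := by
  have h := hu _ (List.take_prefix n u)
  cases s
  · exact h.2
  · exact h.1

theorem length_activeStack (hu : IsPrefixShuffle u) (s : Side) (n : ℕ) :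
    (activeStack u s n).length + (u.take n).count s.closeLetter =
      1 + (u.take n).count s.openLetter := by
  induction n with
  | zero => simp [activeStack]
  | succ n ih =>
    have hle := hu.count_le s n
    obtain ⟨⟨k, e⟩, r, hr⟩ := List.exists_cons_of_length_pos (l := activeStack u s n) (by omega)
    rw [hr, List.length_cons] at ih
    rw [List.take_add_one, List.count_append, List.count_append]
    rcases getElem?_cases_side u s n with h | h | h | h | h
    · rw [activeStack_none h, hr, h]; simpa using ih
    · rw [activeStack_open h, hr, h]; simp; omega
    · rw [activeStack_close h, hr, h]; simp; omega
    · rw [activeStack_touch h hr, h]; simp; omega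
    · rw [activeStack_other h, hr, h]; simp; omega

theorem activeStack_eq_cons (hu : IsPrefixShuffle u) (s : Side) (n : ℕ) :
    ∃ r, activeStack u s n = (opening u s n, latest u s n) :: r := by
  have hlength := length_activeStack hu s n
  have hcount := hu.count_le s n
  obtain ⟨⟨k, e⟩, r, hr⟩ := List.exists_cons_of_length_pos (l := activeStack u s n) (by omega)
  exact ⟨r, by simp [opening, latest, hr]⟩

theorem top_mem_activeStack (hu : IsPrefixShuffle u) (s : Side) (n : ℕ) :
    (opening u s n, latest u s n) ∈ activeStack u s n := by
  obtain ⟨r, hr⟩ := activeStack_eq_cons hu s n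
  rw [hr]
  exact List.mem_cons_self

theorem isActiveAt_opening (hu : IsPrefixShuffle u) (s : Side) (n : ℕ) :
    IsActiveAt u s n (opening u s n) := ⟨_, top_mem_activeStack hu s n⟩

theorem opening_eq (h : activeStack u s n = (k, e) :: r) : opening u s n = k := by
  simp [opening, h]

theorem latest_eq (h : activeStack u s n = (k, e) :: r) : latest u s n = e := by
  simp [latest, h]

theorem opening_open (h : u[n]? = some s.openLetter) : opening u s (n + 1) = n + 1 :=
  opening_eq (activeStack_open h)

theorem opening_touch (hu : IsPrefixShuffle u) (h : u[n]? = some s.other.openLetter) :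
    opening u s (n + 1) = opening u s n := by
  obtain ⟨r, hr⟩ := activeStack_eq_cons hu s n
  exact opening_eq (activeStack_touch h hr)

theorem opening_other (h : u[n]? = some s.other.closeLetter) :
    opening u s (n + 1) = opening u s n := by
  simp [opening, activeStack_other h]

theorem activeStack_close_cons (hu : IsPrefixShuffle u) (h : u[n]? = some s.closeLetter) :
    ∃ k e k' e' r, activeStack u s n = (k, e) :: (k', e') :: r ∧
      activeStack u s (n + 1) = (k', e') :: r := by
  obtain ⟨r, hr⟩ := activeStack_eq_cons hu s n
  obtain ⟨r', hr'⟩ := activeStack_eq_cons hu s (n + 1)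
  rw [activeStack_close h, hr, List.tail_cons] at hr'
  subst hr'
  exact ⟨_, _, _, _, _, hr, by rw [activeStack_close h, hr, List.tail_cons]⟩

theorem subwordBetween_succ (c c' : Letter) (u : List Letter) (h : i < n) :
    subwordBetween c c' u i (n + 1) =
      subwordBetween c c' u i n ++ u[n]?.toList.filter (fun x => x = c ∨ x = c') := by
  unfold subwordBetween
  rw [show n + 1 - (i + 1) = n - (i + 1) + 1 by omega, List.take_add_one, List.filter_append,
    List.getElem?_drop, show i + 1 + (n - (i + 1)) = n by omega]

theorem subwordBetween_succ_of_ne {c c' : Letter} (h : i < n) (hc : u[n]? ≠ some c)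
    (hc' : u[n]? ≠ some c') :
    subwordBetween c c' u i (n + 1) = subwordBetween c c' u i n := by
  rw [subwordBetween_succ _ _ _ h, List.append_right_eq_self, List.filter_eq_nil_iff]
  intro x hx
  rw [Option.mem_toList] at hx
  rw [hx] at hc hc'
  simp_all

theorem subwordBetween_wrap {c c' : Letter} (hji : j < i) (hin : i < n) (hi : u[i]? = some c)
    (hn : u[n]? = some c') :
    subwordBetween c c' u j (n + 1) =
      subwordBetween c c' u j i ++ c :: subwordBetween c c' u i n ++ [c'] := by
  rw [subwordBetween_succ _ _ _ (hji.trans hin), hn]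
  unfold subwordBetween
  rw [drop_take_split u hji hin hi, List.filter_append, List.filter_cons]
  simp

theorem IsParenSystem.append_wrap {c c' : Letter} (hc : c ≠ c') {U V : List Letter}
    (hU : IsParenSystem c c' U) (hV : IsParenSystem c c' V) :
    IsParenSystem c c' (U ++ c :: V ++ [c']) := by
  obtain ⟨letters_U, count_U, prefix_U⟩ := hU
  obtain ⟨letters_V, count_V, prefix_V⟩ := hV
  have hcount : (U ++ c :: V ++ [c']).count c = (U ++ c :: V ++ [c']).count c' := by
    simp [List.count_append, hc, hc.symm, count_U, count_V]
  refine ⟨fun x hx => ?_, hcount, fun v hv => ?_⟩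
  · simp only [List.mem_append, List.mem_cons, List.not_mem_nil, or_false] at hx
    rcases hx with (hx | rfl | hx) | rfl
    · exact letters_U x hx
    · exact Or.inl rfl
    · exact letters_V x hx
    · exact Or.inr rfl
  · rw [List.append_assoc] at hv
    rcases List.prefix_or_prefix_of_prefix hv (List.prefix_append U _) with h | ⟨t, rfl⟩
    · exact prefix_U v h
    · rw [List.prefix_append_right_inj] at hv
      rcases t with _ | ⟨x, t⟩
      · simpa using count_U.ge
      · obtain ⟨rfl, ht⟩ := List.cons_prefix_cons.1 hv
        rcases List.prefix_concat_iff.1 ht with rfl | ht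
        · simpa using hcount.ge
        · have := prefix_V t ht
          simp only [List.count_append, ne_eq, hc, not_false_eq_true, List.count_cons_of_ne,
            count_U, List.count_cons_self, add_le_add_iff_left, ge_iff_le]
          omega

theorem isLastUnmatched_succ_self (h : u[n]? = some s.openLetter) :
    IsLastUnmatched u s n (n + 1) :=
  ⟨n.lt_succ_self, h, by simp [subwordBetween, IsParenSystem]⟩

theorem IsLastUnmatched.succ (h : IsLastUnmatched u s i n) (ho : u[n]? ≠ some s.openLetter)
    (hc : u[n]? ≠ some s.closeLetter) : IsLastUnmatched u s i (n + 1) :=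
  ⟨Nat.lt_succ_of_lt h.1, h.2.1, by rw [subwordBetween_succ_of_ne h.1 ho hc]; exact h.2.2⟩

theorem IsLastUnmatched.close (hji : IsLastUnmatched u s j i) (hin : IsLastUnmatched u s i n)
    (h : u[n]? = some s.closeLetter) : IsLastUnmatched u s j (n + 1) := by
  refine ⟨Nat.lt_succ_of_lt (hji.1.trans hin.1), hji.2.1, ?_⟩
  rw [subwordBetween_wrap hji.1 hin.1 hin.2.1 h]
  exact hji.2.2.append_wrap (by simp) hin.2.2

theorem activeStack_cons (hu : IsPrefixShuffle u) (h : activeStack u s n = (k, e) :: r) :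
    (k = 0 ∧ r = []) ∨ ∃ i, k = i + 1 ∧ activeStack u s i = r ∧ IsLastUnmatched u s i n := by
  induction n using Nat.strong_induction_on generalizing k e r with
  | _ n ih =>
    rcases n with _ | n
    · simp only [activeStack, List.cons.injEq, Prod.mk.injEq] at h
      exact Or.inl ⟨h.1.1.symm, h.2.symm⟩
    · have of_irrelevant {k e r} (ho : u[n]? ≠ some s.openLetter) (hc : u[n]? ≠ some s.closeLetter)
          (h : activeStack u s n = (k, e) :: r) : (k = 0 ∧ r = []) ∨
            ∃ i, k = i + 1 ∧ activeStack u s i = r ∧ IsLastUnmatched u s i (n + 1) :=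
        (ih n n.lt_succ_self h).imp_right fun ⟨i, hk, hr, hin⟩ => ⟨i, hk, hr, hin.succ ho hc⟩
      rcases getElem?_cases_side u s n with hl | hl | hl | hl | hl
      · exact of_irrelevant (by simp [hl]) (by simp [hl]) (by rwa [activeStack_none hl] at h)
      · obtain ⟨hke, rfl⟩ := List.cons.inj ((activeStack_open hl).symm.trans h)
        exact Or.inr ⟨n, (Prod.mk.inj hke).1.symm, rfl, isLastUnmatched_succ_self hl⟩
      · obtain ⟨k₀, e₀, k', e', r', hstack, hnext⟩ := activeStack_close_cons hu hl
        obtain ⟨hke, rfl⟩ := List.cons.inj (hnext.symm.trans h)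
        obtain ⟨rfl, rfl⟩ := Prod.mk.inj hke
        rcases ih n n.lt_succ_self hstack with ⟨-, h⟩ | ⟨i, -, hrest, hin⟩
        · simp at h
        · exact (ih i (Nat.lt_succ_of_lt hin.1) hrest).imp_right
            fun ⟨j, hk, hr, hji⟩ => ⟨j, hk, hr, hji.close hin hl⟩
      · obtain ⟨r', hr'⟩ := activeStack_eq_cons hu s n
        obtain ⟨hke, rfl⟩ := List.cons.inj ((activeStack_touch hl hr').symm.trans h)
        obtain ⟨rfl, -⟩ := Prod.mk.inj hke
        exact of_irrelevant (by simp [hl]) (by simp [hl]) hr'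
      · exact of_irrelevant (by simp [hl]) (by simp [hl]) (by rwa [activeStack_other hl] at h)

theorem isOpeningLabel_opening (hu : IsPrefixShuffle u) (s : Side) (n : ℕ) :
    IsOpeningLabel u s (opening u s n) := by
  obtain ⟨r, hr⟩ := activeStack_eq_cons hu s n
  exact (activeStack_cons hu hr).imp And.left fun ⟨i, hk, _, hi⟩ => ⟨i, hk, hi.2.1⟩

theorem isLabel_opening (hu : IsPrefixShuffle u) (s : Side) (n : ℕ) : IsLabel u (opening u s n) :=
  ⟨s, isOpeningLabel_opening hu s n⟩

theorem opening_le (hu : IsPrefixShuffle u) (s : Side) (n : ℕ) : opening u s n ≤ n := by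
  obtain ⟨r, hr⟩ := activeStack_eq_cons hu s n
  rcases activeStack_cons hu hr with ⟨h, -⟩ | ⟨i, h, -, hin, -⟩ <;> omega

theorem opening_opening (hu : IsPrefixShuffle u) (s : Side) (n : ℕ) :
    opening u s (opening u s n) = opening u s n := by
  rcases isOpeningLabel_opening hu s n with h | ⟨i, h, hi⟩
  · rw [h]; rfl
  · rw [h, opening_open hi]

theorem mem_activeStack (hu : IsPrefixShuffle u) (h : (k, e) ∈ activeStack u s n) :
    e ≤ n ∧ IsLabel u e ∧ opening u s e = k ∧ latest u s e = e := by
  induction n with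
  | zero =>
    simp only [activeStack, List.mem_singleton, Prod.mk.injEq] at h
    obtain ⟨rfl, rfl⟩ := h
    exact ⟨le_rfl, isLabel_zero u, rfl, rfl⟩
  | succ n ih =>
    have of_mem (h : (k, e) ∈ activeStack u s n) := (ih h).imp_left Nat.le_succ_of_le
    obtain ⟨r, hr⟩ := activeStack_eq_cons hu s n
    rcases getElem?_cases_side u s n with hl | hl | hl | hl | hl
    · exact of_mem (by rwa [activeStack_none hl] at h)
    · have hs := activeStack_open hl
      rw [hs, List.mem_cons] at h
      rcases h with h | h
      · obtain ⟨rfl, rfl⟩ := Prod.mk.inj h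
        exact ⟨le_rfl, isLabel_succ hl, opening_eq hs, latest_eq hs⟩
      · exact of_mem h
    · rw [activeStack_close hl] at h
      exact of_mem (List.mem_of_mem_tail h)
    · have hs := activeStack_touch hl hr
      rw [hs, List.mem_cons] at h
      rcases h with h | h
      · obtain ⟨rfl, rfl⟩ := Prod.mk.inj h
        exact ⟨le_rfl, isLabel_succ hl, opening_eq hs, latest_eq hs⟩
      · exact of_mem (by rw [hr]; exact List.mem_cons_of_mem _ h)
    · exact of_mem (by rwa [activeStack_other hl] at h)

theorem isLabel_latest (hu : IsPrefixShuffle u) (s : Side) (n : ℕ) : IsLabel u (latest u s n) :=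
  (mem_activeStack hu (top_mem_activeStack hu s n)).2.1

theorem latest_le (hu : IsPrefixShuffle u) (s : Side) (n : ℕ) : latest u s n ≤ n :=
  (mem_activeStack hu (top_mem_activeStack hu s n)).1

theorem opening_latest (hu : IsPrefixShuffle u) (s : Side) (n : ℕ) :
    opening u s (latest u s n) = opening u s n :=
  (mem_activeStack hu (top_mem_activeStack hu s n)).2.2.1

theorem IsActiveAt.le (hu : IsPrefixShuffle u) (h : IsActiveAt u s n k) : k ≤ n := by
  obtain ⟨e, h⟩ := h
  obtain ⟨hen, -, hk, -⟩ := mem_activeStack hu h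
  have := opening_le hu s e
  omega

theorem activeStack_pairwise (hu : IsPrefixShuffle u) (s : Side) (n : ℕ) :
    (activeStack u s n).Pairwise (fun x y => y.1 < x.1) := by
  induction n using Nat.strong_induction_on with
  | _ n ih =>
    obtain ⟨r, hr⟩ := activeStack_eq_cons hu s n
    rcases activeStack_cons hu hr with ⟨-, h⟩ | ⟨i, hi, h, hin, -⟩
    · simp [hr, h]
    · rw [hr, List.pairwise_cons, ← h]
      refine ⟨fun x hx => ?_, ih i hin⟩
      have := IsActiveAt.le hu ⟨_, hx⟩
      simp only [hi]
      omega

theorem exists_isPaired_of_close (hu : IsPrefixShuffle u) (h : u[n]? = some s.closeLetter) :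
    ∃ i e, activeStack u s n = (i + 1, e) :: activeStack u s i ∧
      activeStack u s (n + 1) = activeStack u s i ∧
      IsPaired s.openLetter s.closeLetter u i n := by
  obtain ⟨k, e, k', e', r, hstack, hnext⟩ := activeStack_close_cons hu h
  rcases activeStack_cons hu hstack with ⟨-, hr⟩ | ⟨i, rfl, hr, hin, hi, hparen⟩
  · simp at hr
  · exact ⟨i, e, by rw [hstack, hr], by rw [hnext, hr], hin, hi, h, hparen⟩

theorem IsPaired.lt_length {c c' : Letter} (h : IsPaired c c' u i j) : j < u.length :=
  (List.getElem?_eq_some_iff.1 h.2.2.1).1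

theorem IsPaired.activeStack_eq (hu : IsPrefixShuffle u)
    (h : IsPaired s.openLetter s.closeLetter u i j) :
    (∃ e, activeStack u s j = (i + 1, e) :: activeStack u s i) ∧
      activeStack u s (j + 1) = activeStack u s i := by
  obtain ⟨i', e, hstack, hnext, hpaired⟩ := exists_isPaired_of_close hu h.2.2.1
  obtain rfl := h.left_unique (by simp) hpaired
  exact ⟨⟨e, hstack⟩, hnext⟩

theorem IsPaired.opening_eq (hu : IsPrefixShuffle u)
    (h : IsPaired s.openLetter s.closeLetter u i j) :
    opening u s j = i + 1 ∧ opening u s (j + 1) = opening u s i := by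
  obtain ⟨⟨e, hstack⟩, hnext⟩ := h.activeStack_eq hu
  exact ⟨_root_.opening_eq hstack, by simp [opening, hnext]⟩

theorem IsActiveAt.of_succ (hu : IsPrefixShuffle u) (hk : k ≤ n)
    (h : IsActiveAt u s (n + 1) k) : IsActiveAt u s n k := by
  obtain ⟨e, h⟩ := h
  obtain ⟨r, hr⟩ := activeStack_eq_cons hu s n
  rcases getElem?_cases_side u s n with hl | hl | hl | hl | hl
  · exact ⟨e, by rwa [activeStack_none hl] at h⟩
  · rw [activeStack_open hl, List.mem_cons] at h
    rcases h with h | h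
    · obtain ⟨rfl, -⟩ := Prod.mk.inj h
      omega
    · exact ⟨e, h⟩
  · rw [activeStack_close hl] at h
    exact ⟨e, List.mem_of_mem_tail h⟩
  · rw [activeStack_touch hl hr, List.mem_cons] at h
    rcases h with h | h
    · obtain ⟨rfl, -⟩ := Prod.mk.inj h
      exact isActiveAt_opening hu s n
    · exact ⟨e, by rw [hr]; exact List.mem_cons_of_mem _ h⟩
  · exact ⟨e, by rwa [activeStack_other hl] at h⟩

theorem IsActiveAt.anti {m : ℕ} (hu : IsPrefixShuffle u) (hk : k ≤ n) (hnm : n ≤ m)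
    (h : IsActiveAt u s m k) : IsActiveAt u s n k := by
  induction m, hnm using Nat.le_induction with
  | base => exact h
  | succ m hm ih => exact ih (h.of_succ hu (by omega))

theorem IsActiveAt.succ (hu : IsPrefixShuffle u) (h : IsActiveAt u s n k) :
    IsActiveAt u s (n + 1) k ∨ ∃ i, k = i + 1 ∧ IsPaired s.openLetter s.closeLetter u i n := by
  obtain ⟨e, h⟩ := h
  obtain ⟨r, hr⟩ := activeStack_eq_cons hu s n
  rcases getElem?_cases_side u s n with hl | hl | hl | hl | hl
  · exact Or.inl ⟨e, by rwa [activeStack_none hl]⟩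
  · exact Or.inl ⟨e, by rw [activeStack_open hl]; exact List.mem_cons_of_mem _ h⟩
  · obtain ⟨i, e', hstack, hnext, hpaired⟩ := exists_isPaired_of_close hu hl
    rw [hstack, List.mem_cons] at h
    rcases h with h | h
    · exact Or.inr ⟨i, (Prod.mk.inj h).1, hpaired⟩
    · exact Or.inl ⟨e, by rwa [hnext]⟩
  · rw [hr, List.mem_cons] at h
    rcases h with h | h
    · exact Or.inl ⟨n + 1, by rw [activeStack_touch hl hr, (Prod.mk.inj h).1]; simp⟩
    · exact Or.inl ⟨e, by rw [activeStack_touch hl hr]; exact List.mem_cons_of_mem _ h⟩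
  · exact Or.inl ⟨e, by rwa [activeStack_other hl]⟩

theorem isActiveAt_zero (hu : IsPrefixShuffle u) (s : Side) (n : ℕ) : IsActiveAt u s n 0 := by
  induction n with
  | zero => exact ⟨0, by simp [activeStack]⟩
  | succ n ih =>
    rcases ih.succ hu with h | ⟨i, h, -⟩
    · exact h
    · omega

theorem isActiveAt_iff {m : ℕ} (hu : IsPrefixShuffle u) (hi : u[i]? = some s.openLetter)
    (him : i < m) :
    IsActiveAt u s m (i + 1) ↔ ¬ ∃ j < m, IsPaired s.openLetter s.closeLetter u i j := by
  constructor
  · rintro h ⟨j, hjm, hj⟩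
    obtain ⟨e, he⟩ := h.anti hu (n := j + 1) (by have := hj.1; omega) hjm
    rw [(hj.activeStack_eq hu).2] at he
    have := IsActiveAt.le hu ⟨e, he⟩
    omega
  · intro h
    induction m, him using Nat.le_induction with
    | base => exact ⟨i + 1, by rw [activeStack_open hi]; simp⟩
    | succ m _ ih =>
      rcases (ih fun ⟨j, hj, hij⟩ => h ⟨j, by omega, hij⟩).succ hu with h' | ⟨i', hi', hpaired⟩
      · exact h'
      · obtain rfl : i = i' := by omega
        exact absurd ⟨m, by omega, hpaired⟩ h

theorem eq_activeStack_of_suffix (hu : IsPrefixShuffle u)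
    (h : (i + 1, e) :: r <:+ activeStack u s n) : r = activeStack u s i := by
  induction n using Nat.strong_induction_on with
  | _ n ih =>
    obtain ⟨r', hr'⟩ := activeStack_eq_cons hu s n
    rw [hr', List.suffix_cons_iff] at h
    rcases h with h | h
    · obtain ⟨htop, rfl⟩ := List.cons.inj h
      have hi := (Prod.mk.inj htop).1
      rcases activeStack_cons hu hr' with ⟨hzero, -⟩ | ⟨j, hj, hstack, -⟩
      · omega
      · obtain rfl : i = j := by omega
        exact hstack.symm
    · rcases activeStack_cons hu hr' with ⟨-, rfl⟩ | ⟨j, -, rfl, hj, -⟩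
      · simp at h
      · exact ih j hj h

theorem IsActiveAt.opening_of_succ (hu : IsPrefixShuffle u) (h : IsActiveAt u s n (i + 1)) :
    IsActiveAt u s n (opening u s i) := by
  obtain ⟨e, h⟩ := h
  obtain ⟨above, r, hstack⟩ := List.append_of_mem h
  have hsuffix : (i + 1, e) :: r <:+ activeStack u s n := ⟨above, hstack.symm⟩
  obtain rfl := eq_activeStack_of_suffix hu hsuffix
  exact ⟨_, hsuffix.subset (List.mem_cons_of_mem _ (top_mem_activeStack hu s i))⟩

theorem IsActiveAt.le_opening (hu : IsPrefixShuffle u) (h : IsActiveAt u s n k) :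
    k ≤ opening u s n := by
  obtain ⟨e, h⟩ := h
  obtain ⟨r, hr⟩ := activeStack_eq_cons hu s n
  have hp := activeStack_pairwise hu s n
  rw [hr] at h hp
  rcases List.mem_cons.1 h with h | h
  · exact (Prod.mk.inj h).1.le
  · exact ((List.pairwise_cons.1 hp).1 _ h).le

/-- The last active vertex after `n` letters is reached from position `n` by going back over the
letters that do not touch it: single letters closing the other side and whole pairs on side `s`. -/
theorem latest_induction (hu : IsPrefixShuffle u) (s : Side) (V : ℕ → ℕ → Prop)
    (base : ∀ e, IsLabel u e → V e (e + 1))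
    (skip : ∀ e n, IsLabel u e → u[n]? = some s.other.closeLetter → V e (n + 1) → V e (n + 2))
    (skip_pair : ∀ e i j, IsLabel u e → IsPaired s.openLetter s.closeLetter u i j →
      V e (i + 1) → V e (j + 2))
    (hn : n ≤ u.length) : V (latest u s n) (n + 1) := by
  induction n using Nat.strong_induction_on with
  | _ n ih =>
    rcases n with _ | n
    · exact base 0 (isLabel_zero u)
    · rcases getElem?_cases_side u s n with hl | hl | hl | hl | hl
      · rw [List.getElem?_eq_none_iff] at hl
        omega
      · rw [latest_eq (activeStack_open hl)]
        exact base _ (isLabel_succ hl)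
      · obtain ⟨i, e, -, h, hpaired⟩ := exists_isPaired_of_close hu hl
        have hin := hpaired.1
        rw [show latest u s (n + 1) = latest u s i by simp [latest, h]]
        exact skip_pair _ _ _ (isLabel_latest hu s i) hpaired (ih i (by omega) (by omega))
      · obtain ⟨r, hr⟩ := activeStack_eq_cons hu s n
        rw [latest_eq (activeStack_touch hl hr)]
        exact base _ (isLabel_succ hl)
      · rw [show latest u s (n + 1) = latest u s n by simp [latest, activeStack_other hl]]
        exact skip _ _ (isLabel_latest hu s n) hl (ih n (by omega) (by omega))

theorem label_induction (hu : IsPrefixShuffle u) (s : Side) (P : ℕ → Prop)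
    (opening : ∀ e, IsLabel u e → opening u s e = e → P e)
    (touch : ∀ n, u[n]? = some s.other.openLetter → P (latest u s n) → P (n + 1))
    (he : IsLabel u e) : P e := by
  induction e using Nat.strong_induction_on with
  | _ e ih =>
    rcases he.cases with rfl | ⟨i, t, rfl, ht⟩
    · exact opening 0 he rfl
    · by_cases hts : t = s
      · subst hts
        exact opening _ he (opening_open ht)
      · obtain rfl := Side.eq_other_of_ne hts
        exact touch i ht (ih _ (by have := latest_le hu s i; omega) (isLabel_latest hu s i))

end Stack

/-! ### Binary trees and their leaves -/

namespace BinTree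

variable {B : BinTree} {p : Address} {act : Bool}

theorem sub_append (B : BinTree) (q p : Address) :
    B.sub (q ++ p) = (B.sub p).bind (fun C => C.sub q) := by
  induction q with
  | nil => simp [sub]
  | cons s q ih =>
    rw [List.cons_append, sub, ih, Option.bind_assoc]
    rfl

theorem sub_leaf_concat (act : Bool) (q : Address) (s : Side) :
    (leaf act).sub (q ++ [s]) = none := by
  rw [sub_append]
  simp [sub, son]

theorem sub_node_left (l r : BinTree) (q : Address) :
    (node l r).sub (q ++ [.left]) = l.sub q := by
  rw [sub_append]
  simp [sub, son]

theorem sub_node_right (l r : BinTree) (q : Address) :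
    (node l r).sub (q ++ [.right]) = r.sub q := by
  rw [sub_append]
  simp [sub, son]

theorem mem_leavesFrom {q : Address} :
    (q, act) ∈ leavesFrom p B ↔ ∃ r, q = r ++ p ∧ B.sub r = some (leaf act) := by
  induction B generalizing p with
  | leaf act' =>
    simp only [leavesFrom, List.mem_singleton, Prod.mk.injEq]
    constructor
    · rintro ⟨rfl, rfl⟩
      exact ⟨[], rfl, rfl⟩
    · rintro ⟨r, rfl, h⟩
      rcases List.eq_nil_or_concat r with rfl | ⟨r, s, rfl⟩
      · simp only [sub, Option.some.injEq, leaf.injEq] at h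
        exact ⟨rfl, h.symm⟩
      · simp [List.concat_eq_append, sub_leaf_concat] at h
  | node l r ihl ihr =>
    simp only [leavesFrom, List.mem_append, ihl, ihr]
    constructor
    · rintro (⟨t, rfl, h⟩ | ⟨t, rfl, h⟩)
      · exact ⟨t ++ [.left], by simp, by rwa [sub_node_left]⟩
      · exact ⟨t ++ [.right], by simp, by rwa [sub_node_right]⟩
    · rintro ⟨t, rfl, h⟩
      rcases List.eq_nil_or_concat t with rfl | ⟨t, s, rfl⟩
      · simp [sub] at h
      · rw [List.concat_eq_append] at h ⊢
        cases s
        · exact Or.inl ⟨t, by simp, by rwa [sub_node_left] at h⟩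
        · exact Or.inr ⟨t, by simp, by rwa [sub_node_right] at h⟩

theorem nodup_leavesFrom (B : BinTree) (p : Address) :
    ((leavesFrom p B).map Prod.fst).Nodup := by
  induction B generalizing p with
  | leaf act => simp [leavesFrom]
  | node l r ihl ihr =>
    rw [leavesFrom, List.map_append, List.nodup_append]
    refine ⟨ihl _, ihr _, ?_⟩
    rintro x hx y hy rfl
    rw [List.mem_map] at hx hy
    obtain ⟨⟨_, _⟩, hx, rfl⟩ := hx
    obtain ⟨⟨_, _⟩, hy, heq⟩ := hy
    obtain ⟨t, rfl, -⟩ := mem_leavesFrom.1 hx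
    obtain ⟨t', rfl, -⟩ := mem_leavesFrom.1 hy
    simpa using List.append_inj_right' heq rfl

theorem leavesFrom_replaceDown (h : B.sub p = some (leaf act)) (p₀ : Address) :
    ∃ L R, leavesFrom p₀ B = L ++ (p ++ p₀, act) :: R ∧
      ∀ C, leavesFrom p₀ (B.replaceDown p.reverse C) = L ++ leavesFrom (p ++ p₀) C ++ R := by
  induction B generalizing p p₀ with
  | leaf act' =>
    rcases List.eq_nil_or_concat p with rfl | ⟨p, s, rfl⟩
    · simp only [sub, Option.some.injEq, leaf.injEq] at h
      subst h
      exact ⟨[], [], by simp [leavesFrom], by simp [replaceDown]⟩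
    · simp [List.concat_eq_append, sub_leaf_concat] at h
  | node l r ihl ihr =>
    rcases List.eq_nil_or_concat p with rfl | ⟨p, s, rfl⟩
    · simp [sub] at h
    · rw [List.concat_eq_append] at h ⊢
      cases s
      · rw [sub_node_left] at h
        obtain ⟨L, R, hleaves, hreplace⟩ := ihl h (.left :: p₀)
        exact ⟨L, R ++ leavesFrom (.right :: p₀) r, by simp [leavesFrom, hleaves], fun C => by
          simp [leavesFrom, replaceDown, hreplace]⟩
      · rw [sub_node_right] at h
        obtain ⟨L, R, hleaves, hreplace⟩ := ihr h (.right :: p₀)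
        exact ⟨leavesFrom (.left :: p₀) l ++ L, R, by simp [leavesFrom, hleaves], fun C => by
          simp [leavesFrom, replaceDown, hreplace]⟩

theorem isNode_nil_node (l r : BinTree) : (node l r).IsNode [] := ⟨l, r, rfl⟩

theorem not_isNode_leaf (act : Bool) (p : Address) : ¬ (leaf act).IsNode p := by
  rintro ⟨l, r, h⟩
  rcases List.eq_nil_or_concat p with rfl | ⟨p, s, rfl⟩
  · simp [sub] at h
  · simp [List.concat_eq_append, sub_leaf_concat] at h

theorem isNode_node_left (l r : BinTree) (q : Address) :
    (node l r).IsNode (q ++ [.left]) ↔ l.IsNode q := by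
  simp [IsNode, sub_node_left]

theorem isNode_node_right (l r : BinTree) (q : Address) :
    (node l r).IsNode (q ++ [.right]) ↔ r.IsNode q := by
  simp [IsNode, sub_node_right]

theorem isNode_B₁ (p : Address) : B₁.IsNode p ↔ p = [] := by
  rcases List.eq_nil_or_concat p with rfl | ⟨p, s, rfl⟩
  · simp [B₁, isNode_nil_node]
  · rw [List.concat_eq_append]
    cases s <;> simp [B₁, isNode_node_left, isNode_node_right, not_isNode_leaf]

theorem isNode_replaceDown (h : B.sub p = some (leaf act)) (C : BinTree) (q : Address) :
    (B.replaceDown p.reverse C).IsNode q ↔ B.IsNode q ∨ ∃ t, q = t ++ p ∧ C.IsNode t := by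
  induction B generalizing p q with
  | leaf act' =>
    rcases List.eq_nil_or_concat p with rfl | ⟨p, s, rfl⟩
    · simp [replaceDown, not_isNode_leaf]
    · simp [List.concat_eq_append, sub_leaf_concat] at h
  | node l r ihl ihr =>
    rcases List.eq_nil_or_concat p with rfl | ⟨p, s, rfl⟩
    · simp [sub] at h
    · rw [List.concat_eq_append] at h ⊢
      have concat_inj : ∀ (t q : Address) (s s' : Side),
          q ++ [s] = t ++ (p ++ [s']) ↔ q = t ++ p ∧ s = s' := by
        intro t q s s'
        rw [← List.append_assoc, List.append_singleton_inj]
      rcases List.eq_nil_or_concat q with rfl | ⟨q, s', rfl⟩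
      · cases s <;> simp [replaceDown, isNode_nil_node]
      · rw [List.concat_eq_append]
        cases s
        · rw [sub_node_left] at h
          cases s'
          · simp [replaceDown, isNode_node_left, ihl h, concat_inj, - List.append_assoc]
          · simp [replaceDown, isNode_node_right, concat_inj, - List.append_assoc]
        · rw [sub_node_right] at h
          cases s'
          · simp [replaceDown, isNode_node_left, concat_inj, - List.append_assoc]
          · simp [replaceDown, isNode_node_right, ihr h, concat_inj, - List.append_assoc]

/-- The active leaves of both sides, in the order of appearance around the tree. -/
def actives (B : BinTree) : List Address := ((leavesFrom [] B).filter Prod.snd).map Prod.fst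

theorem activeLeaves_eq (B : BinTree) (s : Side) :
    B.activeLeaves s = B.actives.filter (fun p => decide (p.head? = some s)) := by
  rw [activeLeaves, actives, List.filter_map, List.filter_filter]
  congr 1
  apply List.filter_congr
  simp [Bool.and_comm]

theorem mem_actives : p ∈ B.actives ↔ B.sub p = some (leaf true) := by
  simp [actives, mem_leavesFrom]

theorem nodup_leafList (B : BinTree) : B.leafList.Nodup := nodup_leavesFrom B []

theorem actives_sublist (B : BinTree) : B.actives.Sublist B.leafList :=
  List.filter_sublist.map _

theorem actives_replaceAt {X Y : List Address} (h : B.actives = X ++ p :: Y) (C : BinTree) :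
    (B.replaceAt (some p) C).actives =
      X ++ ((leavesFrom p C).filter Prod.snd).map Prod.fst ++ Y := by
  have hp : B.sub p = some (leaf true) := mem_actives.1 (by rw [h]; simp)
  obtain ⟨L, R, hleaves, hreplace⟩ := leavesFrom_replaceDown hp []
  rw [List.append_nil] at hleaves hreplace
  have hsplit : X ++ p :: Y =
      (L.filter Prod.snd).map Prod.fst ++ p :: (R.filter Prod.snd).map Prod.fst := by
    simp [← h, actives, hleaves]
  have hnodup := (actives_sublist B).nodup (nodup_leafList B)
  rw [h, List.nodup_append] at hnodup
  obtain ⟨rfl, -, rfl⟩ := (List.append_cons_inj_of_notMem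
    (fun hX => hnodup.2.2 _ hX p (by simp) rfl) (List.nodup_cons.1 hnodup.2.1).1).1 hsplit
  simp only [replaceAt, actives, hreplace, List.filter_append, List.map_append]

theorem isLeaf_or_isNode (h : B.IsVertex p) : B.IsLeaf p ∨ B.IsNode p := by
  obtain ⟨C, hC⟩ := Option.isSome_iff_exists.1 h
  rcases C with act | ⟨l, r⟩
  · exact Or.inl ⟨act, hC⟩
  · exact Or.inr ⟨l, r, hC⟩

theorem IsLeaf.not_isNode (h : B.IsLeaf p) : ¬ B.IsNode p := by
  rintro ⟨l, r, hnode⟩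
  obtain ⟨act, hleaf⟩ := h
  simp [hnode] at hleaf

end BinTree

/-! ### The nodes and the active leaves of `λ₁(w)` -/

open BinTree

/-- The address in `λ₁(u)` of the node created by the letter of label `e`: this letter replaces the
leaf of the last active vertex on the other side. The minimum is only there for termination, since
`latest u s n ≤ n`. -/
def nodeAddr (u : List Letter) : ℕ → Address
  | 0 => []
  | n + 1 =>
    if u[n]? = some .a then .left :: nodeAddr u (min (latest u .left n) n)
    else if u[n]? = some .b then .right :: nodeAddr u (min (latest u .right n) n)
    else []
termination_by n => n
decreasing_by all_goals omega

/-- The addresses of the active leaves in their order around `λ₁(u)`, given the stacks `S`: the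
left leaves appear from the bottom to the top of their stack, then the right leaves from the top to
the bottom of theirs. -/
def stackLeaves (u : List Letter) (S : Side → List (ℕ × ℕ)) : List Address :=
  ((S .left).map fun x => .left :: nodeAddr u x.2).reverse ++
    (S .right).map fun x => .right :: nodeAddr u x.2

/-- The description of `λ₁` after the first `n` letters of `u`: its nodes are the `nodeAddr u e`
for the labels `e` up to `n`, and its active leaves are given by the stacks. -/
structure IsDescribedAt (u : List Letter) (n : ℕ) (B : BinTree) : Prop where
  actives_eq : B.actives = stackLeaves u (activeStack u · n)
  isNode_iff : ∀ p, B.IsNode p ↔ ∃ e, e ≤ n ∧ IsLabel u e ∧ p = nodeAddr u e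
  nodeAddr_inj : ∀ {e e'}, e ≤ n → e' ≤ n → IsLabel u e → IsLabel u e' →
    nodeAddr u e = nodeAddr u e' → e = e'

section Lambda

variable {u : List Letter} {s : Side} {n e : ℕ} {B : BinTree}

theorem nodeAddr_zero : nodeAddr u 0 = [] := by rw [nodeAddr]

theorem nodeAddr_touch (hu : IsPrefixShuffle u) (h : u[n]? = some s.other.openLetter) :
    nodeAddr u (n + 1) = s :: nodeAddr u (latest u s n) := by
  have := latest_le hu s n
  rw [nodeAddr]
  cases s <;> simp_all [Side.other, Side.openLetter]

theorem lambda₁_take_succ {x : Letter} (h : u[n]? = some x) :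
    lambda₁ (u.take (n + 1)) = (lambda₁ (u.take n)).step x := by
  rw [lambda₁, List.take_add_one, h, List.foldl_append]
  rfl

theorem lambda₁_take_none (h : u[n]? = none) :
    lambda₁ (u.take (n + 1)) = lambda₁ (u.take n) := by
  rw [List.take_add_one, h]
  simp

theorem filter_stackLeaves_left (u : List Letter) (S : Side → List (ℕ × ℕ)) :
    (stackLeaves u S).filter (fun p => decide (p.head? = some .left)) =
      ((S .left).map fun x => .left :: nodeAddr u x.2).reverse := by
  rw [stackLeaves, List.filter_append, List.filter_eq_self.2, List.filter_eq_nil_iff.2,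
    List.append_nil] <;> aesop

theorem filter_stackLeaves_right (u : List Letter) (S : Side → List (ℕ × ℕ)) :
    (stackLeaves u S).filter (fun p => decide (p.head? = some .right)) =
      (S .right).map fun x => .right :: nodeAddr u x.2 := by
  rw [stackLeaves, List.filter_append, List.filter_eq_nil_iff.2, List.filter_eq_self.2,
    List.nil_append] <;> aesop

theorem stackLeaves_close {S S' : Side → List (ℕ × ℕ)} {k : ℕ} {r : List (ℕ × ℕ)}
    (h : S s = (k, e) :: r) (h' : S' s = r) (hother : S' s.other = S s.other) :
    ∃ X Y, stackLeaves u S = X ++ (s :: nodeAddr u e) :: Y ∧ stackLeaves u S' = X ++ Y := by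
  cases s <;> simp only [Side.other] at hother
  · exact ⟨(r.map fun x => .left :: nodeAddr u x.2).reverse,
      (S .right).map fun x => .right :: nodeAddr u x.2,
      by simp [stackLeaves, h], by simp [stackLeaves, h', hother]⟩
  · exact ⟨((S .left).map fun x => .left :: nodeAddr u x.2).reverse,
      r.map fun x => .right :: nodeAddr u x.2,
      by simp [stackLeaves, h], by simp [stackLeaves, h', hother]⟩

theorem stackLeaves_touch {S S' : Side → List (ℕ × ℕ)} {k k' m : ℕ} {r : List (ℕ × ℕ)}
    (h : S s = (k, e) :: r) (h' : S' s = (k, m) :: r) (hother : S' s.other = (k', m) :: S s.other)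
    (hm : nodeAddr u m = s :: nodeAddr u e) :
    ∃ X Y, stackLeaves u S = X ++ nodeAddr u m :: Y ∧
      stackLeaves u S' = X ++ [.left :: nodeAddr u m, .right :: nodeAddr u m] ++ Y := by
  cases s <;> simp only [Side.other] at hother
  · exact ⟨(r.map fun x => .left :: nodeAddr u x.2).reverse,
      (S .right).map fun x => .right :: nodeAddr u x.2,
      by simp [stackLeaves, h, hm], by simp [stackLeaves, h', hother]⟩
  · exact ⟨((S .left).map fun x => .left :: nodeAddr u x.2).reverse,
      r.map fun x => .right :: nodeAddr u x.2,
      by simp [stackLeaves, h, hm], by simp [stackLeaves, h', hother]⟩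

namespace IsDescribedAt

theorem step_eq (h : IsDescribedAt u n B) (hu : IsPrefixShuffle u) (s : Side) :
    B.step s.other.openLetter = B.replaceAt (some (s :: nodeAddr u (latest u s n))) B₁ ∧
    B.step s.closeLetter = B.replaceAt (some (s :: nodeAddr u (latest u s n))) (leaf false) := by
  obtain ⟨r, hr⟩ := activeStack_eq_cons hu s n
  cases s
  · have hlast : (B.activeLeaves .left).getLast? =
        some (.left :: nodeAddr u (latest u .left n)) := by
      rw [activeLeaves_eq, h.actives_eq, filter_stackLeaves_left, hr]
      simp
    simp [step, Side.other, Side.openLetter, Side.closeLetter, hlast]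
  · have hfirst : (B.activeLeaves .right).head? =
        some (.right :: nodeAddr u (latest u .right n)) := by
      rw [activeLeaves_eq, h.actives_eq, filter_stackLeaves_right, hr]
      simp
    simp [step, Side.other, Side.openLetter, Side.closeLetter, hfirst]

theorem zero (u : List Letter) : IsDescribedAt u 0 B₁ where
  actives_eq := by simp [stackLeaves, activeStack, actives, B₁, leavesFrom, nodeAddr_zero]
  isNode_iff p := by simp [isNode_B₁, isLabel_zero, nodeAddr_zero]
  nodeAddr_inj h h' _ _ _ := by omega

theorem of_not_open {B' : BinTree} (h : IsDescribedAt u n B)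
    (hopen : ∀ s : Side, u[n]? ≠ some s.openLetter) (hnode : ∀ p, B'.IsNode p ↔ B.IsNode p)
    (hactives : B'.actives = stackLeaves u (activeStack u · (n + 1))) :
    IsDescribedAt u (n + 1) B' where
  actives_eq := hactives
  isNode_iff p := by
    rw [hnode, h.isNode_iff]
    exact ⟨fun ⟨e, hen, he⟩ => ⟨e, by omega, he⟩,
      fun ⟨e, hen, he, hp⟩ => ⟨e, he.le_of_le_succ hen hopen, he, hp⟩⟩
  nodeAddr_inj hen hen' he he' :=
    h.nodeAddr_inj (he.le_of_le_succ hen hopen) (he'.le_of_le_succ hen' hopen) he he'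

theorem open_step (h : IsDescribedAt u n B) (hu : IsPrefixShuffle u)
    (hx : u[n]? = some s.other.openLetter) :
    IsDescribedAt u (n + 1) (B.step s.other.openLetter) := by
  obtain ⟨r, hr⟩ := activeStack_eq_cons hu s n
  have haddr := nodeAddr_touch hu hx
  rw [(h.step_eq hu s).1, ← haddr]
  obtain ⟨X, Y, hXY, hXY'⟩ := stackLeaves_touch (S := (activeStack u · n))
    (S' := (activeStack u · (n + 1))) hr (activeStack_touch hx hr) (activeStack_open hx) haddr
  rw [← h.actives_eq] at hXY
  have hleaf : B.sub (nodeAddr u (n + 1)) = some (leaf true) := mem_actives.1 (by rw [hXY]; simp)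
  have hnew : ∀ {e}, e ≤ n → IsLabel u e → nodeAddr u (n + 1) ≠ nodeAddr u e := fun hen he heq =>
    IsLeaf.not_isNode ⟨_, hleaf⟩ ((h.isNode_iff _).2 ⟨_, hen, he, heq⟩)
  refine ⟨?_, fun p => ?_, fun {e e'} hen hen' he he' heq => ?_⟩
  · rw [actives_replaceAt hXY, hXY']
    simp [leavesFrom, B₁]
  · rw [replaceAt, isNode_replaceDown hleaf, h.isNode_iff]
    simp only [isNode_B₁]
    constructor
    · rintro (⟨e, hen, he⟩ | ⟨t, rfl, rfl⟩)
      · exact ⟨e, by omega, he⟩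
      · exact ⟨n + 1, le_rfl, isLabel_succ hx, rfl⟩
    · rintro ⟨e, hen, he, rfl⟩
      rcases Nat.le_succ_iff.1 hen with hen | rfl
      · exact Or.inl ⟨e, hen, he, rfl⟩
      · exact Or.inr ⟨[], rfl, rfl⟩
  · rcases Nat.le_succ_iff.1 hen with hen | rfl <;> rcases Nat.le_succ_iff.1 hen' with hen' | rfl
    · exact h.nodeAddr_inj hen hen' he he' heq
    · exact absurd heq.symm (hnew hen he)
    · exact absurd heq (hnew hen' he')
    · rfl

theorem close_step (h : IsDescribedAt u n B) (hu : IsPrefixShuffle u)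
    (hx : u[n]? = some s.closeLetter) : IsDescribedAt u (n + 1) (B.step s.closeLetter) := by
  obtain ⟨r, hr⟩ := activeStack_eq_cons hu s n
  rw [(h.step_eq hu s).2]
  obtain ⟨X, Y, hXY, hXY'⟩ := stackLeaves_close (u := u) (S := (activeStack u · n))
    (S' := (activeStack u · (n + 1))) hr (by simp only [activeStack_close hx, hr, List.tail_cons])
    (activeStack_other (by simpa using hx))
  rw [← h.actives_eq] at hXY
  have hleaf : B.sub (s :: nodeAddr u (latest u s n)) = some (leaf true) :=
    mem_actives.1 (by rw [hXY]; simp)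
  refine h.of_not_open (by simp [hx]) (fun p => ?_) ?_
  · rw [replaceAt, isNode_replaceDown hleaf]
    simp [not_isNode_leaf]
  · rw [actives_replaceAt hXY, hXY']
    simp [leavesFrom]

end IsDescribedAt

theorem isDescribedAt_lambda₁ (hu : IsPrefixShuffle u) (n : ℕ) :
    IsDescribedAt u n (lambda₁ (u.take n)) := by
  induction n with
  | zero => exact .zero u
  | succ n ih =>
    rcases hx : u[n]? with _ | x
    · rw [lambda₁_take_none hx]
      exact ih.of_not_open (by simp [hx]) (fun _ => Iff.rfl)
        (by simp only [activeStack_none hx, ih.actives_eq])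
    · rw [lambda₁_take_succ hx]
      rcases x.eq_openLetter_or_closeLetter with ⟨s, rfl⟩ | ⟨s, rfl⟩
      · exact ih.open_step hu hx
      · exact ih.close_step hu hx

end Lambda

/-! ### The map `θ(B)` -/

namespace RootedMap

variable {M : RootedMap} {S : M.D → Prop} {hS : ∀ d, S (M.opp d) ↔ S d} {hroot : ¬ S M.root}

theorem contract_face_val (x : (M.contract S hS hroot).D) :
    ((M.contract S hS hroot).face x).1 = returnPerm M.face S x.1 := by
  have apply_inv_apply : ∀ (O R : Perm {d // ¬ S d}) (x : {d // ¬ S d}), R (O⁻¹ (O x)) = R x := by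
    intro O R x
    simp
  exact congrArg Subtype.val (apply_inv_apply (M.opp.subtypePerm (p := fun d => ¬ S d)
    (fun d => not_congr (hS d))) ((returnPerm M.face S).subtypePerm (p := fun d => ¬ S d)
        (fun d => not_congr (iff_of_eq (returnPerm_label M.face S d)))) x)

theorem contract_cw_eq (hopp : ∀ d, M.opp (M.opp d) = d) {d e : (M.contract S hS hroot).D}
    (h : Via M.face S (M.opp d.1) e.1) : (M.contract S hS hroot).cw d = e := by
  have hd : ¬ S (M.opp d.1) := fun h => d.2 ((hS _).1 h)
  obtain ⟨x, hx, rfl⟩ : ∃ x : (M.contract S hS hroot).D, x.1 = M.opp d.1 ∧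
      (M.contract S hS hroot).opp x = d := ⟨⟨M.opp d.1, hd⟩, rfl, Subtype.ext (hopp _)⟩
  rw [← hx] at h hd
  exact Subtype.ext ((contract_face_val x).trans
    (h.returnPerm_eq (fun z hz h => hd (h ▸ hz)) (propext (iff_of_false e.2 hd))))

theorem contract_vert_cw (hcw : ∀ d, M.vert (M.cw d) = M.vert d)
    (d : (M.contract S hS hroot).D) :
    (M.contract S hS hroot).vert ((M.contract S hS hroot).cw d) =
      (M.contract S hS hroot).vert d := by
  obtain ⟨x, rfl⟩ := (M.contract S hS hroot).opp.surjective d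
  have hface : ∀ z, M.vert (M.face z) = M.vert (M.opp z) := fun z => hcw _
  have hvia := (via_returnPerm M.face S x.1).apply_eq_apply_of_invariant
    (fun z => (Quot.mk _ (M.vert z) : (M.contract S hS hroot).V)) (fun z hz => by
      have hz : S z := by
        by_contra h
        exact hz (propext (iff_of_false h x.2))
      rw [hface]
      exact (Quot.sound ⟨z, hz, rfl, rfl⟩).symm)
  rwa [hface, ← contract_face_val x] at hvia

theorem contract_face_sameCycle {d e : (M.contract S hS hroot).D}
    (h : M.face.SameCycle d.1 e.1) : (M.contract S hS hroot).face.SameCycle d e := by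
  have hface : (M.contract S hS hroot).face =
      (returnPerm M.face S).subtypePerm (p := fun d => ¬ S d)
        (fun d => not_congr (iff_of_eq (returnPerm_label M.face S d))) :=
    Equiv.ext fun x => Subtype.ext (contract_face_val x)
  rw [hface]
  exact Perm.sameCycle_subtypePerm.2 (sameCycle_returnPerm h (propext (iff_of_false d.2 e.2)))

end RootedMap

namespace BinTree

/-- The side of a vertex, the root-vertex being considered as a left son. An edge is branching when
its two ends are of different kinds. -/
def kind : Address → Side
  | [] => .left
  | s :: _ => s

@[simp] theorem kind_cons (s : Side) (p : Address) : kind (s :: p) = s := rfl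

theorem isBranching_cons (s : Side) (p : Address) : IsBranching (s :: p) ↔ s ≠ kind p := by
  rcases p with _ | ⟨t, p⟩ <;> cases s <;> try cases t
  all_goals simp [IsBranching, IsLeftSon, IsRightSon, kind]

/-- The highest vertex contracted with `p`. -/
def chainTop : Address → Address
  | [] => []
  | s :: p => if s = kind p then chainTop p else s :: p

theorem chainTop_kind_cons (p : Address) : chainTop (kind p :: p) = chainTop p := if_pos rfl

theorem chainTop_of_ne {s : Side} {p : Address} (h : s ≠ kind p) : chainTop (s :: p) = s :: p :=
  if_neg h

theorem eq_replicate_append_chainTop (p : Address) :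
    ∃ n, p = List.replicate n (kind p) ++ chainTop p ∧ kind (chainTop p) = kind p := by
  induction p with
  | nil => exact ⟨0, rfl, rfl⟩
  | cons s p ih =>
    by_cases h : s = kind p
    · subst h
      obtain ⟨n, hp, hk⟩ := ih
      rw [chainTop_kind_cons]
      refine ⟨n + 1, ?_, hk⟩
      rw [kind_cons, List.replicate_succ, List.cons_append, ← hp]
    · rw [chainTop_of_ne h]
      exact ⟨0, rfl, rfl⟩

variable {B : BinTree} {p : Address} {s : Side}

theorem vertex_induction {P : Address → Prop} (hleaf : ∀ p, B.IsLeaf p → P p)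
    (hnode : ∀ p, B.IsNode p → (∀ s, P (s :: p)) → P p) (hp : B.IsVertex p) : P p := by
  obtain ⟨n, hn⟩ : ∃ n, B.depth - p.length = n := ⟨_, rfl⟩
  induction n using Nat.strong_induction_on generalizing p with
  | _ n ih =>
    rcases isLeaf_or_isNode hp with h | h
    · exact hleaf p h
    · refine hnode p h fun s => ?_
      have hs := (isVertex_cons B s p).2 h
      obtain ⟨C, hC⟩ := Option.isSome_iff_exists.1 hs
      have hlen := B.length_add_depth_le _ C hC
      rw [List.length_cons] at hlen
      exact ih (B.depth - (p.length + 1)) (by omega) hs (by rw [List.length_cons])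

/-- The half-edge of the vertex `p` in the direction of its father; this is the root for
`p = []`. -/
def fatherHalf (p : Address) (hp : B.IsVertex p) : B.toMap.D := ⟨(p, false), hp, by simp⟩

/-- The half-edge of the node `p` in the direction of its son on side `s`. -/
def sonHalf (s : Side) (p : Address) (hp : B.IsNode p) : B.toMap.D :=
  ⟨(s :: p, true), (isVertex_cons B s p).2 hp, by simp⟩

theorem eq_fatherHalf_or_eq_sonHalf (d : B.toMap.D) :
    (∃ p hp, d = fatherHalf p hp) ∨ ∃ s p hp, d = sonHalf s p hp := by
  obtain ⟨⟨p, _ | _⟩, h1, h2⟩ := d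
  · exact Or.inl ⟨p, h1, rfl⟩
  · rcases p with _ | ⟨s, p⟩
    · simp at h2
    · exact Or.inr ⟨s, p, (isVertex_cons B s p).1 h1, rfl⟩

theorem toMap_opp_opp (d : B.toMap.D) : B.toMap.opp (B.toMap.opp d) = d := B.oppFun_involutive d

theorem toMap_opp_root : B.toMap.opp B.toMap.root = B.toMap.root := by
  change B.oppFun B.toMap.root = B.toMap.root
  simp [oppFun, toMap]

theorem toMap_opp_fatherHalf (hp : B.IsNode p) :
    B.toMap.opp (fatherHalf (s :: p) ((isVertex_cons B s p).2 hp)) = sonHalf s p hp := by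
  change B.oppFun (fatherHalf (s :: p) _) = sonHalf s p hp
  simp [oppFun, fatherHalf, sonHalf]

theorem toMap_opp_sonHalf (hp : B.IsNode p) :
    B.toMap.opp (sonHalf s p hp) = fatherHalf (s :: p) ((isVertex_cons B s p).2 hp) := by
  rw [← toMap_opp_fatherHalf, toMap_opp_opp]

theorem toMap_cw_fatherHalf (hp : B.IsNode p) :
    B.toMap.cw (fatherHalf p hp.isVertex) = sonHalf .right p hp :=
  Subtype.ext (if_pos hp)

theorem toMap_cw_fatherHalf_of_isLeaf (hp : B.IsLeaf p) :
    B.toMap.cw (fatherHalf p hp.isVertex) = fatherHalf p hp.isVertex :=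
  Subtype.ext (if_neg hp.not_isNode)

theorem toMap_cw_sonHalf_right (hp : B.IsNode p) :
    B.toMap.cw (sonHalf .right p hp) = sonHalf .left p hp := rfl

theorem toMap_cw_sonHalf_left (hp : B.IsNode p) :
    B.toMap.cw (sonHalf .left p hp) = fatherHalf p hp.isVertex := rfl

theorem toMap_vert_cw (d : B.toMap.D) : B.toMap.vert (B.toMap.cw d) = B.toMap.vert d := by
  rcases eq_fatherHalf_or_eq_sonHalf d with ⟨p, hp, rfl⟩ | ⟨s, p, hp, rfl⟩
  · rcases isLeaf_or_isNode hp with h | h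
    · rw [toMap_cw_fatherHalf_of_isLeaf h]
    · rw [toMap_cw_fatherHalf h]
      rfl
  · cases s <;> rfl

theorem face_sonHalf (hp : B.IsNode p) : B.toMap.face (sonHalf s p hp) =
    B.toMap.cw (fatherHalf (s :: p) ((isVertex_cons B s p).2 hp)) :=
  congrArg B.toMap.cw (toMap_opp_sonHalf hp)

theorem face_fatherHalf_cons (hp : B.IsNode p) :
    B.toMap.face (fatherHalf (s :: p) ((isVertex_cons B s p).2 hp)) =
      B.toMap.cw (sonHalf s p hp) :=
  congrArg B.toMap.cw (toMap_opp_fatherHalf hp)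

/-- The border of the subtree of `p` runs from its first half-edge back to the edge above `p`. -/
theorem face_sameCycle_cw_fatherHalf (hp : B.IsVertex p) :
    B.toMap.face.SameCycle (B.toMap.cw (fatherHalf p hp)) (fatherHalf p hp) := by
  refine vertex_induction (P := fun p => ∀ hp : B.IsVertex p,
    B.toMap.face.SameCycle (B.toMap.cw (fatherHalf p hp)) (fatherHalf p hp)) ?_ ?_ hp hp
  · intro p h _
    rw [toMap_cw_fatherHalf_of_isLeaf h]
  · intro p h ih _
    have tour (s : Side) : B.toMap.face.SameCycle (sonHalf s p h) (B.toMap.cw (sonHalf s p h)) := by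
      rw [← face_fatherHalf_cons, Perm.sameCycle_apply_right, ← Perm.sameCycle_apply_left,
        face_sonHalf]
      exact ih s _
    rw [toMap_cw_fatherHalf h, ← toMap_cw_sonHalf_left h]
    exact (tour .right).trans (tour .left)

theorem face_sameCycle_sonHalf (hp : B.IsNode p) : B.toMap.face.SameCycle (sonHalf s p hp)
    (fatherHalf (s :: p) ((isVertex_cons B s p).2 hp)) := by
  rw [← Perm.sameCycle_apply_left, face_sonHalf]
  exact face_sameCycle_cw_fatherHalf _

theorem face_sameCycle_root (d : B.toMap.D) : B.toMap.face.SameCycle B.toMap.root d := by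
  have father : ∀ p (hp : B.IsVertex p), B.toMap.face.SameCycle B.toMap.root (fatherHalf p hp) := by
    intro p
    induction p with
    | nil => exact fun _ => .refl _ _
    | cons s p ih =>
      intro hs
      have hp := (isVertex_cons B s p).1 hs
      have right : B.toMap.face.SameCycle B.toMap.root (sonHalf .right p hp) := by
        rw [← toMap_cw_fatherHalf hp]
        exact (ih hp.isVertex).trans (face_sameCycle_cw_fatherHalf _).symm
      have left : B.toMap.face.SameCycle B.toMap.root (sonHalf .left p hp) := by
        rw [← toMap_cw_sonHalf_right hp, ← face_fatherHalf_cons, Perm.sameCycle_apply_right]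
        exact right.trans (face_sameCycle_sonHalf hp)
      cases s
      · exact left.trans (face_sameCycle_sonHalf hp)
      · exact right.trans (face_sameCycle_sonHalf hp)
  rcases eq_fatherHalf_or_eq_sonHalf d with ⟨p, hp, rfl⟩ | ⟨s, p, hp, rfl⟩
  · exact father p hp
  · exact (father (s :: p) _).trans (face_sameCycle_sonHalf hp).symm

theorem theta_face_sameCycle (d e : B.theta.D) : B.theta.face.SameCycle d e :=
  RootedMap.contract_face_sameCycle ((face_sameCycle_root d.1).symm.trans (face_sameCycle_root e.1))

/-- The vertex of `θ(B)` into which a vertex of `B` is contracted. -/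
noncomputable def thetaVertex (p : Address) (hp : B.IsVertex p) : B.theta.V :=
  Quot.mk _ (⟨p, hp⟩ : {p // B.IsVertex p})

theorem thetaVertex_congr {q : Address} {hp : B.IsVertex p} {hq : B.IsVertex q} (h : p = q) :
    thetaVertex p hp = thetaVertex q hq := by
  subst h
  rfl

theorem isNonBranching_fatherHalf (hp : B.IsVertex (s :: p)) (h : kind p = s) :
    IsNonBranching (fatherHalf (s :: p) hp) :=
  ⟨List.cons_ne_nil _ _, fun hb => (isBranching_cons _ _).1 hb h.symm⟩

theorem isNonBranching_sonHalf (hp : B.IsNode p) (h : kind p = s) :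
    IsNonBranching (sonHalf s p hp) :=
  ⟨List.cons_ne_nil _ _, fun hb => (isBranching_cons _ _).1 hb h.symm⟩

theorem thetaVertex_kind_cons (hp : B.IsNode p) :
    thetaVertex (kind p :: p) ((isVertex_cons B _ p).2 hp) = thetaVertex p hp.isVertex :=
  Quot.sound ⟨fatherHalf (kind p :: p) _, isNonBranching_fatherHalf _ rfl, rfl,
    congrArg B.toMap.vert (toMap_opp_fatherHalf hp)⟩

/-- The highest vertex of `B` contracted into a vertex of `θ(B)`. -/
noncomputable def thetaTop : B.theta.V → Address :=
  Quot.lift (fun p => chainTop p.1) (by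
    rintro _ _ ⟨d, ⟨hne, hd⟩, rfl, rfl⟩
    rcases eq_fatherHalf_or_eq_sonHalf d with ⟨_ | ⟨s, p⟩, hp, rfl⟩ | ⟨s, p, hp, rfl⟩
    · exact absurd rfl hne
    · obtain rfl : s = kind p := not_not.1 fun h => hd ((isBranching_cons s p).2 h)
      rw [toMap_opp_fatherHalf ((isVertex_cons B _ p).1 hp)]
      exact chainTop_kind_cons p
    · obtain rfl : s = kind p := not_not.1 fun h => hd ((isBranching_cons s p).2 h)
      rw [toMap_opp_sonHalf]
      exact (chainTop_kind_cons p).symm)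

theorem thetaTop_thetaVertex (hp : B.IsVertex p) : thetaTop (thetaVertex p hp) = chainTop p := rfl

theorem exists_thetaVertex_chainTop (hp : B.IsVertex p) :
    ∃ h : B.IsVertex (chainTop p), thetaVertex (chainTop p) h = thetaVertex p hp := by
  induction p with
  | nil => exact ⟨hp, rfl⟩
  | cons s p ih =>
    by_cases h : s = kind p
    · subst h
      have hN := (isVertex_cons B _ p).1 hp
      rw [chainTop_kind_cons, thetaVertex_kind_cons hN]
      exact ih hN.isVertex
    · rw [chainTop_of_ne h]
      exact ⟨hp, rfl⟩

theorem thetaTop_injective : Function.Injective (thetaTop (B := B)) := by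
  rintro ⟨⟨p, hp⟩⟩ ⟨⟨q, hq⟩⟩ h
  obtain ⟨_, hp'⟩ := exists_thetaVertex_chainTop hp
  obtain ⟨_, hq'⟩ := exists_thetaVertex_chainTop hq
  exact hp'.symm.trans ((thetaVertex_congr h).trans hq')

/-- Among the edges from a node `p` to its two sons, exactly one is branching. Its half-edges are
indexed by the sides: on side `s`, the half-edge is incident to the vertex of `θ(B)` that contains
the son of `p` on side `s`. -/
noncomputable def thetaHalf (p : Address) (hp : B.IsNode p) (s : Side) : B.theta.D :=
  ⟨(⟨((kind p).other :: p, decide (s = kind p)), (isVertex_cons B _ p).2 hp, by simp⟩ :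
    B.HalfEdge), fun h => h.2 ((isBranching_cons _ _).2 (Side.other_ne _))⟩

theorem thetaHalf_congr {q : Address} {hp : B.IsNode p} {hq : B.IsNode q} (h : p = q) :
    thetaHalf p hp s = thetaHalf q hq s := by
  subst h
  rfl

theorem thetaHalf_kind (hp : B.IsNode p) (h : kind p = s) :
    (thetaHalf p hp s).1 = sonHalf s.other p hp :=
  Subtype.ext (by simp [thetaHalf, sonHalf, h])

theorem thetaHalf_other (hp : B.IsNode p) (h : kind p = s.other) : (thetaHalf p hp s).1 =
    fatherHalf (s :: p) ((isVertex_cons B s p).2 hp) :=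
  Subtype.ext (by simp [thetaHalf, fatherHalf, h, (Side.other_ne s).symm])

theorem kind_eq_or_eq_other (s : Side) (p : Address) : kind p = s ∨ kind p = s.other :=
  or_iff_not_imp_left.2 Side.eq_other_of_ne

theorem thetaHalf_inj {p' : Address} {hp : B.IsNode p} {hp' : B.IsNode p'} {s' : Side}
    (h : thetaHalf p hp s = thetaHalf p' hp' s') : p = p' ∧ s = s' := by
  have h := congrArg (fun d => d.1.1) h
  simp only [thetaHalf, Prod.mk.injEq, List.cons.injEq, decide_eq_decide] at h
  obtain ⟨⟨-, rfl⟩, h⟩ := h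
  refine ⟨rfl, ?_⟩
  revert h
  cases s <;> cases s' <;> cases kind p <;> simp

theorem thetaHalf_ne_root {hp : B.IsNode p} : thetaHalf p hp s ≠ B.theta.root := fun h =>
  List.cons_ne_nil _ _ (congrArg (fun d => d.1.1.1) h)

theorem eq_root_or_eq_thetaHalf (d : B.theta.D) :
    d = B.theta.root ∨ ∃ p hp s, d = thetaHalf p hp s := by
  obtain ⟨d, hd⟩ := d
  have hbranch : ∀ s p, d.1.1 = s :: p → kind p = s.other := fun s p h =>
    Side.eq_other_of_ne fun hs => hd ⟨by simp [h], by rw [h, isBranching_cons]; simpa using hs.symm⟩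
  rcases eq_fatherHalf_or_eq_sonHalf d with ⟨_ | ⟨s, p⟩, hp, rfl⟩ | ⟨s, p, hp, rfl⟩
  · exact Or.inl rfl
  · exact Or.inr ⟨p, (isVertex_cons B s p).1 hp, s, Subtype.ext
      (thetaHalf_other _ (hbranch s p rfl)).symm⟩
  · refine Or.inr ⟨p, hp, s.other, Subtype.ext ?_⟩
    rw [thetaHalf_kind hp (hbranch s p rfl), Side.other_other]

theorem theta_opp_root : B.theta.opp B.theta.root = B.theta.root := Subtype.ext toMap_opp_root

theorem theta_opp_opp (d : B.theta.D) : B.theta.opp (B.theta.opp d) = d :=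
  Subtype.ext (toMap_opp_opp d.1)

theorem theta_opp_thetaHalf (p : Address) (hp : B.IsNode p) (s : Side) :
    B.theta.opp (thetaHalf p hp s) = thetaHalf p hp s.other := by
  refine Subtype.ext ?_
  change B.toMap.opp (thetaHalf p hp s).1 = _
  rcases kind_eq_or_eq_other s p with h | h
  · rw [thetaHalf_kind hp h, toMap_opp_sonHalf, thetaHalf_other hp (by rw [h, Side.other_other])]
  · rw [thetaHalf_other hp h, toMap_opp_fatherHalf hp, thetaHalf_kind hp h, Side.other_other]

theorem theta_vert_thetaHalf (p : Address) (hp : B.IsNode p) (s : Side) :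
    B.theta.vert (thetaHalf p hp s) = thetaVertex (s :: p) ((isVertex_cons B s p).2 hp) := by
  change Quot.mk _ (B.toMap.vert (thetaHalf p hp s).1) = _
  rcases kind_eq_or_eq_other s p with rfl | h
  · rw [thetaHalf_kind hp rfl, thetaVertex_kind_cons hp]
    rfl
  · rw [thetaHalf_other hp h]
    rfl

theorem isVertex_nil (B : BinTree) : B.IsVertex [] := rfl

theorem theta_vert_root : B.theta.vert B.theta.root = thetaVertex [] B.isVertex_nil := rfl

theorem theta_vert_cw (d : B.theta.D) : B.theta.vert (B.theta.cw d) = B.theta.vert d :=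
  RootedMap.contract_vert_cw toMap_vert_cw d

theorem theta_cw_eq {d e : B.theta.D} (h : B.toMap.cw d.1 = e.1) : B.theta.cw d = e := by
  refine RootedMap.contract_cw_eq toMap_opp_opp (.single ?_)
  change B.toMap.cw (B.toMap.opp (B.toMap.opp d.1)) = e.1
  rw [toMap_opp_opp, h]

theorem theta_cw_eq_face_cw {d e : B.theta.D} (hcw : IsNonBranching (B.toMap.cw d.1))
    (h : B.toMap.face (B.toMap.cw d.1) = e.1) : B.theta.cw d = e := by
  refine RootedMap.contract_cw_eq toMap_opp_opp (.tail (.single ?_) hcw h)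
  change B.toMap.cw (B.toMap.opp (B.toMap.opp d.1)) = _
  rw [toMap_opp_opp]

theorem theta_cw_root (h : B.IsNode []) : B.theta.cw B.theta.root = thetaHalf [] h .left := by
  refine theta_cw_eq ?_
  rw [thetaHalf_kind (s := .left) h rfl]
  exact toMap_cw_fatherHalf h

theorem theta_cw_left (p : Address) (hp : B.IsNode p) (hq : B.IsNode (.left :: p)) :
    B.theta.cw (thetaHalf p hp .left) = thetaHalf (.left :: p) hq .left := by
  have himage : (thetaHalf (.left :: p) hq .left).1 = sonHalf .right (.left :: p) hq :=
    thetaHalf_kind (s := .left) hq rfl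
  rcases kind_eq_or_eq_other .left p with h | h
  · have hcw : B.toMap.cw (thetaHalf p hp .left).1 = sonHalf .left p hp := by
      rw [thetaHalf_kind hp h]
      exact toMap_cw_sonHalf_right hp
    refine theta_cw_eq_face_cw ?_ ?_ <;> rw [hcw]
    · exact isNonBranching_sonHalf hp h
    · rw [face_sonHalf, toMap_cw_fatherHalf hq, himage]
  · refine theta_cw_eq ?_
    rw [thetaHalf_other hp h, toMap_cw_fatherHalf hq, himage]

theorem theta_cw_right (p : Address) (hp : B.IsNode p) (hq : B.IsNode (.right :: p)) :
    B.theta.cw (thetaHalf (.right :: p) hq .right) = thetaHalf p hp .right := by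
  have hcw : B.toMap.cw (thetaHalf (.right :: p) hq .right).1 =
      fatherHalf (.right :: p) hq.isVertex := by
    rw [thetaHalf_kind (s := .right) hq rfl]
    exact toMap_cw_sonHalf_left hq
  rcases kind_eq_or_eq_other .right p with h | h
  · refine theta_cw_eq_face_cw ?_ ?_ <;> rw [hcw]
    · exact isNonBranching_fatherHalf _ h
    · rw [face_fatherHalf_cons hp, toMap_cw_sonHalf_right hp, thetaHalf_kind hp h]
      rfl
  · refine theta_cw_eq ?_
    rw [hcw, thetaHalf_other hp h]

theorem theta_vert_surjective : Function.Surjective B.theta.vert := by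
  rintro ⟨⟨_ | ⟨s, p⟩, hp⟩⟩
  · exact ⟨B.theta.root, theta_vert_root⟩
  · exact ⟨thetaHalf p ((isVertex_cons B s p).1 hp) s, theta_vert_thetaHalf _ _ _⟩

theorem theta_connected (x y : B.theta.V) : Relation.ReflTransGen
    (fun x y => ∃ d, B.theta.vert d = x ∧ B.theta.vert (B.theta.opp d) = y) x y := by
  set Adj := fun x y => ∃ d, B.theta.vert d = x ∧ B.theta.vert (B.theta.opp d) = y
  have symm : Std.Symm Adj := ⟨fun x y ⟨d, hx, hy⟩ => ⟨B.theta.opp d, hy, by rwa [theta_opp_opp]⟩⟩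
  have from_root : ∀ p (hp : B.IsVertex p),
      Relation.ReflTransGen Adj (thetaVertex [] B.isVertex_nil) (thetaVertex p hp) := by
    intro p
    induction p with
    | nil => exact fun _ => .refl
    | cons s p ih =>
      intro hp
      have hN := (isVertex_cons B s p).1 hp
      by_cases h : s = kind p
      · subst h
        rw [thetaVertex_kind_cons hN]
        exact ih hN.isVertex
      · obtain rfl := Side.eq_other_of_ne h
        refine (ih hN.isVertex).tail ⟨thetaHalf p hN (kind p), ?_, ?_⟩
        · rw [theta_vert_thetaHalf, thetaVertex_kind_cons hN]
        · rw [theta_opp_thetaHalf, theta_vert_thetaHalf]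
  obtain ⟨⟨p, hp⟩⟩ := x
  obtain ⟨⟨q, hq⟩⟩ := y
  exact (Std.Symm.symm _ _ (from_root p hp)).trans (from_root q hq)

theorem isNode_of_isVertex_append {n : ℕ} (h : B.IsVertex (List.replicate (n + 1) s ++ p)) :
    B.IsNode p := by
  induction n with
  | zero => exact (isVertex_cons B s p).1 h
  | succ n ih =>
    rw [List.replicate_succ, List.cons_append, isVertex_cons] at h
    exact ih h.isVertex

theorem Leaf.vertex_injective : Function.Injective (Leaf.vertex (B := B)) := by
  intro l m h
  have htop : chainTop l.1 = chainTop m.1 := congrArg thetaTop h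
  obtain ⟨i, hl, hkl⟩ := eq_replicate_append_chainTop l.1
  obtain ⟨j, hm, hkm⟩ := eq_replicate_append_chainTop m.1
  rw [htop, ← hkl, htop] at hl
  rw [← hkm] at hm
  have length_le : ∀ (l m : B.Leaf) (i j : ℕ) (s : Side) (t : Address),
      l.1 = List.replicate i s ++ t → m.1 = List.replicate j s ++ t → j ≤ i := by
    refine fun l m i j s t hl hm => not_lt.1 fun hij => ?_
    obtain ⟨n, rfl⟩ := Nat.exists_eq_add_of_lt hij
    rw [show i + n + 1 = (n + 1) + i by omega, ← List.replicate_append_replicate,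
      List.append_assoc, ← hl] at hm
    exact l.2.not_isNode (isNode_of_isVertex_append (hm ▸ m.2.isVertex))
  obtain rfl : i = j := le_antisymm (length_le m l _ _ _ _ hm hl)
    (length_le l m _ _ _ _ hl hm)
  exact Subtype.ext (hl.trans hm.symm)

theorem Leaf.vertex_surjective : Function.Surjective (Leaf.vertex (B := B)) := by
  rintro ⟨⟨p, hp⟩⟩
  refine vertex_induction (P := fun p => ∀ hp : B.IsVertex p,
    ∃ l : B.Leaf, l.vertex = thetaVertex p hp) ?_ ?_ hp hp
  · exact fun p h _ => ⟨⟨p, h⟩, rfl⟩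
  · intro p h ih
    obtain ⟨l, hl⟩ := ih (kind p) ((isVertex_cons B _ p).2 h)
    exact fun _ => ⟨l, hl.trans (thetaVertex_kind_cons h)⟩

end BinTree

section Lambda

open BinTree

variable {u : List Letter} {s : Side} {e : ℕ}

/-- The highest vertex contracted into the vertex of `θ` that corresponds to the vertex of `P_w`
opened at label `k` on side `s`. -/
def topAddr (u : List Letter) (s : Side) (k : ℕ) : Address :=
  if s = .left ∧ k = 0 then [] else s :: nodeAddr u k

theorem chainTop_cons_nodeAddr (hu : IsPrefixShuffle u) (he : IsLabel u e) :
    chainTop (s :: nodeAddr u e) = topAddr u s (opening u s e) := by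
  induction e using Nat.strong_induction_on with
  | _ e ih =>
    rcases he.cases with rfl | ⟨i, t, rfl, ht⟩
    · cases s <;> simp [nodeAddr_zero, topAddr, opening, activeStack, chainTop, kind]
    · by_cases hts : t = s
      · subst hts
        have haddr : nodeAddr u (i + 1) = _ := nodeAddr_touch (s := t.other) hu (by simpa using ht)
        rw [opening_open ht, chainTop_of_ne (by rw [haddr]; exact (Side.other_ne t).symm), topAddr]
        simp
      · obtain rfl := Side.eq_other_of_ne hts
        have haddr := nodeAddr_touch hu ht
        have hkind : kind (nodeAddr u (i + 1)) = s := by rw [haddr, kind_cons]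
        have htop := chainTop_kind_cons (nodeAddr u (i + 1))
        rw [hkind] at htop
        rw [htop, haddr, ih _ (Nat.lt_succ_of_le (latest_le hu s i)) (isLabel_latest hu s i),
          opening_latest hu, opening_touch hu ht]

theorem topAddr_inj (hu : IsPrefixShuffle u) {s' : Side} {k k' : ℕ}
    (hk : IsLabel u k) (hk' : IsLabel u k') (h : topAddr u s k = topAddr u s' k') :
    s = s' ∧ k = k' := by
  have inj : nodeAddr u k = nodeAddr u k' → k = k' :=
    (isDescribedAt_lambda₁ hu (max k k')).nodeAddr_inj (le_max_left _ _) (le_max_right _ _) hk hk'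
  unfold topAddr at h
  split_ifs at h with h1 h2 h2
  · exact ⟨h1.1.trans h2.1.symm, h1.2.trans h2.2.symm⟩
  · exact ⟨(List.cons.inj h).1, inj (List.cons.inj h).2⟩

end Lambda

/-! ### The half-edges of `M_w` and of `M★_w` -/

namespace PrefixMap

variable {w : List Letter}

theorem isPrefixShuffle_plus (hw : IsPrefixShuffle w) : IsPrefixShuffle (plus w) := by
  intro v hv
  have hcount := hw w (List.prefix_refl w)
  rcases List.prefix_or_prefix_of_prefix hv (List.prefix_append w _) with h | ⟨t, rfl⟩
  · exact hw v h
  · rw [plus, List.prefix_append_right_inj, List.prefix_replicate_iff] at hv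
    obtain ⟨hlength, ht⟩ := hv
    rw [ht]
    simp only [List.count_append, List.count_replicate, BEq.rfl, ↓reduceIte, reduceCtorEq,
      beq_iff_eq, add_zero]
    omega

theorem take_plus (w : List Letter) : (plus w).take w.length = w := by simp [plus]

theorem length_le_plus (w : List Letter) : w.length ≤ (plus w).length := by simp [plus]

theorem count_plus (hw : IsPrefixShuffle w) : (plus w).count .a = (plus w).count .abar := by
  have hcount := hw w (List.prefix_refl w)
  simp only [plus, List.count_append, List.count_replicate, BEq.rfl, ↓reduceIte, reduceCtorEq,
    beq_iff_eq, add_zero]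
  omega

theorem getElem?_plus_of_le {n : ℕ} (h : w.length ≤ n) (hn : n < (plus w).length) :
    (plus w)[n]? = some .abar := by
  rw [plus, List.length_append, List.length_replicate] at hn
  rw [plus, List.getElem?_append_right h, List.getElem?_replicate, if_pos (by omega)]

theorem eq_zero_of_isActiveAt_right_length (hw : IsPrefixShuffle w) {k : ℕ}
    (h : IsActiveAt (plus w) .right (plus w).length k) : k = 0 := by
  have hlength := length_activeStack (isPrefixShuffle_plus hw) .right (plus w).length
  rw [List.take_length] at hlength
  have hcount := count_plus hw
  obtain ⟨r, hr⟩ := activeStack_eq_cons (isPrefixShuffle_plus hw) .right (plus w).length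
  simp only [hr, List.length_cons, Side.closeLetter, Side.openLetter, hcount] at hlength
  obtain rfl : r = [] := List.length_eq_zero_iff.1 (by omega)
  obtain ⟨e, h⟩ := h
  rw [hr, List.mem_singleton] at h
  rcases activeStack_cons (isPrefixShuffle_plus hw) hr with ⟨hzero, -⟩ | ⟨i, -, hi, -⟩
  · rw [(Prod.mk.inj h).1, hzero]
  · obtain ⟨r', hr'⟩ := activeStack_eq_cons (isPrefixShuffle_plus hw) .right i
    simp [hr'] at hi

/-- The tour of `T_w`, as the sequence of the half-edges it meets: `tour w 0` is the root, and
`tour w (i + 1)` is met when the letter at position `i` of `w⁺` is written. -/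
def tour (w : List Letter) (n : ℕ) : HalfEdge w := Fin.ofNat _ n

theorem tour_val {n : ℕ} (h : n ≤ (plus w).length) : (tour w n).val = n :=
  Nat.mod_eq_of_lt (Nat.lt_succ_of_le h)

theorem tour_val_self (d : HalfEdge w) : tour w d.val = d := by
  apply Fin.ext
  rw [tour_val (by omega)]

theorem tour_zero : tour w 0 = root w := rfl

theorem eq_root_or_eq_tour (d : HalfEdge w) :
    d = root w ∨ ∃ n x, d = tour w (n + 1) ∧ (plus w)[n]? = some x := by
  obtain ⟨_ | n, h⟩ := d
  · exact Or.inl rfl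
  · have hn : n < (plus w).length := by omega
    exact Or.inr ⟨n, _, (tour_val_self _).symm, List.getElem?_eq_getElem hn⟩

theorem finRotate_tour (n : ℕ) : finRotate _ (tour w n) = tour w (n + 1) := by
  rw [finRotate_apply]
  apply Fin.ext
  simp [tour, Fin.ofNat, Fin.val_add]

theorem hasLetter_tour {n : ℕ} {c x : Letter} (h : (plus w)[n]? = some x) :
    HasLetter w (tour w (n + 1)) c ↔ c = x := by
  have hn := (List.getElem?_eq_some_iff.1 h).1
  unfold HasLetter
  rw [tour_val (by omega)]
  constructor
  · rintro ⟨i, hi, hc⟩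
    obtain rfl : n = i := by omega
    exact Option.some.inj (hc.symm.trans h)
  · rintro rfl
    exact ⟨n, rfl, h⟩

theorem tour_succ_ne_root {n : ℕ} (h : n < (plus w).length) : tour w (n + 1) ≠ root w := by
  intro heq
  have hval := congrArg Fin.val heq
  rw [tour_val (by omega)] at hval
  exact Nat.succ_ne_zero n hval

theorem isHead_tour {n : ℕ} {x : Letter} (h : (plus w)[n]? = some x) :
    IsHead w (tour w (n + 1)) ↔ x = .abar ∨ x = .b := by
  rw [IsHead, hasLetter_tour h, hasLetter_tour h]
  simp [tour_succ_ne_root (List.getElem?_eq_some_iff.1 h).1, eq_comm]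

theorem linked_tour {c c' : Letter} {i j : ℕ} (h : IsPaired c c' (plus w) i j) :
    Linked w c c' (tour w (i + 1)) (tour w (j + 1)) := by
  have hij := h.1
  have hj := h.lt_length
  exact ⟨i, j, tour_val (by omega), tour_val (by omega), Or.inl h⟩

theorem treeOpp_eq {d e : HalfEdge w} (h : Linked w .a .abar d e) : treeOpp w d = e :=
  partner_eq (fun _ _ _ h h' => h.unique (by simp) h') h

theorem treeOpp_treeOpp (d : HalfEdge w) : treeOpp w (treeOpp w d) = d :=
  partner_involutive (R := Linked w .a .abar) (fun _ _ h => h.symm)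
    (fun _ _ _ h h' => h.unique (by simp) h') d

theorem not_linked_a_and_linked_b {d e f : HalfEdge w} (h : Linked w .a .abar d e)
    (h' : Linked w .b .bbar d f) : False := by
  rcases h.letter with h | h <;> rcases h'.letter with h' | h' <;> cases h.unique h'

theorem opp_eq {d e : HalfEdge w} (h : Linked w .a .abar d e ∨ Linked w .b .bbar d e) :
    opp w d = e := by
  refine partner_eq (R := fun d e => Linked w .a .abar d e ∨ Linked w .b .bbar d e) ?_ h
  rintro d e f (h | h) (h' | h')
  · exact h.unique (by simp) h'
  · exact (not_linked_a_and_linked_b h h').elim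
  · exact (not_linked_a_and_linked_b h' h).elim
  · exact h.unique (by simp) h'

theorem treeOpp_root : treeOpp w (root w) = root w := by
  refine partner_of_not ?_
  rintro ⟨y, i, _, h, _⟩
  simp [root] at h

theorem treeOpp_tour {n : ℕ} {x : Letter} (h : (plus w)[n]? = some x) (ha : x ≠ .a)
    (ha' : x ≠ .abar) : treeOpp w (tour w (n + 1)) = tour w (n + 1) := by
  refine partner_of_not ?_
  rintro ⟨y, hy⟩
  rcases hy.letter with hletter | hletter <;> rw [hasLetter_tour h] at hletter
  · exact ha hletter.symm
  · exact ha' hletter.symm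

theorem ccw_treeOpp_tour (n : ℕ) : ccw w (treeOpp w (tour w n)) = tour w (n + 1) := by
  rw [ccw, Perm.mul_apply, ← finRotate_tour]
  simp

theorem exists_paired_a (hw : IsPrefixShuffle w) {i : ℕ} (h : (plus w)[i]? = some .a) :
    ∃ j, IsPaired .a .abar (plus w) i j := by
  have hi := (List.getElem?_eq_some_iff.1 h).1
  by_contra hunpaired
  have hactive := (isActiveAt_iff (s := .right) (isPrefixShuffle_plus hw) h hi).2
    fun ⟨j, _, hj⟩ => hunpaired ⟨j, hj⟩
  exact Nat.succ_ne_zero i (eq_zero_of_isActiveAt_right_length hw hactive)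

theorem exists_paired_abar (hw : IsPrefixShuffle w) {j : ℕ} (h : (plus w)[j]? = some .abar) :
    ∃ i, IsPaired .a .abar (plus w) i j := by
  obtain ⟨i, _, _, _, h⟩ := exists_isPaired_of_close (s := .right) (isPrefixShuffle_plus hw) h
  exact ⟨i, h⟩

theorem exists_paired_bbar (hw : IsPrefixShuffle w) {j : ℕ} (h : (plus w)[j]? = some .bbar) :
    ∃ i, IsPaired .b .bbar (plus w) i j := by
  obtain ⟨i, _, _, _, h⟩ := exists_isPaired_of_close (s := .left) (isPrefixShuffle_plus hw) h
  exact ⟨i, h⟩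

theorem exists_linked_tour_iff {c c' : Letter} (hc : c ≠ c') {i : ℕ}
    (h : (plus w)[i]? = some c) :
    (∃ d, Linked w c c' (tour w (i + 1)) d) ↔ ∃ j, IsPaired c c' (plus w) i j := by
  constructor
  · rintro ⟨d, i', j, hi, -, hpaired⟩
    rw [tour_val (List.getElem?_eq_some_iff.1 h).1] at hi
    obtain rfl : i = i' := by omega
    rcases hpaired with hij | hji
    · exact ⟨j, hij⟩
    · exact absurd (Option.some.inj (h.symm.trans hji.2.2.1)) hc
  · rintro ⟨j, hj⟩
    exact ⟨_, linked_tour hj⟩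

theorem isDangling_tour (hw : IsPrefixShuffle w) {k : ℕ} (hk : k ≤ (plus w).length) :
    IsDangling w (tour w k) ↔ k ≠ 0 ∧ IsActiveAt (plus w) .left (plus w).length k := by
  have hu := isPrefixShuffle_plus hw
  rcases k with _ | i
  · simp [IsDangling, HasLetter, tour_zero, root]
  have hx := List.getElem?_eq_getElem (l := plus w) (i := i) (by omega)
  have isActiveAt_iff_of_b (hb : (plus w)[i]? = some .b) :
      IsActiveAt (plus w) .left (plus w).length (i + 1) ↔
        ¬ ∃ d, Linked w .b .bbar (tour w (i + 1)) d := by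
    rw [exists_linked_tour_iff (by simp) hb, isActiveAt_iff (s := .left) hu hb (by omega)]
    exact not_congr ⟨fun ⟨j, _, hj⟩ => ⟨j, hj⟩, fun ⟨j, hj⟩ => ⟨j, hj.lt_length, hj⟩⟩
  constructor
  · rintro ⟨hletter, hunlinked⟩
    rw [hasLetter_tour hx] at hletter
    exact ⟨Nat.succ_ne_zero i, (isActiveAt_iff_of_b (hletter ▸ hx)).2 hunlinked⟩
  · rintro ⟨-, hactive⟩
    have hlabel : IsOpeningLabel (plus w) .left (i + 1) := by
      obtain ⟨e, he⟩ := hactive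
      exact (mem_activeStack hu he).2.2.1 ▸ isOpeningLabel_opening hu .left e
    rcases hlabel with h | ⟨i', h, hb⟩
    · omega
    · obtain rfl : i = i' := by omega
      exact ⟨(hasLetter_tour hb).2 rfl, (isActiveAt_iff_of_b hb).1 hactive⟩

/-! ### Heads and labels -/

/-- The label of the edge of a head: `0` for the root, and that of the letter `a` or `b` of this
edge otherwise. -/
noncomputable def headLabel (h : Head w) : ℕ := (treeOpp w h.1).val

theorem isHead_treeOpp_tour (hw : IsPrefixShuffle w) {e : ℕ} (he : IsLabel (plus w) e) :
    IsHead w (treeOpp w (tour w e)) := by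
  rcases he.cases with rfl | ⟨i, s, rfl, hs⟩
  · rw [tour_zero, treeOpp_root]
    exact Or.inl rfl
  · cases s
    · rw [treeOpp_tour hs (by simp [Side.openLetter]) (by simp [Side.openLetter]), isHead_tour hs]
      exact Or.inr rfl
    · obtain ⟨j, hj⟩ := exists_paired_a hw hs
      rw [treeOpp_eq (linked_tour hj), isHead_tour hj.2.2.1]
      exact Or.inl rfl

/-- The head of the edge of label `e`, inverse to `headLabel`. -/
noncomputable def headAt (hw : IsPrefixShuffle w) {e : ℕ} (he : IsLabel (plus w) e) : Head w :=
  ⟨treeOpp w (tour w e), isHead_treeOpp_tour hw he⟩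

theorem headAt_val (hw : IsPrefixShuffle w) {e : ℕ} (he : IsLabel (plus w) e) :
    (headAt hw he).1 = treeOpp w (tour w e) := rfl

theorem headLabel_headAt (hw : IsPrefixShuffle w) {e : ℕ} (he : IsLabel (plus w) e) :
    headLabel (headAt hw he) = e := by
  rw [headLabel, headAt, treeOpp_treeOpp, tour_val he.le_length]

theorem isLabel_headLabel (hw : IsPrefixShuffle w) (h : Head w) :
    IsLabel (plus w) (headLabel h) := by
  obtain ⟨d, hhead⟩ := h
  unfold headLabel
  rcases eq_root_or_eq_tour d with rfl | ⟨n, x, rfl, hx⟩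
  · rw [treeOpp_root]
    exact isLabel_zero _
  · have hn := (List.getElem?_eq_some_iff.1 hx).1
    rcases (isHead_tour hx).1 hhead with rfl | rfl
    · obtain ⟨i, hi⟩ := exists_paired_abar hw hx
      have hin := hi.1
      rw [treeOpp_eq (linked_tour hi).symm, tour_val (by omega)]
      exact isLabel_succ (s := .right) hi.2.1
    · rw [treeOpp_tour hx (by simp) (by simp), tour_val (by omega)]
      exact isLabel_succ (s := .left) hx

theorem headAt_headLabel (hw : IsPrefixShuffle w) (h : Head w) :
    headAt hw (isLabel_headLabel hw h) = h := by
  apply Subtype.ext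
  rw [headAt_val]
  unfold headLabel
  rw [tour_val_self, treeOpp_treeOpp]

theorem exists_eq_headAt (hw : IsPrefixShuffle w) (h : Head w) :
    ∃ e, ∃ he : IsLabel (plus w) e, h = headAt hw he :=
  ⟨headLabel h, isLabel_headLabel hw h, (headAt_headLabel hw h).symm⟩

theorem headAt_congr (hw : IsPrefixShuffle w) {e e' : ℕ} {he : IsLabel (plus w) e}
    {he' : IsLabel (plus w) e'} (h : e = e') : headAt hw he = headAt hw he' := by
  subst h
  rfl

theorem ccw_headAt (hw : IsPrefixShuffle w) {e : ℕ} (he : IsLabel (plus w) e) :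
    ccw w (headAt hw he).1 = tour w (e + 1) :=
  ccw_treeOpp_tour e

theorem ccw_tour_of_paired {i j : ℕ} (h : IsPaired .a .abar (plus w) i j) :
    ccw w (tour w (i + 1)) = tour w (j + 2) := by
  rw [← treeOpp_eq (linked_tour h).symm, ccw_treeOpp_tour]

theorem ccw_tour {n : ℕ} {x : Letter} (h : (plus w)[n]? = some x) (ha : x ≠ .a)
    (ha' : x ≠ .abar) : ccw w (tour w (n + 1)) = tour w (n + 2) := by
  conv_lhs => rw [← treeOpp_tour h ha ha', ccw_treeOpp_tour]

theorem headAt_of_b (hw : IsPrefixShuffle w) {i : ℕ} (h : (plus w)[i]? = some .b)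
    (he : IsLabel (plus w) (i + 1)) : (headAt hw he).1 = tour w (i + 1) :=
  treeOpp_tour h (by simp) (by simp)

theorem headAt_zero (hw : IsPrefixShuffle w) (he : IsLabel (plus w) 0) :
    (headAt hw he).1 = root w := by
  rw [headAt_val, tour_zero, treeOpp_root]

/-! ### Following the borders of the faces of `M★_w` -/

theorem starFace_near (h : Head w) : starFace w (near h) = old (ccw w h.1) := rfl

theorem starFace_far (h : Head w) : starFace w (far h) = far ((nextHead w).symm h) := rfl

theorem starFace_old_head {d : HalfEdge w} (h : IsHead w (opp w d)) :
    starFace w (old d) = near ⟨opp w d, h⟩ :=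
  dif_pos h

theorem starFace_old_tail {d : HalfEdge w} (h : ¬ IsHead w (opp w d)) :
    starFace w (old d) = old (ccw w (opp w d)) :=
  dif_neg h

theorem starFace_old_eq_near {d : HalfEdge w} {h : Head w} (hopp : opp w d = h.1) :
    starFace w (old d) = near h := by
  rw [starFace_old_head (by rw [hopp]; exact h.2)]
  exact congrArg near (Subtype.ext hopp)

theorem starFace_near_headAt (hw : IsPrefixShuffle w) {e : ℕ} (he : IsLabel (plus w) e) :
    starFace w (near (headAt hw he)) = old (tour w (e + 1)) := by
  rw [starFace_near, ccw_headAt]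

theorem starFace_root (hw : IsPrefixShuffle w) :
    starFace w (old (root w)) = near (headAt hw (isLabel_zero _)) :=
  starFace_old_eq_near (by rw [opp_root, headAt_zero])

theorem starFace_a (hw : IsPrefixShuffle w) {i : ℕ} (h : (plus w)[i]? = some .a)
    (he : IsLabel (plus w) (i + 1)) :
    starFace w (old (tour w (i + 1))) = near (headAt hw he) := by
  obtain ⟨j, hj⟩ := exists_paired_a hw h
  apply starFace_old_eq_near
  rw [opp_eq (Or.inl (linked_tour hj)), headAt_val, treeOpp_eq (linked_tour hj)]

theorem starFace_abar (hw : IsPrefixShuffle w) {j : ℕ} (h : (plus w)[j]? = some .abar) :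
    starFace w (old (tour w (j + 1))) = old (tour w (j + 2)) := by
  obtain ⟨i, hi⟩ := exists_paired_abar hw h
  have hopp := opp_eq (Or.inl (linked_tour hi).symm)
  rw [starFace_old_tail, hopp, ccw_tour_of_paired hi]
  rw [hopp, isHead_tour hi.2.1]
  simp

theorem starFace_b {i j : ℕ} (h : IsPaired .b .bbar (plus w) i j) :
    starFace w (old (tour w (i + 1))) = old (tour w (j + 2)) := by
  have hopp := opp_eq (Or.inr (linked_tour h))
  rw [starFace_old_tail, hopp, ccw_tour h.2.2.1 (by simp) (by simp)]
  rw [hopp, isHead_tour h.2.2.1]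
  simp

theorem starFace_bbar (hw : IsPrefixShuffle w) {i j : ℕ} (h : IsPaired .b .bbar (plus w) i j)
    (he : IsLabel (plus w) (i + 1)) : starFace w (old (tour w (j + 1))) = near (headAt hw he) :=
  starFace_old_eq_near (by rw [opp_eq (Or.inr (linked_tour h).symm), headAt_of_b hw h.2.1])

theorem opp_of_isDangling {d : HalfEdge w} (h : IsDangling w d) : opp w d = d := by
  refine partner_of_not (R := fun d e => Linked w .a .abar d e ∨ Linked w .b .bbar d e) ?_
  rintro ⟨y, hy | hy⟩
  · rcases hy.letter with h' | h' <;> cases h.1.unique h'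
  · exact h.2 ⟨y, hy⟩

theorem starFace_dangling {d : HalfEdge w} (h : IsDangling w d) {h' : Head w} (e : h'.1 = d) :
    starFace w (old d) = near h' :=
  starFace_old_eq_near ((opp_of_isDangling h).trans e.symm)

theorem IsDangling.headAt_eq (hw : IsPrefixShuffle w) {k : ℕ} (h : IsDangling w (tour w k))
    (he : IsLabel (plus w) k) : (headAt hw he).1 = tour w k := by
  rcases he.cases with rfl | ⟨i, s, rfl, hs⟩
  · exact headAt_zero hw _
  · have hb : Letter.b = s.openLetter := (hasLetter_tour hs).1 h.1
    exact headAt_of_b hw (hb ▸ hs) _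

end PrefixMap

/-! ### The faces of `M★_w` -/

namespace PrefixMap

variable {w : List Letter}

theorem opening_right_treeOpp (hw : IsPrefixShuffle w) (d : HalfEdge w) :
    opening (plus w) .right ((treeOpp w d).val - 1) = opening (plus w) .right d.val := by
  have hu := isPrefixShuffle_plus hw
  rcases eq_root_or_eq_tour d with rfl | ⟨n, x, rfl, hx⟩
  · rw [treeOpp_root]
    rfl
  · have hn := (List.getElem?_eq_some_iff.1 hx).1
    rw [tour_val (by omega)]
    cases x
    · obtain ⟨j, hj⟩ := exists_paired_a hw hx
      rw [treeOpp_eq (linked_tour hj), tour_val (IsPaired.lt_length hj),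
        opening_open (s := .right) hx]
      exact (IsPaired.opening_eq (s := .right) hu hj).1
    · obtain ⟨i, hi⟩ := exists_paired_abar hw hx
      rw [treeOpp_eq (linked_tour hi).symm, tour_val (by have := hi.1; omega)]
      exact (IsPaired.opening_eq (s := .right) hu hi).2.symm
    · rw [treeOpp_tour hx (by simp) (by simp), tour_val (by omega)]
      exact (opening_touch (s := .right) hu hx).symm
    · rw [treeOpp_tour hx (by simp) (by simp), tour_val (by omega)]
      exact (opening_other (s := .right) hx).symm

theorem opening_right_length (hw : IsPrefixShuffle w) :
    opening (plus w) .right (plus w).length = 0 :=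
  eq_zero_of_isActiveAt_right_length hw (isActiveAt_opening (isPrefixShuffle_plus hw) _ _)

theorem tour_length_succ : tour w ((plus w).length + 1) = root w :=
  Fin.ext (Nat.mod_self _)

theorem opening_right_ccw (hw : IsPrefixShuffle w) (d : HalfEdge w) :
    opening (plus w) .right ((ccw w d).val - 1) = opening (plus w) .right (d.val - 1) := by
  obtain ⟨d, rfl⟩ := (treeOpp w).surjective d
  rw [opening_right_treeOpp hw]
  conv_lhs => rw [← tour_val_self d, ccw_treeOpp_tour]
  rcases Nat.lt_or_ge d.val (plus w).length with hlt | hge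
  · rw [tour_val (by omega)]
    rfl
  · have hlast : d.val = (plus w).length := by omega
    rw [hlast, tour_length_succ, opening_right_length hw]
    rfl

theorem opening_right_of_sameCycle (hw : IsPrefixShuffle w) {d e : HalfEdge w}
    (h : (ccw w).SameCycle d e) :
    opening (plus w) .right (d.val - 1) = opening (plus w) .right (e.val - 1) :=
  apply_eq_of_sameCycle (g := fun d : HalfEdge w => opening (plus w) .right (d.val - 1))
    (opening_right_ccw hw) h

theorem opening_right_head (hw : IsPrefixShuffle w) (h : Head w) :
    opening (plus w) .right (h.1.val - 1) = opening (plus w) .right (headLabel h) := by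
  rw [headLabel, ← opening_right_treeOpp hw, treeOpp_treeOpp]

theorem nextHead_val (h : Head w) : (nextHead w h).1 = returnPerm (ccw w) (IsHead w) h.1 := rfl

theorem opening_right_nextHead (hw : IsPrefixShuffle w) (h : Head w) :
    opening (plus w) .right (headLabel (nextHead w h)) =
      opening (plus w) .right (headLabel h) := by
  rw [← opening_right_head hw, ← opening_right_head hw, nextHead_val]
  exact (opening_right_of_sameCycle hw (sameCycle_returnPerm_apply _ _ _)).symm

open Classical in
/-- The label that opens the white face of `M★_w` in which the white vertex opened by `k` lies: `0`
for the active vertices, which are all in the root-face, and `k` itself for the other ones. -/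
noncomputable def whiteOwner (w : List Letter) (k : ℕ) : ℕ :=
  if IsActiveAt (plus w) .left (plus w).length k then 0 else k

theorem whiteOwner_of_isActiveAt {k : ℕ} (h : IsActiveAt (plus w) .left (plus w).length k) :
    whiteOwner w k = 0 := if_pos h

theorem whiteOwner_of_not {k : ℕ} (h : ¬ IsActiveAt (plus w) .left (plus w).length k) :
    whiteOwner w k = k := if_neg h

/-- The face that has a half-edge on its border, encoded as its colour (left for white, right for
black) and the label that opens it. -/
noncomputable def owner : StarHalfEdge w → Side × ℕ
  | Sum.inl d => (.left, whiteOwner w (opening (plus w) .left (d.val - 1)))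
  | Sum.inr (Sum.inl h) => (.left, whiteOwner w (opening (plus w) .left (headLabel h)))
  | Sum.inr (Sum.inr h) => (.right, opening (plus w) .right (headLabel h))

theorem owner_old (d : HalfEdge w) :
    owner (old d) = (.left, whiteOwner w (opening (plus w) .left (d.val - 1))) := rfl

theorem owner_near (h : Head w) :
    owner (near h) = (.left, whiteOwner w (opening (plus w) .left (headLabel h))) := rfl

theorem owner_far (h : Head w) :
    owner (far h) = (.right, opening (plus w) .right (headLabel h)) := rfl

theorem owner_old_succ (hw : IsPrefixShuffle w) {n : ℕ} (hn : n ≤ (plus w).length) :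
    owner (old (tour w (n + 1))) = (.left, whiteOwner w (opening (plus w) .left n)) := by
  have hu := isPrefixShuffle_plus hw
  rcases Nat.lt_or_ge n (plus w).length with hlt | hge
  · rw [owner_old, tour_val (by omega)]
    rfl
  · obtain rfl : n = (plus w).length := by omega
    rw [tour_length_succ, owner_old, whiteOwner_of_isActiveAt (isActiveAt_opening hu _ _),
      whiteOwner_of_isActiveAt]
    exact isActiveAt_zero hu _ _

theorem owner_starFace_tour (hw : IsPrefixShuffle w) {n : ℕ} {x : Letter}
    (hx : (plus w)[n]? = some x) :
    owner (starFace w (old (tour w (n + 1)))) = owner (old (tour w (n + 1))) := by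
  have hu := isPrefixShuffle_plus hw
  have hn := (List.getElem?_eq_some_iff.1 hx).1
  rw [owner_old_succ hw (by omega)]
  cases x
  · rw [starFace_a hw hx (isLabel_succ (s := .right) hx), owner_near, headLabel_headAt,
      opening_touch (s := .left) hu hx]
  · rw [starFace_abar hw hx, owner_old_succ hw (by omega), opening_other (s := .left) hx]
  · have hlabel : IsLabel (plus w) (n + 1) := isLabel_succ (s := .left) hx
    by_cases hactive : IsActiveAt (plus w) .left (plus w).length (n + 1)
    · have hdangling := (isDangling_tour hw hn).2 ⟨n.succ_ne_zero, hactive⟩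
      rw [starFace_dangling hdangling (hdangling.headAt_eq hw hlabel), owner_near,
        headLabel_headAt, opening_open (s := .left) hx, whiteOwner_of_isActiveAt hactive,
        whiteOwner_of_isActiveAt (hactive.opening_of_succ hu)]
    · obtain ⟨j, -, hj⟩ := not_not.1 (mt (isActiveAt_iff (s := .left) hu hx hn).2 hactive)
      rw [starFace_b hj, owner_old_succ hw (IsPaired.lt_length hj),
        (IsPaired.opening_eq (s := .left) hu hj).2]
  · obtain ⟨i, hi⟩ := exists_paired_bbar hw hx
    rw [starFace_bbar hw hi (isLabel_succ (s := .left) hi.2.1), owner_near, headLabel_headAt,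
      opening_open (s := .left) hi.2.1, (IsPaired.opening_eq (s := .left) hu hi).1]

theorem owner_starFace (hw : IsPrefixShuffle w) (x : StarHalfEdge w) :
    owner (starFace w x) = owner x := by
  rcases x with d | h | h
  · change owner (starFace w (old d)) = owner (old d)
    rcases eq_root_or_eq_tour d with rfl | ⟨n, x, rfl, hx⟩
    · rw [starFace_root hw, owner_near, headLabel_headAt]
      rfl
    · exact owner_starFace_tour hw hx
  · change owner (starFace w (near h)) = owner (near h)
    obtain ⟨e, he, rfl⟩ := exists_eq_headAt hw h
    rw [starFace_near_headAt, owner_old_succ hw he.le_length, owner_near, headLabel_headAt]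
  · change owner (starFace w (far h)) = owner (far h)
    rw [starFace_far, owner_far, owner_far, ← opening_right_nextHead hw, Equiv.apply_symm_apply]

theorem faceOf_eq_iff {x y : StarHalfEdge w} : faceOf x = faceOf y ↔ (starFace w).SameCycle x y :=
  Quotient.eq

theorem owner_eq_of_faceOf (hw : IsPrefixShuffle w) {x y : StarHalfEdge w}
    (h : faceOf x = faceOf y) : owner x = owner y :=
  apply_eq_of_sameCycle (owner_starFace hw) (faceOf_eq_iff.1 h)

theorem faceOf_starFace (x : StarHalfEdge w) : faceOf (starFace w x) = faceOf x :=
  faceOf_eq_iff.2 (Perm.SameCycle.symm ⟨1, by simp⟩)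

theorem owner_root (hw : IsPrefixShuffle w) : owner (old (root w)) = (.left, 0) := by
  rw [owner_old]
  exact congrArg (Prod.mk _)
    (whiteOwner_of_isActiveAt (isActiveAt_zero (isPrefixShuffle_plus hw) _ _))

theorem owner_of_rootFace (hw : IsPrefixShuffle w) {x : StarHalfEdge w}
    (h : faceOf x = rootFace w) : owner x = (.left, 0) :=
  (owner_eq_of_faceOf hw h).trans (owner_root hw)

theorem faceOf_far_ne_rootFace (hw : IsPrefixShuffle w) (h : Head w) :
    faceOf (far h) ≠ rootFace w := by
  intro heq
  have howner := owner_of_rootFace hw heq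
  rw [owner_far] at howner
  cases howner

/-! ### Moving along the borders of the white faces -/

/-- The half-edges of `M_w` that are neither the root nor a dangling head: the border of a face can
run through them without changing the vertex of `P_w` to which the next half-edge is attached. -/
def Silent (x : StarHalfEdge w) : Prop := ∃ d, x = old d ∧ d ≠ root w ∧ ¬ IsDangling w d

theorem silent_tour {n : ℕ} {x : Letter} (hx : (plus w)[n]? = some x) (hb : x ≠ .b) :
    Silent (old (tour w (n + 1))) :=
  ⟨_, rfl, tour_succ_ne_root (List.getElem?_eq_some_iff.1 hx).1,
    fun h => hb ((hasLetter_tour hx).1 h.1).symm⟩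

theorem silent_tour_of_paired {i j : ℕ} (h : IsPaired .b .bbar (plus w) i j) :
    Silent (old (tour w (i + 1))) :=
  ⟨_, rfl, tour_succ_ne_root (List.getElem?_eq_some_iff.1 h.2.1).1,
    fun hdangling => hdangling.2 ⟨_, linked_tour h⟩⟩

theorem via_near_latest_tour (hw : IsPrefixShuffle w) {n : ℕ} (hn : n ≤ (plus w).length)
    (he : IsLabel (plus w) (latest (plus w) .left n)) :
    Via (starFace w) Silent (near (headAt hw he)) (old (tour w (n + 1))) := by
  refine latest_induction (isPrefixShuffle_plus hw) .left
    (fun e n => ∀ he : IsLabel (plus w) e,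
      Via (starFace w) Silent (near (headAt hw he)) (old (tour w n))) ?_ ?_ ?_ hn he
  · exact fun e _ he => Via.single (starFace_near_headAt hw he)
  · exact fun e n _ h hv he => (hv he).tail (silent_tour h (by simp [Side.other, Side.closeLetter]))
      (starFace_abar hw h)
  · exact fun e i j _ h hv he => (hv he).tail (silent_tour_of_paired h) (starFace_b h)

theorem via_headAt_latest_tour (hw : IsPrefixShuffle w) {n : ℕ} (hn : n ≤ (plus w).length)
    (he : IsLabel (plus w) (latest (plus w) .right n)) :
    Via (ccw w) (fun d => ¬ IsHead w d) (headAt hw he).1 (tour w (n + 1)) := by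
  refine latest_induction (isPrefixShuffle_plus hw) .right
    (fun e n => ∀ he : IsLabel (plus w) e,
      Via (ccw w) (fun d => ¬ IsHead w d) (headAt hw he).1 (tour w n)) ?_ ?_ ?_ hn he
  · exact fun e _ he => Via.single (ccw_headAt hw he)
  · refine fun e n _ h hv he => (hv he).tail ?_ (ccw_tour h ?_ ?_)
    · rw [isHead_tour h]
      simp [Side.other, Side.closeLetter]
    all_goals simp [Side.other, Side.closeLetter]
  · refine fun e i j _ h hv he => (hv he).tail ?_ (ccw_tour_of_paired h)
    rw [isHead_tour h.2.1]
    simp [Side.openLetter]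

theorem via_near (hw : IsPrefixShuffle w) {n : ℕ} (h : (plus w)[n]? = some .a)
    (he : IsLabel (plus w) (latest (plus w) .left n)) (he' : IsLabel (plus w) (n + 1)) :
    Via (starFace w) Silent (near (headAt hw he)) (near (headAt hw he')) :=
  (via_near_latest_tour hw (List.getElem?_eq_some_iff.1 h).1.le he).tail (silent_tour h (by simp))
    (starFace_a hw h he')

theorem nextHead_headAt (hw : IsPrefixShuffle w) {n : ℕ} (h : (plus w)[n]? = some .b)
    (he : IsLabel (plus w) (latest (plus w) .right n)) (he' : IsLabel (plus w) (n + 1)) :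
    nextHead w (headAt hw he) = headAt hw he' := by
  have hvia := via_headAt_latest_tour hw (List.getElem?_eq_some_iff.1 h).1.le he
  rw [← headAt_of_b hw h he'] at hvia
  refine Subtype.ext (hvia.returnPerm_eq ?_ ?_)
  · exact fun z hz heq => hz (heq ▸ (headAt hw he).2)
  · exact propext (iff_of_true (headAt hw he').2 (headAt hw he).2)

theorem starFace_far_headAt (hw : IsPrefixShuffle w) {n : ℕ} (h : (plus w)[n]? = some .b)
    (he : IsLabel (plus w) (latest (plus w) .right n)) (he' : IsLabel (plus w) (n + 1)) :
    starFace w (far (headAt hw he')) = far (headAt hw he) := by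
  rw [starFace_far, ← nextHead_headAt hw h he he', Equiv.symm_apply_apply]

/-- A step around a face of `M★_w` that does not arrive at the root and does not leave a dangling
head: it preserves the face and increases the rank, and its two ends are attached to the same
vertex of `P_w`. -/
def Step (x y : StarHalfEdge w) : Prop :=
  starFace w x = y ∧ y ≠ old (root w) ∧ ∀ d, x = old d → ¬ IsDangling w d

theorem Via.transGen {x y : StarHalfEdge w} (h : Via (starFace w) Silent x y)
    (hx : ∀ d, x = old d → ¬ IsDangling w d) (hy : y ≠ old (root w)) :
    Relation.TransGen Step x y := by
  induction h with
  | single h => exact .single ⟨h, hy, hx⟩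
  | tail _ hS hyz ih =>
    obtain ⟨d, rfl, hroot, hdangling⟩ := hS
    refine (ih fun heq => hroot (Sum.inl_injective heq)).tail ⟨hyz, hy, fun d' heq => ?_⟩
    rwa [← Sum.inl_injective heq]

theorem near_ne_old (h : Head w) (d : HalfEdge w) : near h ≠ old d := by simp [near, old]

theorem not_isDangling_of_near_eq_old {h : Head w} (d : HalfEdge w) (heq : near h = old d) :
    ¬ IsDangling w d :=
  absurd heq (near_ne_old _ _)

theorem reflTransGen_near (hw : IsPrefixShuffle w) {e : ℕ} (he : IsLabel (plus w) e)
    (hk : IsLabel (plus w) (opening (plus w) .left e)) :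
    Relation.ReflTransGen Step (near (headAt hw hk)) (near (headAt hw he)) := by
  have hu := isPrefixShuffle_plus hw
  refine label_induction hu .left (fun e => ∀ (he : IsLabel (plus w) e)
    (hk : IsLabel (plus w) (opening (plus w) .left e)),
    Relation.ReflTransGen Step (near (headAt hw hk)) (near (headAt hw he))) ?_ ?_ he he hk
  · intro e _ h he hk
    rw [headAt_congr hw (he := hk) (he' := he) h]
  · intro n hn ih he hk
    have hlatest := isLabel_latest hu .left n
    have hk' := isLabel_opening hu .left (latest (plus w) .left n)
    have heq : headAt hw hk = headAt hw hk' :=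
      headAt_congr hw (by rw [opening_latest hu, opening_touch (s := .left) hu hn])
    rw [heq]
    exact (ih hlatest hk').trans (Via.transGen (via_near hw hn hlatest he)
      not_isDangling_of_near_eq_old (near_ne_old _ _)).to_reflTransGen

theorem transGen_old (hw : IsPrefixShuffle w) {n : ℕ} (hn : n < (plus w).length)
    (hk : IsLabel (plus w) (opening (plus w) .left n)) :
    Relation.TransGen Step (near (headAt hw hk)) (old (tour w (n + 1))) := by
  have hu := isPrefixShuffle_plus hw
  have hlatest := isLabel_latest hu .left n
  have hnear := reflTransGen_near hw hlatest (isLabel_opening hu _ _)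
  rw [headAt_congr hw (he' := hk) (opening_latest hu .left n)] at hnear
  exact Relation.TransGen.trans_right hnear (Via.transGen (via_near_latest_tour hw hn.le hlatest)
    not_isDangling_of_near_eq_old fun heq => tour_succ_ne_root hn (Sum.inl_injective heq))

theorem Step.faceOf_eq {x y : StarHalfEdge w} (h : Step x y) : faceOf y = faceOf x := by
  rw [← h.1, faceOf_starFace]

theorem faceOf_eq_of_reflTransGen {x y : StarHalfEdge w} (h : Relation.ReflTransGen Step x y) :
    faceOf y = faceOf x := by
  induction h with
  | refl => rfl
  | tail _ h ih => rw [h.faceOf_eq, ih]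

/-! ### The root-face -/

theorem starFace_pow_rank {x : StarHalfEdge w} (h : faceOf x = rootFace w) :
    (starFace w ^ rank x) (old (root w)) = x := by
  obtain ⟨n, -, hn⟩ := (faceOf_eq_iff.1 h).symm.exists_pow_eq'
  exact Nat.sInf_mem (s := {n | ((starFace w) ^ n) (old (root w)) = x}) ⟨n, hn⟩

theorem rank_le {x : StarHalfEdge w} {n : ℕ} (h : (starFace w ^ n) (old (root w)) = x) :
    rank x ≤ n :=
  Nat.sInf_le h

theorem rank_root : rank (old (root w)) = 0 := Nat.le_zero.1 (rank_le rfl)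

theorem rank_starFace {x : StarHalfEdge w} (h : faceOf x = rootFace w)
    (hne : starFace w x ≠ old (root w)) : rank (starFace w x) = rank x + 1 := by
  apply le_antisymm
  · apply rank_le
    rw [pow_succ', Perm.mul_apply, starFace_pow_rank h]
  · have hpow := starFace_pow_rank (x := starFace w x) (by rw [faceOf_starFace, h])
    rcases hr : rank (starFace w x) with _ | m
    · rw [hr] at hpow
      exact absurd hpow.symm hne
    · rw [hr, pow_succ', Perm.mul_apply] at hpow
      exact Nat.succ_le_succ (rank_le ((starFace w).injective hpow))

theorem rank_inj {x y : StarHalfEdge w} (hx : faceOf x = rootFace w) (hy : faceOf y = rootFace w)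
    (h : rank x = rank y) : x = y := by
  rw [← starFace_pow_rank hx, h, starFace_pow_rank hy]

theorem Step.rank_eq {x y : StarHalfEdge w} (h : Step x y) (hx : faceOf x = rootFace w) :
    rank y = rank x + 1 := by
  obtain ⟨rfl, hroot, -⟩ := h
  exact rank_starFace hx hroot

theorem rank_le_of_reflTransGen {x y : StarHalfEdge w} (h : Relation.ReflTransGen Step x y)
    (hx : faceOf x = rootFace w) : rank x ≤ rank y := by
  induction h with
  | refl => rfl
  | tail hxy hyz ih =>
    rw [hyz.rank_eq ((faceOf_eq_of_reflTransGen hxy).trans hx)]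
    omega

theorem rank_lt_of_transGen {x y : StarHalfEdge w} (h : Relation.TransGen Step x y)
    (hx : faceOf x = rootFace w) : rank x < rank y := by
  obtain ⟨z, hxz, hzy⟩ := Relation.TransGen.head'_iff.1 h
  have hle := rank_le_of_reflTransGen hzy (hxz.faceOf_eq.trans hx)
  rw [hxz.rank_eq hx] at hle
  omega

theorem starFace_old_of_isActiveAt (hw : IsPrefixShuffle w) {k : ℕ} (hk : IsLabel (plus w) k)
    (h : IsActiveAt (plus w) .left (plus w).length k) :
    starFace w (old (tour w k)) = near (headAt hw hk) := by
  rcases Nat.eq_zero_or_pos k with rfl | hpos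
  · rw [tour_zero, starFace_root hw]
  · have hdangling := (isDangling_tour hw hk.le_length).2 ⟨hpos.ne', h⟩
    exact starFace_dangling hdangling (hdangling.headAt_eq hw hk)

theorem faceOf_near_of_isActiveAt (hw : IsPrefixShuffle w) {k : ℕ} (hk : IsLabel (plus w) k)
    (h : IsActiveAt (plus w) .left (plus w).length k) :
    faceOf (near (headAt hw hk)) = faceOf (old (tour w k)) := by
  rw [← starFace_old_of_isActiveAt hw hk h, faceOf_starFace]

theorem faceOf_old_of_isActiveAt (hw : IsPrefixShuffle w) {k : ℕ} (hk : IsLabel (plus w) k)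
    (h : IsActiveAt (plus w) .left (plus w).length k) : faceOf (old (tour w k)) = rootFace w := by
  have hu := isPrefixShuffle_plus hw
  induction k using Nat.strong_induction_on with
  | _ k ih =>
    rcases k with _ | i
    · rfl
    · have hlabel := isLabel_opening hu .left i
      have hactive := h.opening_of_succ hu
      rw [faceOf_eq_of_reflTransGen (transGen_old hw hk.le_length hlabel).to_reflTransGen,
        faceOf_near_of_isActiveAt hw hlabel hactive]
      exact ih _ (Nat.lt_succ_of_le (opening_le hu .left i)) hlabel hactive

theorem rank_near_of_isActiveAt (hw : IsPrefixShuffle w) {k : ℕ} (hk : IsLabel (plus w) k)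
    (h : IsActiveAt (plus w) .left (plus w).length k) :
    rank (near (headAt hw hk)) = rank (old (tour w k)) + 1 := by
  rw [← starFace_old_of_isActiveAt hw hk h]
  apply rank_starFace (faceOf_old_of_isActiveAt hw hk h)
  rw [starFace_old_of_isActiveAt hw hk h]
  exact near_ne_old _ _

theorem rank_lt_rank (hw : IsPrefixShuffle w) {k k' : ℕ} (hk : IsLabel (plus w) k)
    (hk' : IsLabel (plus w) k') (h : IsActiveAt (plus w) .left (plus w).length k)
    (h' : IsActiveAt (plus w) .left (plus w).length k') (hlt : k < k') :
    rank (old (tour w k)) < rank (old (tour w k')) := by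
  have hu := isPrefixShuffle_plus hw
  induction k' using Nat.strong_induction_on with
  | _ k' ih =>
    rcases k' with _ | i
    · omega
    · have hlabel := isLabel_opening hu .left i
      have hactive := h'.opening_of_succ hu
      have hrank := rank_lt_of_transGen (transGen_old hw hk'.le_length hlabel)
        ((faceOf_near_of_isActiveAt hw hlabel hactive).trans
          (faceOf_old_of_isActiveAt hw hlabel hactive))
      rw [rank_near_of_isActiveAt hw hlabel hactive] at hrank
      have hi : i ≤ (plus w).length := Nat.le_of_succ_le hk'.le_length
      have hle := (h.anti hu (Nat.le_of_lt_succ hlt) hi).le_opening hu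
      rcases hle.eq_or_lt with rfl | hlt'
      · omega
      · exact (ih _ (Nat.lt_succ_of_le (opening_le hu .left i)) hlabel hactive hlt').trans
          (Nat.lt_of_succ_lt hrank)

end PrefixMap

/-! ### The vertices of `P_w` -/

namespace PrefixMap

variable {w : List Letter}

theorem pvert_of_ne_rootFace {x : StarHalfEdge w} (h : faceOf x ≠ rootFace w) :
    pvert x = Sum.inl (faceOf x) := if_neg h

theorem old_injective : Function.Injective (old (w := w)) := Sum.inl_injective

theorem IsLastDanglingBefore.unique {x : StarHalfEdge w} {h h' : Dangling w}
    (hlast : IsLastDanglingBefore h x) (hlast' : IsLastDanglingBefore h' x) : h = h' :=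
  Subtype.ext (old_injective (rank_inj hlast.1.1 hlast'.1.1
    (le_antisymm (hlast'.2 h hlast.1.1 hlast.1.2) (hlast.2 h' hlast'.1.1 hlast'.1.2))))

theorem pvert_of_isLastDanglingBefore {x : StarHalfEdge w} {h : Dangling w}
    (hx : faceOf x = rootFace w) (hlast : IsLastDanglingBefore h x) : pvert x = Sum.inr h := by
  have hex : ∃ h : Dangling w, IsLastDanglingBefore h x := ⟨h, hlast⟩
  unfold pvert
  rw [if_pos hx, dif_pos hex, hex.choose_spec.unique hlast]

theorem pvert_of_not_exists {x : StarHalfEdge w} (hx : faceOf x = rootFace w)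
    (hnot : ¬ ∃ h : Dangling w, IsLastDanglingBefore h x) : pvert x = exterior w := by
  unfold pvert
  rw [if_pos hx, dif_neg hnot]

theorem pvert_root : pvert (old (root w)) = exterior w := by
  refine pvert_of_not_exists rfl ?_
  rintro ⟨h, ⟨-, hlt⟩, -⟩
  rw [rank_root] at hlt
  omega

theorem Step.rank_dangling_lt_iff {x y : StarHalfEdge w} (h : Step x y)
    (hx : faceOf x = rootFace w) (d : Dangling w) (hd : faceOf (old d.1) = rootFace w) :
    rank (old d.1) < rank y ↔ rank (old d.1) < rank x := by
  have hne : rank (old d.1) ≠ rank x := fun heq => h.2.2 _ (rank_inj hd hx heq).symm d.2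
  rw [h.rank_eq hx]
  omega

theorem Step.isLastDanglingBefore_iff {x y : StarHalfEdge w} (h : Step x y)
    (hx : faceOf x = rootFace w) (d : Dangling w) :
    IsLastDanglingBefore d y ↔ IsLastDanglingBefore d x := by
  unfold IsLastDanglingBefore
  refine and_congr (and_congr_right (h.rank_dangling_lt_iff hx d))
    (forall_congr' fun d' => forall_congr' fun hd' => ?_)
  rw [h.rank_dangling_lt_iff hx d' hd']

theorem Step.pvert_eq {x y : StarHalfEdge w} (h : Step x y) : pvert y = pvert x := by
  by_cases hx : faceOf x = rootFace w
  · have hy : faceOf y = rootFace w := h.faceOf_eq.trans hx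
    by_cases hex : ∃ d : Dangling w, IsLastDanglingBefore d x
    · obtain ⟨d, hlast⟩ := hex
      rw [pvert_of_isLastDanglingBefore hx hlast,
        pvert_of_isLastDanglingBefore hy ((h.isLastDanglingBefore_iff hx d).2 hlast)]
    · rw [pvert_of_not_exists hx hex, pvert_of_not_exists hy]
      simpa only [h.isLastDanglingBefore_iff hx] using hex
  · rw [pvert_of_ne_rootFace hx, pvert_of_ne_rootFace (by rwa [h.faceOf_eq]), h.faceOf_eq]

theorem pvert_eq_of_reflTransGen {x y : StarHalfEdge w} (h : Relation.ReflTransGen Step x y) :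
    pvert y = pvert x := by
  induction h with
  | refl => rfl
  | tail _ h ih => rw [h.pvert_eq, ih]

theorem step_root (hw : IsPrefixShuffle w) :
    Step (old (root w)) (near (headAt hw (isLabel_zero _))) := by
  refine ⟨starFace_root hw, near_ne_old _ _, fun d e hd => ?_⟩
  rw [← old_injective e] at hd
  exact ((isDangling_tour hw (k := 0) (by omega)).1 hd).1 rfl

theorem pvert_near_zero (hw : IsPrefixShuffle w) :
    pvert (near (headAt hw (isLabel_zero _))) = exterior w := by
  rw [(step_root hw).pvert_eq, pvert_root]

theorem pvert_near_of_isDangling (hw : IsPrefixShuffle w) {k : ℕ} (hk : IsLabel (plus w) k)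
    (hd : IsDangling w (tour w k)) :
    pvert (near (headAt hw hk)) = Sum.inr ⟨tour w k, hd⟩ := by
  have hactive := ((isDangling_tour hw hk.le_length).1 hd).2
  have hface := faceOf_old_of_isActiveAt hw hk hactive
  have hrank := rank_near_of_isActiveAt hw hk hactive
  refine pvert_of_isLastDanglingBefore ((faceOf_near_of_isActiveAt hw hk hactive).trans hface)
    ⟨⟨hface, ?_⟩, fun h' _ hlt => ?_⟩
  · rw [hrank]
    exact Nat.lt_succ_self _
  · rw [hrank] at hlt
    exact Nat.le_of_lt_succ hlt

theorem faceOf_near_ne_rootFace (hw : IsPrefixShuffle w) {k : ℕ} (hk : IsLabel (plus w) k)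
    (hopening : opening (plus w) .left k = k)
    (hactive : ¬ IsActiveAt (plus w) .left (plus w).length k) :
    faceOf (near (headAt hw hk)) ≠ rootFace w := by
  intro heq
  have howner := owner_of_rootFace hw heq
  rw [owner_near, headLabel_headAt, hopening, whiteOwner_of_not hactive] at howner
  obtain rfl : k = 0 := (Prod.mk.inj howner).2
  exact hactive (isActiveAt_zero (isPrefixShuffle_plus hw) _ _)

theorem pvert_far (hw : IsPrefixShuffle w) (h : Head w) :
    pvert (far h) = Sum.inl (faceOf (far h)) :=
  pvert_of_ne_rootFace (faceOf_far_ne_rootFace hw h)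

theorem pvert_near_opening (hw : IsPrefixShuffle w) {e : ℕ} (he : IsLabel (plus w) e)
    (hk : IsLabel (plus w) (opening (plus w) .left e)) :
    pvert (near (headAt hw he)) = pvert (near (headAt hw hk)) :=
  pvert_eq_of_reflTransGen (reflTransGen_near hw he hk)

theorem faceOf_far_opening (hw : IsPrefixShuffle w) {e : ℕ} (he : IsLabel (plus w) e)
    (hk : IsLabel (plus w) (opening (plus w) .right e)) :
    faceOf (far (headAt hw he)) = faceOf (far (headAt hw hk)) := by
  have hu := isPrefixShuffle_plus hw
  refine label_induction hu .right (fun e => ∀ (he : IsLabel (plus w) e)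
    (hk : IsLabel (plus w) (opening (plus w) .right e)),
    faceOf (far (headAt hw he)) = faceOf (far (headAt hw hk))) ?_ ?_ he he hk
  · intro e _ h he hk
    rw [headAt_congr hw (he := hk) (he' := he) h]
  · intro n hn ih he hk
    have hlatest := isLabel_latest hu .right n
    have hk' := isLabel_opening hu .right (latest (plus w) .right n)
    rw [headAt_congr hw (he := hk) (he' := hk')
      (by rw [opening_latest hu, opening_touch (s := .right) hu hn]), ← ih hlatest hk',
      ← faceOf_starFace, starFace_far_headAt hw hn hlatest he]

/-- The half-edge of `P_w` whose dual is a half of the permeable edge of the head `h`: `near h` on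
the left, that is, white side, and `far h` on the right, that is, black side. -/
noncomputable def pHalf : Side → Head w → (partitionTree w).D
  | .left, h => ⟨near h, Or.inr (Or.inl ⟨h, rfl⟩)⟩
  | .right, h => ⟨far h, Or.inr (Or.inr ⟨h, rfl⟩)⟩

theorem partitionTree_eq_root_or_eq_pHalf (x : (partitionTree w).D) :
    x = (partitionTree w).root ∨ ∃ s h, x = pHalf s h := by
  obtain ⟨x, rfl | ⟨h, rfl⟩ | ⟨h, rfl⟩⟩ := x
  · exact Or.inl rfl
  · exact Or.inr ⟨.left, h, rfl⟩
  · exact Or.inr ⟨.right, h, rfl⟩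

theorem partitionTree_vert_root (hw : IsPrefixShuffle w) :
    (partitionTree w).vert (partitionTree w).root =
      (partitionTree w).vert (pHalf .left (headAt hw (isLabel_zero _))) :=
  (step_root hw).pvert_eq.symm

theorem partitionTree_vert_pHalf_opening (hw : IsPrefixShuffle w) (s : Side) {e : ℕ}
    (he : IsLabel (plus w) e) (hk : IsLabel (plus w) (opening (plus w) s e)) :
    (partitionTree w).vert (pHalf s (headAt hw he)) =
      (partitionTree w).vert (pHalf s (headAt hw hk)) := by
  cases s
  · exact pvert_near_opening hw he hk
  · exact (pvert_far hw _).trans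
      ((congrArg Sum.inl (faceOf_far_opening hw he hk)).trans (pvert_far hw _).symm)

/-- A vertex of `P_w`, encoded as its colour (left for white, right for black) and the label that
opens it. -/
noncomputable def vertexCode (hw : IsPrefixShuffle w) : PVertex w → Side × ℕ
  | Sum.inl f => Quotient.lift owner (fun _ _ h => apply_eq_of_sameCycle (owner_starFace hw) h) f
  | Sum.inr h => (.left, h.1.val)

/-- The code of the vertex of `P_w` at a half-edge of `P_w`, see `vertexCode`. -/
noncomputable def code (x : (partitionTree w).D) : Side × ℕ :=
  match x.1 with
  | Sum.inl _ => (.left, 0)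
  | Sum.inr (Sum.inl h) => (.left, opening (plus w) .left (headLabel h))
  | Sum.inr (Sum.inr h) => (.right, opening (plus w) .right (headLabel h))

theorem code_root : code (partitionTree w).root = (.left, 0) := rfl

theorem code_pHalf (s : Side) (h : Head w) :
    code (pHalf s h) = (s, opening (plus w) s (headLabel h)) := by
  cases s <;> rfl

theorem code_pHalf_headAt (hw : IsPrefixShuffle w) (s : Side) {e : ℕ} (he : IsLabel (plus w) e) :
    code (pHalf s (headAt hw he)) = (s, opening (plus w) s e) := by
  rw [code_pHalf, headLabel_headAt]

theorem vertexCode_face (hw : IsPrefixShuffle w) (x : StarHalfEdge w) :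
    vertexCode hw (Sum.inl (faceOf x)) = owner x := rfl

theorem vertexCode_pvert_near_of_opening_eq (hw : IsPrefixShuffle w) {k : ℕ}
    (hk : IsLabel (plus w) k) (hopening : opening (plus w) .left k = k) :
    vertexCode hw (pvert (near (headAt hw hk))) = (.left, k) := by
  by_cases hactive : IsActiveAt (plus w) .left (plus w).length k
  · rcases eq_or_ne k 0 with rfl | h0
    · rw [pvert_near_zero hw]
      exact owner_root hw
    · rw [pvert_near_of_isDangling hw hk ((isDangling_tour hw hk.le_length).2 ⟨h0, hactive⟩)]
      exact congrArg (Prod.mk _) (tour_val hk.le_length)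
  · rw [pvert_of_ne_rootFace (faceOf_near_ne_rootFace hw hk hopening hactive), vertexCode_face,
      owner_near, headLabel_headAt, hopening, whiteOwner_of_not hactive]

theorem vertexCode_vert_pHalf_of_opening_eq (hw : IsPrefixShuffle w) (s : Side) {k : ℕ}
    (hk : IsLabel (plus w) k) (hopening : opening (plus w) s k = k) :
    vertexCode hw ((partitionTree w).vert (pHalf s (headAt hw hk))) = (s, k) := by
  cases s
  · exact vertexCode_pvert_near_of_opening_eq hw hk hopening
  · change vertexCode hw (pvert (far (headAt hw hk))) = (.right, k)
    rw [pvert_far hw, vertexCode_face, owner_far, headLabel_headAt, hopening]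

theorem vertexCode_vert (hw : IsPrefixShuffle w) (x : (partitionTree w).D) :
    vertexCode hw ((partitionTree w).vert x) = code x := by
  have hu := isPrefixShuffle_plus hw
  rcases partitionTree_eq_root_or_eq_pHalf x with rfl | ⟨s, h, rfl⟩
  · rw [partitionTree_vert_root hw, code_root]
    exact vertexCode_vert_pHalf_of_opening_eq hw .left _ rfl
  · obtain ⟨e, he, rfl⟩ := exists_eq_headAt hw h
    rw [partitionTree_vert_pHalf_opening hw s he (isLabel_opening hu s e), code_pHalf_headAt,
      vertexCode_vert_pHalf_of_opening_eq hw s _ (opening_opening hu s e)]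

theorem vert_eq_vert_of_code_eq (hw : IsPrefixShuffle w) {x : (partitionTree w).D} {s : Side}
    {k : ℕ} (h : code x = (s, k)) : ∃ hk : IsLabel (plus w) k,
      (partitionTree w).vert x = (partitionTree w).vert (pHalf s (headAt hw hk)) := by
  rcases partitionTree_eq_root_or_eq_pHalf x with rfl | ⟨t, d, rfl⟩
  · cases h
    exact ⟨isLabel_zero _, partitionTree_vert_root hw⟩
  · obtain ⟨e, he, rfl⟩ := exists_eq_headAt hw d
    rw [code_pHalf_headAt] at h
    cases h
    exact ⟨isLabel_opening (isPrefixShuffle_plus hw) s e,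
      partitionTree_vert_pHalf_opening hw s he _⟩

theorem vert_eq_iff_code_eq (hw : IsPrefixShuffle w) (x y : (partitionTree w).D) :
    (partitionTree w).vert x = (partitionTree w).vert y ↔ code x = code y := by
  refine ⟨fun h => by rw [← vertexCode_vert hw x, ← vertexCode_vert hw y, h], fun h => ?_⟩
  obtain ⟨_, hx⟩ := vert_eq_vert_of_code_eq hw (s := (code x).1) (k := (code x).2) rfl
  obtain ⟨_, hy⟩ := vert_eq_vert_of_code_eq hw h.symm
  exact hx.trans hy.symm

theorem exists_faceOf_eq (hw : IsPrefixShuffle w) (x : StarHalfEdge w) :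
    ∃ y : (partitionTree w).D, faceOf y.1 = faceOf x := by
  rcases x with d | h | h
  · rcases eq_root_or_eq_tour d with rfl | ⟨n, x, rfl, hx⟩
    · exact ⟨(partitionTree w).root, rfl⟩
    · have hn := (List.getElem?_eq_some_iff.1 hx).1
      have hk := isLabel_opening (isPrefixShuffle_plus hw) .left n
      exact ⟨pHalf .left (headAt hw hk),
        (faceOf_eq_of_reflTransGen (transGen_old hw hn hk).to_reflTransGen).symm⟩
  · exact ⟨pHalf .left h, rfl⟩
  · exact ⟨pHalf .right h, rfl⟩

theorem partitionTree_vert_surjective (hw : IsPrefixShuffle w) :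
    Function.Surjective (partitionTree w).vert := by
  rintro (f | ⟨d, hd⟩)
  · obtain ⟨x, rfl⟩ : ∃ x, faceOf x = f := Quotient.exists_rep f
    obtain ⟨y, heq⟩ := exists_faceOf_eq hw x
    rw [← heq]
    by_cases hroot : faceOf y.1 = rootFace w
    · exact ⟨(partitionTree w).root, by rw [hroot]; exact pvert_root⟩
    · exact ⟨y, pvert_of_ne_rootFace hroot⟩
  · obtain ⟨i, hi, hb⟩ := hd.1
    have hk : IsLabel (plus w) d.val := by
      rw [hi]
      exact isLabel_succ (s := .left) hb
    have hd' : IsDangling w (tour w d.val) := by rwa [tour_val_self]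
    exact ⟨pHalf .left (headAt hw hk), (pvert_near_of_isDangling hw hk hd').trans
      (congrArg Sum.inr (Subtype.ext (tour_val_self d)))⟩

/-! ### The rotations of `P_w` -/

theorem plabel_eq_iff {x y : StarHalfEdge w} (hx : IsPHalfEdge x) (hy : IsPHalfEdge y) :
    plabel x = plabel y ↔ pvert x = pvert y := by
  simp [plabel, hx, hy]

theorem eq_rootFace_of_pvert_eq_inl {x : StarHalfEdge w} (hx : faceOf x = rootFace w) {f : Face w}
    (h : pvert x = Sum.inl f) : f = rootFace w := by
  by_cases hex : ∃ d : Dangling w, IsLastDanglingBefore d x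
  · obtain ⟨d, hlast⟩ := hex
    rw [pvert_of_isLastDanglingBefore hx hlast] at h
    cases h
  · rw [pvert_of_not_exists hx hex] at h
    exact (Sum.inl_injective h).symm

theorem faceOf_eq_of_pvert {x y : StarHalfEdge w} (h : pvert x = pvert y) :
    faceOf x = faceOf y := by
  by_cases hx : faceOf x = rootFace w <;> by_cases hy : faceOf y = rootFace w
  · rw [hx, hy]
  · exact absurd (eq_rootFace_of_pvert_eq_inl hx (h.trans (pvert_of_ne_rootFace hy))) hy
  · exact absurd (eq_rootFace_of_pvert_eq_inl hy (h.symm.trans (pvert_of_ne_rootFace hx))) hx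
  · rw [pvert_of_ne_rootFace hx, pvert_of_ne_rootFace hy] at h
    exact Sum.inl_injective h

theorem partitionTree_vert_cw (x : (partitionTree w).D) :
    (partitionTree w).vert ((partitionTree w).cw x) = (partitionTree w).vert x :=
  (plabel_eq_iff ((partitionTree w).cw x).2 x.2).1 (returnPerm_label (starFace w) plabel x.1)

theorem vert_eq_iff_sameCycle (x y : (partitionTree w).D) :
    (partitionTree w).vert x = (partitionTree w).vert y ↔ (partitionTree w).cw.SameCycle x y := by
  refine ⟨fun h => ?_, apply_eq_of_sameCycle partitionTree_vert_cw⟩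
  exact Perm.SameCycle.subtypePerm (h := isPHalfEdge_return) (sameCycle_returnPerm
    (faceOf_eq_iff.1 (faceOf_eq_of_pvert h)) ((plabel_eq_iff x.2 y.2).2 h))

theorem plabel_old {d : HalfEdge w} (h : d ≠ root w) : plabel (old d) = none := by
  refine if_neg ?_
  rintro (h' | ⟨_, h'⟩ | ⟨_, h'⟩)
  · exact h (old_injective h')
  · cases h'
  · cases h'

theorem partitionTree_cw_eq {x y : (partitionTree w).D} (h : Via (starFace w) Silent x.1 y.1)
    (hv : (partitionTree w).vert x = (partitionTree w).vert y) : (partitionTree w).cw x = y := by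
  refine Subtype.ext (h.returnPerm_eq ?_ ((plabel_eq_iff y.2 x.2).2 hv.symm))
  rintro z ⟨d, rfl, hd, -⟩ heq
  have hsome := (plabel_isSome x.1).2 x.2
  rw [← heq, plabel_old hd] at hsome
  cases hsome

theorem partitionTree_cw_root (hw : IsPrefixShuffle w) :
    (partitionTree w).cw (partitionTree w).root = pHalf .left (headAt hw (isLabel_zero _)) :=
  partitionTree_cw_eq (Via.single (starFace_root hw)) (partitionTree_vert_root hw)

theorem partitionTree_cw_pHalf_left (hw : IsPrefixShuffle w) {n : ℕ}
    (h : (plus w)[n]? = some .a) (he : IsLabel (plus w) (latest (plus w) .left n))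
    (he' : IsLabel (plus w) (n + 1)) :
    (partitionTree w).cw (pHalf .left (headAt hw he)) = pHalf .left (headAt hw he') := by
  have hu := isPrefixShuffle_plus hw
  refine partitionTree_cw_eq (via_near hw h he he') ((vert_eq_iff_code_eq hw _ _).2 ?_)
  rw [code_pHalf_headAt, code_pHalf_headAt, opening_latest hu, opening_touch (s := .left) hu h]

theorem partitionTree_cw_pHalf_right (hw : IsPrefixShuffle w) {n : ℕ}
    (h : (plus w)[n]? = some .b) (he : IsLabel (plus w) (latest (plus w) .right n))
    (he' : IsLabel (plus w) (n + 1)) :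
    (partitionTree w).cw (pHalf .right (headAt hw he')) = pHalf .right (headAt hw he) := by
  have hu := isPrefixShuffle_plus hw
  refine partitionTree_cw_eq (Via.single (starFace_far_headAt hw h he he'))
    ((vert_eq_iff_code_eq hw _ _).2 ?_)
  rw [code_pHalf_headAt, code_pHalf_headAt, opening_latest hu, opening_touch (s := .right) hu h]

theorem partitionTree_opp_root :
    (partitionTree w).opp (partitionTree w).root = (partitionTree w).root :=
  Subtype.ext (congrArg Sum.inl (opp_root w))

theorem partitionTree_opp_pHalf (s : Side) (h : Head w) :
    (partitionTree w).opp (pHalf s h) = pHalf s.other h := by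
  cases s <;> rfl

end PrefixMap

/-! ### The isomorphism -/

namespace RootedMap

variable {M N : RootedMap}

/-- An isomorphism of rooted maps is determined by its action on half-edges: here the vertices are
recovered from the half-edges that are incident to them. -/
noncomputable def Iso.ofHalfEdges (f : M.D ≃ N.D) (hM : Function.Surjective M.vert)
    (hN : Function.Surjective N.vert)
    (hv : ∀ d e, M.vert d = M.vert e ↔ N.vert (f d) = N.vert (f e))
    (hcw : ∀ d, N.cw (f d) = f (M.cw d)) (hopp : ∀ d, N.opp (f d) = f (M.opp d))
    (hroot : f M.root = N.root) : Iso M N where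
  onV := Equiv.ofBijective (fun v => N.vert (f (Function.surjInv hM v)))
    ⟨fun v v' h => by
      rw [← Function.surjInv_eq hM v, ← Function.surjInv_eq hM v']
      exact (hv _ _).2 h, fun v => by
      obtain ⟨d, rfl⟩ := hN v
      obtain ⟨d, rfl⟩ := f.surjective d
      exact ⟨M.vert d, (hv _ _).1 (Function.surjInv_eq hM _)⟩⟩
  onD := f
  vert_eq d := (hv _ _).1 (Function.surjInv_eq hM _).symm
  cw_eq := hcw
  opp_eq := hopp
  root_eq := hroot

theorem Iso.semiconj_face (φ : Iso M N) : Function.Semiconj φ.onD M.face N.face := fun d => by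
  simp only [face, Perm.mul_apply, φ.cw_eq, φ.opp_eq]

theorem Iso.face_sameCycle (φ : Iso M N) {d e : M.D}
    (h : N.face.SameCycle (φ.onD d) (φ.onD e)) : M.face.SameCycle d e := by
  have : Finite N.D := N.finD
  obtain ⟨n, -, hn⟩ := h.exists_pow_eq'
  rw [← Perm.iterate_eq_pow, ← φ.semiconj_face.iterate_right n] at hn
  exact ⟨n, by rw [zpow_natCast, ← Perm.iterate_eq_pow, φ.onD.injective hn]⟩

theorem Iso.reflTransGen_symm (φ : Iso M N) {x y : N.V}
    (h : Relation.ReflTransGen (fun x y => ∃ d, N.vert d = x ∧ N.vert (N.opp d) = y) x y) :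
    Relation.ReflTransGen (fun x y => ∃ d, M.vert d = x ∧ M.vert (M.opp d) = y)
      (φ.onV.symm x) (φ.onV.symm y) := by
  refine h.lift _ ?_
  rintro _ _ ⟨d, rfl, rfl⟩
  obtain ⟨d, rfl⟩ := φ.onD.surjective d
  refine ⟨d, ?_, ?_⟩
  · rw [φ.vert_eq, Equiv.symm_apply_apply]
  · rw [φ.opp_eq, φ.vert_eq, Equiv.symm_apply_apply]

theorem Iso.connected (φ : Iso M N)
    (h : ∀ x y, Relation.ReflTransGen (fun x y => ∃ d, N.vert d = x ∧ N.vert (N.opp d) = y) x y)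
    (x y : M.V) :
    Relation.ReflTransGen (fun x y => ∃ d, M.vert d = x ∧ M.vert (M.opp d) = y) x y := by
  simpa using φ.reflTransGen_symm (h (φ.onV x) (φ.onV y))

end RootedMap

namespace PrefixMap

open BinTree

variable {w : List Letter} {e : ℕ}

theorem le_length_of_isLabel_plus (he : IsLabel (plus w) e) : e ≤ w.length := by
  rcases he.cases with rfl | ⟨n, s, rfl, hs⟩
  · exact Nat.zero_le _
  · by_contra h
    rw [getElem?_plus_of_le (by omega) (List.getElem?_eq_some_iff.1 hs).1] at hs
    cases s <;> simp [Side.openLetter] at hs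

theorem isDescribedAt_lambda₁_plus (hw : IsPrefixShuffle w) :
    IsDescribedAt (plus w) w.length (lambda₁ w) := by
  simpa only [take_plus] using isDescribedAt_lambda₁ (isPrefixShuffle_plus hw) w.length

theorem isNode_iff (hw : IsPrefixShuffle w) (p : Address) :
    (lambda₁ w).IsNode p ↔ ∃ e, IsLabel (plus w) e ∧ p = nodeAddr (plus w) e :=
  ((isDescribedAt_lambda₁_plus hw).isNode_iff p).trans
    ⟨fun ⟨e, _, h⟩ => ⟨e, h⟩, fun ⟨e, h⟩ => ⟨e, le_length_of_isLabel_plus h.1, h⟩⟩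

theorem isNode_nodeAddr (hw : IsPrefixShuffle w) (he : IsLabel (plus w) e) :
    (lambda₁ w).IsNode (nodeAddr (plus w) e) := (isNode_iff hw _).2 ⟨e, he, rfl⟩

theorem nodeAddr_plus_inj (hw : IsPrefixShuffle w) {e' : ℕ} (he : IsLabel (plus w) e)
    (he' : IsLabel (plus w) e') (h : nodeAddr (plus w) e = nodeAddr (plus w) e') : e = e' :=
  (isDescribedAt_lambda₁_plus hw).nodeAddr_inj (le_length_of_isLabel_plus he)
    (le_length_of_isLabel_plus he') he he' h

theorem headLabel_injective (hw : IsPrefixShuffle w) :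
    Function.Injective (headLabel (w := w)) := fun h h' heq => by
  rw [← headAt_headLabel hw h, ← headAt_headLabel hw h']
  exact headAt_congr hw heq

/-- The half-edge of `θ(λ₁(w))` corresponding to a half-edge of `P_w`. The edge of a head with
label `e` corresponds to the branching edge of the node with address `nodeAddr (plus w) e`. -/
noncomputable def toTheta (hw : IsPrefixShuffle w) (x : (partitionTree w).D) :
    (lambda₁ w).theta.D :=
  match x.1 with
  | Sum.inl _ => (lambda₁ w).theta.root
  | Sum.inr (Sum.inl h) => thetaHalf _ (isNode_nodeAddr hw (isLabel_headLabel hw h)) .left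
  | Sum.inr (Sum.inr h) => thetaHalf _ (isNode_nodeAddr hw (isLabel_headLabel hw h)) .right

theorem toTheta_root (hw : IsPrefixShuffle w) :
    toTheta hw (partitionTree w).root = (lambda₁ w).theta.root := rfl

theorem toTheta_pHalf (hw : IsPrefixShuffle w) (s : Side) (h : Head w) : toTheta hw (pHalf s h) =
    thetaHalf _ (isNode_nodeAddr hw (isLabel_headLabel hw h)) s := by
  cases s <;> rfl

theorem toTheta_pHalf_headAt (hw : IsPrefixShuffle w) (s : Side) (he : IsLabel (plus w) e) :
    toTheta hw (pHalf s (headAt hw he)) = thetaHalf _ (isNode_nodeAddr hw he) s :=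
  (toTheta_pHalf hw s _).trans (thetaHalf_congr (by rw [headLabel_headAt]))

theorem toTheta_injective (hw : IsPrefixShuffle w) : Function.Injective (toTheta hw) := by
  intro x y hxy
  rcases partitionTree_eq_root_or_eq_pHalf x with rfl | ⟨s, h, rfl⟩ <;>
    rcases partitionTree_eq_root_or_eq_pHalf y with rfl | ⟨t, h', rfl⟩
  · rfl
  · rw [toTheta_root, toTheta_pHalf] at hxy
    exact absurd hxy.symm thetaHalf_ne_root
  · rw [toTheta_root, toTheta_pHalf] at hxy
    exact absurd hxy thetaHalf_ne_root
  · rw [toTheta_pHalf, toTheta_pHalf] at hxy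
    obtain ⟨haddr, rfl⟩ := thetaHalf_inj hxy
    rw [headLabel_injective hw
      (nodeAddr_plus_inj hw (isLabel_headLabel hw h) (isLabel_headLabel hw h') haddr)]

theorem toTheta_surjective (hw : IsPrefixShuffle w) : Function.Surjective (toTheta hw) := by
  intro d
  rcases eq_root_or_eq_thetaHalf d with rfl | ⟨p, hp, s, rfl⟩
  · exact ⟨_, toTheta_root hw⟩
  · obtain ⟨e, he, rfl⟩ := (isNode_iff hw p).1 hp
    exact ⟨_, toTheta_pHalf_headAt hw s he⟩

theorem thetaTop_toTheta (hw : IsPrefixShuffle w) (x : (partitionTree w).D) :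
    thetaTop ((lambda₁ w).theta.vert (toTheta hw x)) =
      topAddr (plus w) (code x).1 (code x).2 := by
  rcases partitionTree_eq_root_or_eq_pHalf x with rfl | ⟨s, h, rfl⟩
  · exact congrArg thetaTop theta_vert_root
  · rw [toTheta_pHalf, theta_vert_thetaHalf, thetaTop_thetaVertex,
      chainTop_cons_nodeAddr (isPrefixShuffle_plus hw) (isLabel_headLabel hw h), code_pHalf]

theorem isLabel_code (hw : IsPrefixShuffle w) (x : (partitionTree w).D) :
    IsLabel (plus w) (code x).2 :=
  (vert_eq_vert_of_code_eq hw (Prod.mk.eta (p := code x)).symm).fst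

theorem theta_vert_toTheta_eq_iff (hw : IsPrefixShuffle w) (x y : (partitionTree w).D) :
    (lambda₁ w).theta.vert (toTheta hw x) = (lambda₁ w).theta.vert (toTheta hw y) ↔
      code x = code y := by
  rw [← thetaTop_injective.eq_iff, thetaTop_toTheta, thetaTop_toTheta]
  refine ⟨fun h => ?_, fun h => by rw [h]⟩
  obtain ⟨hside, hlabel⟩ :=
    topAddr_inj (isPrefixShuffle_plus hw) (isLabel_code hw x) (isLabel_code hw y) h
  exact Prod.ext hside hlabel

theorem theta_opp_toTheta (hw : IsPrefixShuffle w) (x : (partitionTree w).D) :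
    (lambda₁ w).theta.opp (toTheta hw x) = toTheta hw ((partitionTree w).opp x) := by
  rcases partitionTree_eq_root_or_eq_pHalf x with rfl | ⟨s, h, rfl⟩
  · rw [toTheta_root, theta_opp_root, partitionTree_opp_root, toTheta_root]
  · rw [toTheta_pHalf, theta_opp_thetaHalf, partitionTree_opp_pHalf, toTheta_pHalf]

/-- The bijection between the half-edges of `P_w` and those of `θ(λ₁(w))`. -/
noncomputable def toThetaEquiv (hw : IsPrefixShuffle w) :
    (partitionTree w).D ≃ (lambda₁ w).theta.D :=
  Equiv.ofBijective (toTheta hw) ⟨toTheta_injective hw, toTheta_surjective hw⟩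

/-- The clockwise rotation of `θ(λ₁(w))`, as a permutation of the half-edges of `P_w`. -/
noncomputable def thetaCw (hw : IsPrefixShuffle w) : Perm (partitionTree w).D :=
  (toThetaEquiv hw).symm.permCongr (lambda₁ w).theta.cw

theorem toTheta_thetaCw (hw : IsPrefixShuffle w) (x : (partitionTree w).D) :
    toTheta hw (thetaCw hw x) = (lambda₁ w).theta.cw (toTheta hw x) :=
  (toThetaEquiv hw).apply_symm_apply _

theorem thetaCw_eq (hw : IsPrefixShuffle w) {x y : (partitionTree w).D}
    (h : (lambda₁ w).theta.cw (toTheta hw x) = toTheta hw y) : thetaCw hw x = y :=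
  toTheta_injective hw ((toTheta_thetaCw hw x).trans h)

theorem thetaCw_root (hw : IsPrefixShuffle w) :
    thetaCw hw (partitionTree w).root = pHalf .left (headAt hw (isLabel_zero _)) := by
  refine thetaCw_eq hw ?_
  rw [toTheta_root, toTheta_pHalf_headAt,
    theta_cw_root (nodeAddr_zero (u := plus w) ▸ isNode_nodeAddr hw (isLabel_zero _))]
  exact thetaHalf_congr nodeAddr_zero.symm

theorem thetaCw_pHalf_left (hw : IsPrefixShuffle w) {n : ℕ} (h : (plus w)[n]? = some .a)
    (he : IsLabel (plus w) (latest (plus w) .left n)) (he' : IsLabel (plus w) (n + 1)) :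
    thetaCw hw (pHalf .left (headAt hw he)) = pHalf .left (headAt hw he') := by
  have haddr := nodeAddr_touch (s := .left) (isPrefixShuffle_plus hw) h
  refine thetaCw_eq hw ?_
  rw [toTheta_pHalf_headAt, toTheta_pHalf_headAt,
    theta_cw_left _ _ (haddr ▸ isNode_nodeAddr hw he')]
  exact thetaHalf_congr haddr.symm

theorem thetaCw_pHalf_right (hw : IsPrefixShuffle w) {n : ℕ} (h : (plus w)[n]? = some .b)
    (he : IsLabel (plus w) (latest (plus w) .right n)) (he' : IsLabel (plus w) (n + 1)) :
    thetaCw hw (pHalf .right (headAt hw he')) = pHalf .right (headAt hw he) := by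
  have haddr := nodeAddr_touch (s := .right) (isPrefixShuffle_plus hw) h
  have hnode : (lambda₁ w).IsNode (.right :: nodeAddr (plus w) (latest (plus w) .right n)) := by
    rw [← haddr]
    exact isNode_nodeAddr hw he'
  refine thetaCw_eq hw ?_
  rw [toTheta_pHalf_headAt, toTheta_pHalf_headAt,
    ← theta_cw_right _ (isNode_nodeAddr hw he) hnode]
  exact congrArg _ (thetaHalf_congr haddr)

theorem code_cw (hw : IsPrefixShuffle w) (x : (partitionTree w).D) :
    code ((partitionTree w).cw x) = code x :=
  (vert_eq_iff_code_eq hw _ _).1 (partitionTree_vert_cw x)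

theorem code_thetaCw (hw : IsPrefixShuffle w) (x : (partitionTree w).D) :
    code (thetaCw hw x) = code x := by
  rw [← theta_vert_toTheta_eq_iff hw, toTheta_thetaCw, theta_vert_cw]

theorem cw_eq_thetaCw_of_left (hw : IsPrefixShuffle w) {x : (partitionTree w).D}
    (hx : (code x).1 = .left) : (partitionTree w).cw x = thetaCw hw x := by
  refine perm_apply_eq_of_common_preimage (s := fun x => (code x).1 = .left) (g := code)
    (f := fun x => x = (partitionTree w).root ∨ ∃ k, ∃ hk : IsLabel (plus w) k,
      k ≠ 0 ∧ opening (plus w) .left k = k ∧ x = pHalf .left (headAt hw hk))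
    (code_cw hw) (code_thetaCw hw) (fun x h => by rwa [code_cw hw])
    (fun x h => by rwa [code_thetaCw hw]) ?_ ?_ hx
  · rintro y z - - (rfl | ⟨k, hk, h0, hopen, rfl⟩) (rfl | ⟨k', hk', h0', hopen', rfl⟩) heq
    · rfl
    · rw [code_root, code_pHalf_headAt, hopen'] at heq
      exact absurd (Prod.mk.inj heq).2.symm h0'
    · rw [code_root, code_pHalf_headAt, hopen] at heq
      exact absurd (Prod.mk.inj heq).2 h0
    · rw [code_pHalf_headAt, code_pHalf_headAt, hopen, hopen'] at heq
      rw [headAt_congr hw (Prod.mk.inj heq).2]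
  · intro y hy
    rcases partitionTree_eq_root_or_eq_pHalf y with rfl | ⟨s, h, rfl⟩
    · exact Or.inl (Or.inl rfl)
    · obtain ⟨e, he, rfl⟩ := exists_eq_headAt hw h
      obtain rfl : s = .left := by rwa [code_pHalf] at hy
      rcases he.cases with rfl | ⟨n, _ | _, rfl, hn⟩
      · exact Or.inr ⟨_, partitionTree_cw_root hw, thetaCw_root hw⟩
      · exact Or.inl (Or.inr ⟨_, he, n.succ_ne_zero, opening_open (s := .left) hn, rfl⟩)
      · have hlatest := isLabel_latest (isPrefixShuffle_plus hw) .left n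
        exact Or.inr ⟨_, partitionTree_cw_pHalf_left hw hn hlatest he,
          thetaCw_pHalf_left hw hn hlatest he⟩

theorem inv_cw_eq_inv_thetaCw_of_right (hw : IsPrefixShuffle w) {x : (partitionTree w).D}
    (hx : (code x).1 = .right) : (partitionTree w).cw⁻¹ x = (thetaCw hw)⁻¹ x := by
  have hcw (x : (partitionTree w).D) : code ((partitionTree w).cw⁻¹ x) = code x := by
    simpa using (code_cw hw ((partitionTree w).cw⁻¹ x)).symm
  have hthetaCw (x : (partitionTree w).D) : code ((thetaCw hw)⁻¹ x) = code x := by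
    simpa using (code_thetaCw hw ((thetaCw hw)⁻¹ x)).symm
  refine perm_apply_eq_of_common_preimage (s := fun x => (code x).1 = .right) (g := code)
    (f := fun x => ∃ k, ∃ hk : IsLabel (plus w) k,
      opening (plus w) .right k = k ∧ x = pHalf .right (headAt hw hk))
    hcw hthetaCw (fun x h => by rwa [hcw]) (fun x h => by rwa [hthetaCw]) ?_ ?_ hx
  · rintro y z - - ⟨k, hk, hopen, rfl⟩ ⟨k', hk', hopen', rfl⟩ heq
    rw [code_pHalf_headAt, code_pHalf_headAt, hopen, hopen'] at heq
    rw [headAt_congr hw (Prod.mk.inj heq).2]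
  · intro y hy
    rcases partitionTree_eq_root_or_eq_pHalf y with rfl | ⟨s, h, rfl⟩
    · cases hy
    · obtain ⟨e, he, rfl⟩ := exists_eq_headAt hw h
      obtain rfl : s = .right := by rwa [code_pHalf] at hy
      rcases he.cases with rfl | ⟨n, _ | _, rfl, hn⟩
      · exact Or.inl ⟨0, he, rfl, rfl⟩
      · have hlatest := isLabel_latest (isPrefixShuffle_plus hw) .right n
        exact Or.inr ⟨pHalf .right (headAt hw hlatest),
          Perm.inv_eq_iff_eq.2 (partitionTree_cw_pHalf_right hw hn hlatest he).symm,
          Perm.inv_eq_iff_eq.2 (thetaCw_pHalf_right hw hn hlatest he).symm⟩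
      · exact Or.inl ⟨_, he, opening_open (s := .right) hn, rfl⟩

theorem cw_eq_thetaCw (hw : IsPrefixShuffle w) (x : (partitionTree w).D) :
    (partitionTree w).cw x = thetaCw hw x := by
  rcases hside : (code x).1 with _ | _
  · exact cw_eq_thetaCw_of_left hw hside
  · have h := inv_cw_eq_inv_thetaCw_of_right hw (x := (partitionTree w).cw x)
      (by rwa [code_cw hw])
    rw [Perm.inv_eq_iff_eq.2 rfl, eq_comm, Perm.inv_eq_iff_eq] at h
    exact h

/-- The isomorphism from `P_w` to `θ(λ₁(w))`. -/
noncomputable def isoTheta (hw : IsPrefixShuffle w) : (partitionTree w).Iso (lambda₁ w).theta :=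
  RootedMap.Iso.ofHalfEdges (toThetaEquiv hw) (partitionTree_vert_surjective hw)
    theta_vert_surjective
    (fun x y => (vert_eq_iff_code_eq hw x y).trans (theta_vert_toTheta_eq_iff hw x y).symm)
    (fun x => (toTheta_thetaCw hw x).symm.trans (congrArg _ (cw_eq_thetaCw hw x).symm))
    (theta_opp_toTheta hw) (toTheta_root hw)

/-! ### `P_w` is a tree -/

/-- The side on which the node of a head label is attached below its father edge: the vertex with
code `(childSide w e, e)` is the son end of the edge with label `e`. -/
noncomputable def childSide (w : List Letter) (e : ℕ) : Side :=
  if opening (plus w) .right e = e then .right else .left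

theorem childSide_zero : childSide w 0 = .right := rfl

theorem opening_eq_self_iff (hw : IsPrefixShuffle w) (he : IsLabel (plus w) e) (s : Side) :
    opening (plus w) s e = e ↔ s = childSide w e ∨ e = 0 := by
  have hu := isPrefixShuffle_plus hw
  rcases he.cases with rfl | ⟨n, t, rfl, hn⟩
  · exact iff_of_true rfl (Or.inr rfl)
  · have hopen : opening (plus w) t (n + 1) = n + 1 := opening_open hn
    have htouch : opening (plus w) t.other (n + 1) ≠ n + 1 := by
      rw [opening_touch hu (by rwa [Side.other_other])]
      exact (Nat.lt_succ_of_le (opening_le hu _ n)).ne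
    cases t <;> cases s <;> simp_all [childSide, Side.other]

/-- The half-edge of the edge of `h` that is incident to the son end of this edge. -/
noncomputable def child (h : Head w) : (partitionTree w).D := pHalf (childSide w (headLabel h)) h

theorem code_child (hw : IsPrefixShuffle w) (h : Head w) :
    code (child h) = (childSide w (headLabel h), headLabel h) := by
  rw [child, code_pHalf, (opening_eq_self_iff hw (isLabel_headLabel hw h) _).2 (Or.inl rfl)]

theorem code_child_ne_code_root (hw : IsPrefixShuffle w) (h : Head w) :
    code (child h) ≠ code (partitionTree w).root := by
  rw [code_child hw, code_root]
  intro heq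
  obtain ⟨hside, hlabel⟩ := Prod.mk.inj heq
  rw [hlabel, childSide_zero] at hside
  cases hside

/-- The vertices of `P_w`, up to bijection: the root-vertex and the son ends of the edges. -/
noncomputable def rootOrSon (o : Option (Head w)) : (partitionTree w).V :=
  (partitionTree w).vert (o.elim (partitionTree w).root child)

theorem rootOrSon_injective (hw : IsPrefixShuffle w) :
    Function.Injective (rootOrSon (w := w)) := by
  intro o o' h
  have h := (vert_eq_iff_code_eq hw _ _).1 h
  rcases o with _ | o <;> rcases o' with _ | o'
  · rfl
  · exact absurd h.symm (code_child_ne_code_root hw o')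
  · exact absurd h (code_child_ne_code_root hw o)
  · rw [Option.elim_some, Option.elim_some, code_child hw, code_child hw] at h
    rw [headLabel_injective hw (Prod.mk.inj h).2]

theorem rootOrSon_surjective (hw : IsPrefixShuffle w) :
    Function.Surjective (rootOrSon (w := w)) := by
  intro v
  obtain ⟨x, rfl⟩ := partitionTree_vert_surjective hw v
  rcases partitionTree_eq_root_or_eq_pHalf x with rfl | ⟨s, h, rfl⟩
  · exact ⟨none, rfl⟩
  · obtain ⟨e, he, rfl⟩ := exists_eq_headAt hw h
    have hk := isLabel_opening (isPrefixShuffle_plus hw) s e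
    have hopening := opening_opening (isPrefixShuffle_plus hw) s e
    by_cases hs : s = childSide w (opening (plus w) s e)
    · refine ⟨some (headAt hw hk), (vert_eq_iff_code_eq hw _ _).2 ?_⟩
      rw [Option.elim_some, code_child hw, code_pHalf_headAt, headLabel_headAt, ← hs]
    · have hzero := ((opening_eq_self_iff hw hk s).1 hopening).resolve_left hs
      rw [hzero, childSide_zero] at hs
      obtain rfl : s = .left := Side.eq_other_of_ne hs
      exact ⟨none, (vert_eq_iff_code_eq hw _ _).2 (by
        rw [Option.elim_none, code_root, code_pHalf_headAt, hzero])⟩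

theorem card_V (hw : IsPrefixShuffle w) :
    Nat.card (partitionTree w).V = Nat.card (Head w) + 1 := by
  rw [← Finite.card_option]
  exact (Nat.card_congr
    (Equiv.ofBijective rootOrSon ⟨rootOrSon_injective hw, rootOrSon_surjective hw⟩)).symm

/-- The head whose permeable edge is dual to the edge of a half-edge of `P_w`, if this is not the
root. -/
noncomputable def headOf (x : (partitionTree w).D) : Option (Head w) :=
  match x.1 with
  | Sum.inl _ => none
  | Sum.inr (Sum.inl h) => some h
  | Sum.inr (Sum.inr h) => some h

theorem headOf_pHalf (s : Side) (h : Head w) : headOf (pHalf s h) = some h := by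
  cases s <;> rfl

theorem headOf_opp (x : (partitionTree w).D) : headOf ((partitionTree w).opp x) = headOf x := by
  rcases partitionTree_eq_root_or_eq_pHalf x with rfl | ⟨s, h, rfl⟩
  · rw [partitionTree_opp_root]
  · rw [partitionTree_opp_pHalf, headOf_pHalf, headOf_pHalf]

theorem headOf_eq_of_orbitOf_opp_eq {x y : (partitionTree w).D}
    (h : orbitOf (partitionTree w).opp x = orbitOf (partitionTree w).opp y) :
    headOf x = headOf y :=
  apply_eq_of_sameCycle headOf_opp (Quotient.exact h)

theorem card_Edge : Nat.card (partitionTree w).Edge = Nat.card (Head w) := by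
  refine (Nat.card_congr (Equiv.ofBijective (fun h : Head w =>
    (⟨orbitOf (partitionTree w).opp (pHalf .left h), fun heq => ?_⟩ : (partitionTree w).Edge))
    ⟨fun h h' heq => ?_, ?_⟩)).symm
  · cases headOf_eq_of_orbitOf_opp_eq heq
  · exact Option.some.inj (headOf_eq_of_orbitOf_opp_eq (Subtype.mk.inj heq))
  · rintro ⟨o, ho⟩
    obtain ⟨x, rfl⟩ := Quotient.exists_rep o
    rcases partitionTree_eq_root_or_eq_pHalf x with rfl | ⟨_ | _, h, rfl⟩
    · exact absurd rfl ho
    · exact ⟨h, rfl⟩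
    · refine ⟨h, Subtype.ext (Quotient.sound ⟨1, ?_⟩)⟩
      rw [zpow_one, partitionTree_opp_pHalf]
      rfl

theorem partitionTree_one_face (hw : IsPrefixShuffle w) :
    Nat.card (Orbit (partitionTree w).face) = 1 := by
  rw [Nat.card_eq_one_iff_unique]
  refine ⟨⟨?_⟩, ⟨orbitOf _ (partitionTree w).root⟩⟩
  rintro ⟨x⟩ ⟨y⟩
  exact Quotient.sound ((isoTheta hw).face_sameCycle (theta_face_sameCycle _ _))

theorem partitionTree_isTree (hw : IsPrefixShuffle w) : (partitionTree w).IsTree where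
  opp_opp x := by
    rcases partitionTree_eq_root_or_eq_pHalf x with rfl | ⟨s, h, rfl⟩
    · rw [partitionTree_opp_root, partitionTree_opp_root]
    · rw [partitionTree_opp_pHalf, partitionTree_opp_pHalf, Side.other_other]
  opp_eq_self x := by
    rcases partitionTree_eq_root_or_eq_pHalf x with rfl | ⟨_ | _, h, rfl⟩
    · exact iff_of_true partitionTree_opp_root rfl
    all_goals
      rw [partitionTree_opp_pHalf]
      refine iff_of_false (fun heq => ?_) (fun heq => ?_) <;> cases congrArg Subtype.val heq
  rotation := vert_eq_iff_sameCycle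
  connected := (isoTheta hw).connected theta_connected
  euler := by rw [partitionTree_one_face hw, card_V hw, card_Edge]
  one_face := partitionTree_one_face hw

end PrefixMap

/-! ### Leaves and active vertices -/

namespace PrefixMap

open BinTree

variable {w : List Letter} {e f i : ℕ} {s : Side}

theorem isoTheta_onV (hw : IsPrefixShuffle w) (x : (partitionTree w).D) :
    (isoTheta hw).onV ((partitionTree w).vert x) = (lambda₁ w).theta.vert (toTheta hw x) :=
  ((isoTheta hw).vert_eq x).symm

theorem exists_leaf_eq_cons_nodeAddr (hw : IsPrefixShuffle w) (l : (lambda₁ w).Leaf) :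
    ∃ s e, IsLabel (plus w) e ∧ l.1 = s :: nodeAddr (plus w) e := by
  have hnode := l.2.not_isNode
  have hvertex := l.2.isVertex
  rcases hl : l.1 with _ | ⟨s, p⟩
  · rw [hl, ← nodeAddr_zero (u := plus w)] at hnode
    exact absurd (isNode_nodeAddr hw (isLabel_zero _)) hnode
  · rw [hl, isVertex_cons, isNode_iff hw] at hvertex
    obtain ⟨e, he, rfl⟩ := hvertex
    exact ⟨s, e, he, rfl⟩

theorem exists_label_of_onV_eq_vertex (hw : IsPrefixShuffle w) {x : PVertex w}
    {l : (lambda₁ w).Leaf} (h : (isoTheta hw).onV x = l.vertex) :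
    ∃ s e, ∃ he : IsLabel (plus w) e, l.1 = s :: nodeAddr (plus w) e ∧
      x = (partitionTree w).vert (pHalf s (headAt hw he)) := by
  obtain ⟨s, e, he, hl⟩ := exists_leaf_eq_cons_nodeAddr hw l
  refine ⟨s, e, he, hl, (isoTheta hw).onV.injective ?_⟩
  rw [h, isoTheta_onV, toTheta_pHalf_headAt, theta_vert_thetaHalf]
  exact thetaVertex_congr (hp := l.2.isVertex) hl

theorem actives_lambda₁ (hw : IsPrefixShuffle w) :
    (lambda₁ w).actives = stackLeaves (plus w) (activeStack (plus w) · w.length) :=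
  (isDescribedAt_lambda₁_plus hw).actives_eq

theorem mem_actives_lambda₁ (hw : IsPrefixShuffle w) (he : IsLabel (plus w) e) :
    s :: nodeAddr (plus w) e ∈ (lambda₁ w).actives ↔
      (opening (plus w) s e, e) ∈ activeStack (plus w) s w.length := by
  have hu := isPrefixShuffle_plus hw
  rw [actives_lambda₁ hw, stackLeaves, List.mem_append, List.mem_reverse, List.mem_map,
    List.mem_map]
  constructor
  · rintro (⟨⟨k, e'⟩, hmem, heq⟩ | ⟨⟨k, e'⟩, hmem, heq⟩) <;>
    · obtain ⟨rfl, haddr⟩ := List.cons.inj heq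
      obtain ⟨-, he', hopening, -⟩ := mem_activeStack hu hmem
      obtain rfl := nodeAddr_plus_inj hw he' he haddr
      rwa [hopening]
  · intro hmem
    cases s
    · exact Or.inl ⟨_, hmem, rfl⟩
    · exact Or.inr ⟨_, hmem, rfl⟩

theorem leaf_isActive_iff_mem_activeStack (hw : IsPrefixShuffle w) {l : (lambda₁ w).Leaf}
    (he : IsLabel (plus w) e) (hl : l.1 = s :: nodeAddr (plus w) e) :
    l.IsActive ↔ (opening (plus w) s e, e) ∈ activeStack (plus w) s w.length := by
  rw [← mem_actives_lambda₁ hw he, ← hl]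
  exact mem_actives.symm

theorem leaf_isActive_iff_isActiveAt (hw : IsPrefixShuffle w) {l : (lambda₁ w).Leaf}
    (he : IsLabel (plus w) e) (hl : l.1 = s :: nodeAddr (plus w) e) :
    l.IsActive ↔ IsActiveAt (plus w) s w.length (opening (plus w) s e) := by
  have hu := isPrefixShuffle_plus hw
  rw [leaf_isActive_iff_mem_activeStack hw he hl]
  refine ⟨fun hmem => ⟨e, hmem⟩, fun ⟨e', hmem⟩ => ?_⟩
  obtain ⟨-, he', hopening, -⟩ := mem_activeStack hu hmem
  rw [← hopening] at hmem
  have hactive := mem_actives.1 ((mem_actives_lambda₁ hw he').2 hmem)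
  -- Both leaves are contracted into the same vertex of `θ(λ₁(w))`, hence are equal.
  have hvertex : Leaf.vertex (⟨_, ⟨_, hactive⟩⟩ : (lambda₁ w).Leaf) = l.vertex := by
    apply thetaTop_injective
    change chainTop (s :: nodeAddr (plus w) e') = chainTop l.1
    rw [hl, chainTop_cons_nodeAddr hu he', chainTop_cons_nodeAddr hu he, hopening]
  have haddr := (congrArg Subtype.val (Leaf.vertex_injective hvertex)).trans hl
  rwa [nodeAddr_plus_inj hw he' he (List.cons.inj haddr).2] at hmem

theorem activeStack_left_length (w : List Letter) :
    activeStack (plus w) .left (plus w).length = activeStack (plus w) .left w.length := by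
  have constant_after_length : ∀ n, w.length ≤ n → n ≤ (plus w).length →
      activeStack (plus w) .left n = activeStack (plus w) .left w.length := by
    intro n hn
    induction n, hn using Nat.le_induction with
    | base => exact fun _ => rfl
    | succ n hn ih =>
      intro h
      rw [activeStack_other (s := .left) (getElem?_plus_of_le hn h), ih (by omega)]
  exact constant_after_length _ (length_le_plus w) le_rfl

theorem isActiveAt_left_length_plus (w : List Letter) (k : ℕ) :
    IsActiveAt (plus w) .left (plus w).length k ↔ IsActiveAt (plus w) .left w.length k := by
  rw [IsActiveAt, IsActiveAt, activeStack_left_length]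

theorem faceOf_near_ne_far (hw : IsPrefixShuffle w) (h h' : Head w) :
    faceOf (near h) ≠ faceOf (far h') := by
  intro heq
  cases (Prod.mk.inj (owner_eq_of_faceOf hw heq)).1

theorem pvert_near_eq_inr_or (h : Head w) :
    (∃ h', pvert (near h) = Sum.inr h') ∨ pvert (near h) = Sum.inl (faceOf (near h)) := by
  by_cases hface : faceOf (near h) = rootFace w
  · by_cases hex : ∃ h' : Dangling w, IsLastDanglingBefore h' (near h)
    · exact Or.inl ⟨_, pvert_of_isLastDanglingBefore hface hex.choose_spec⟩
    · exact Or.inr (by rw [pvert_of_not_exists hface hex, hface, exterior])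
  · exact Or.inr (pvert_of_ne_rootFace hface)

theorem isWhite_vert_pHalf_iff (hw : IsPrefixShuffle w) (s : Side) (h : Head w) :
    IsWhite ((partitionTree w).vert (pHalf s h)) ↔ s = .left := by
  cases s
  · refine iff_of_true (?_ : IsWhite (pvert (near h))) rfl
    rcases pvert_near_eq_inr_or h with ⟨h', hvert⟩ | hvert <;> rw [hvert]
    · trivial
    · exact ⟨ccw w h.1, by rw [← starFace_near, faceOf_starFace]⟩
  · refine iff_of_false (?_ : ¬ IsWhite (pvert (far h))) (by simp)
    rw [pvert_far hw]
    rintro ⟨d, heq⟩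
    cases (Prod.mk.inj (owner_eq_of_faceOf hw heq)).1

theorem isBlack_vert_pHalf_iff (hw : IsPrefixShuffle w) (s : Side) (h : Head w) :
    IsBlack ((partitionTree w).vert (pHalf s h)) ↔ s = .right := by
  cases s
  · refine iff_of_false (?_ : ¬ IsBlack (pvert (near h))) (by simp)
    rcases pvert_near_eq_inr_or h with ⟨h', hvert⟩ | hvert <;> rw [hvert]
    · exact id
    · rintro ⟨h', heq⟩
      exact faceOf_near_ne_far hw h h' heq
  · refine iff_of_true (?_ : IsBlack (pvert (far h))) rfl
    rw [pvert_far hw]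
    exact ⟨h, rfl⟩

theorem isActive_near_iff (hw : IsPrefixShuffle w) (he : IsLabel (plus w) e) :
    IsActive (pvert (near (headAt hw he))) ↔
      IsActiveAt (plus w) .left w.length (opening (plus w) .left e) := by
  have hu := isPrefixShuffle_plus hw
  have hk := isLabel_opening hu .left e
  have hopening := opening_opening hu .left e
  rw [pvert_near_opening hw he hk, ← isActiveAt_left_length_plus]
  generalize opening (plus w) .left e = k at hk hopening
  by_cases hactive : IsActiveAt (plus w) .left (plus w).length k
  · refine iff_of_true ?_ hactive
    rcases eq_or_ne k 0 with rfl | h0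
    · rw [pvert_near_zero hw]
      exact Or.inl rfl
    · rw [pvert_near_of_isDangling hw hk ((isDangling_tour hw hk.le_length).2 ⟨h0, hactive⟩)]
      trivial
  · refine iff_of_false ?_ hactive
    have hface := faceOf_near_ne_rootFace hw hk hopening hactive
    rw [pvert_of_ne_rootFace hface]
    rintro (heq | ⟨h, -, heq⟩)
    · exact hface heq
    · exact faceOf_near_ne_far hw _ h heq

theorem isPaired_append_iff {c c' : Letter} {u v : List Letter} {i j : ℕ} :
    IsPaired c c' (u ++ v) i j ∧ j < u.length ↔ IsPaired c c' u i j := by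
  have iff_of_lt (hj : j < u.length) (hij : i < j) :
      IsPaired c c' (u ++ v) i j ↔ IsPaired c c' u i j := by
    have hsub : subwordBetween c c' (u ++ v) i j = subwordBetween c c' u i j := by
      unfold subwordBetween
      rw [List.drop_append_of_le_length (by omega),
        List.take_append_of_le_length (by rw [List.length_drop]; omega)]
    rw [IsPaired, IsPaired, hsub, List.getElem?_append_left hj,
      List.getElem?_append_left (by omega)]
  exact ⟨fun ⟨h, hj⟩ => (iff_of_lt hj h.1).1 h,
    fun h => ⟨(iff_of_lt h.lt_length h.1).2 h, h.lt_length⟩⟩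

theorem isActiveAt_right_iff_not_isPaired (hw : IsPrefixShuffle w)
    (hi : (plus w)[i]? = some .a) :
    IsActiveAt (plus w) .right w.length (i + 1) ↔ ¬ ∃ k, IsPaired .a .abar w i k := by
  have hlt : i < w.length := le_length_of_isLabel_plus (isLabel_succ (s := .right) hi)
  rw [isActiveAt_iff (s := .right) (isPrefixShuffle_plus hw) hi hlt]
  refine not_congr (exists_congr fun k => ?_)
  rw [and_comm]
  exact isPaired_append_iff

theorem isRooting_headAt_iff (hw : IsPrefixShuffle w) (he : IsLabel (plus w) e) :
    IsRooting w (headAt hw he).1 ↔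
      opening (plus w) .right e = e ∧ IsActiveAt (plus w) .right w.length e := by
  have hu := isPrefixShuffle_plus hw
  rcases he.cases with rfl | ⟨n, _ | _, rfl, hn⟩
  · exact iff_of_true (Or.inl (headAt_zero hw he)) ⟨rfl, isActiveAt_zero hu _ _⟩
  · have hval : (headAt hw he).1.val = n + 1 := by
      rw [headAt_of_b hw hn, tour_val he.le_length]
    refine iff_of_false ?_ fun h => ?_
    · rintro (hroot | ⟨i, j, hj, hpaired, -⟩)
      · rw [hroot] at hval
        cases hval
      · obtain rfl : j = n := by omega
        cases hn.symm.trans hpaired.2.2.1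
    · have hle := opening_le hu .right n
      rw [opening_touch (s := .right) hu hn] at h
      omega
  · obtain ⟨j, hpaired⟩ := exists_paired_a hw hn
    have hval : (headAt hw he).1.val = j + 1 := by
      rw [headAt_val, treeOpp_eq (linked_tour hpaired), tour_val hpaired.lt_length]
    rw [isActiveAt_right_iff_not_isPaired hw hn]
    refine ⟨?_, fun h => Or.inr ⟨n, j, hval, hpaired, h.2⟩⟩
    rintro (hroot | ⟨i, j', hj', hpaired', hnot⟩)
    · rw [hroot] at hval
      cases hval
    · obtain rfl : j = j' := by omega
      obtain rfl := hpaired.left_unique (by simp) hpaired'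
      exact ⟨opening_open (s := .right) hn, hnot⟩

theorem isRooting_iff (hw : IsPrefixShuffle w) (h : Head w) : IsRooting w h.1 ↔
    opening (plus w) .right (headLabel h) = headLabel h ∧
      IsActiveAt (plus w) .right w.length (headLabel h) := by
  rw [← isRooting_headAt_iff hw (isLabel_headLabel hw h), headAt_headLabel]

theorem isRooting_headAt_opening (hw : IsPrefixShuffle w)
    (hk : IsLabel (plus w) (opening (plus w) .right e))
    (hactive : IsActiveAt (plus w) .right w.length (opening (plus w) .right e)) :
    IsRooting w (headAt hw hk).1 :=
  (isRooting_headAt_iff hw hk).2 ⟨opening_opening (isPrefixShuffle_plus hw) _ _, hactive⟩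

theorem opening_right_eq_headLabel_of_cell (hw : IsPrefixShuffle w) (he : IsLabel (plus w) e)
    {h : Head w} (hrooting : IsRooting w h.1) (hcell : faceOf (far (headAt hw he)) = cell h) :
    opening (plus w) .right e = headLabel h := by
  have howner := owner_eq_of_faceOf hw hcell
  rw [owner_far, owner_far, headLabel_headAt, ((isRooting_iff hw h).1 hrooting).1] at howner
  exact (Prod.mk.inj howner).2

theorem isActive_far_iff (hw : IsPrefixShuffle w) (he : IsLabel (plus w) e) :
    IsActive (pvert (far (headAt hw he))) ↔
      IsActiveAt (plus w) .right w.length (opening (plus w) .right e) := by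
  have hk := isLabel_opening (isPrefixShuffle_plus hw) .right e
  rw [pvert_far hw]
  constructor
  · rintro (hface | ⟨h, hrooting, hcell⟩)
    · exact absurd hface (faceOf_far_ne_rootFace hw _)
    · rw [opening_right_eq_headLabel_of_cell hw he hrooting hcell]
      exact ((isRooting_iff hw h).1 hrooting).2
  · intro hactive
    exact Or.inr ⟨headAt hw hk, isRooting_headAt_opening hw hk hactive,
      faceOf_far_opening hw he hk⟩

theorem isActive_vert_pHalf_iff (hw : IsPrefixShuffle w) (s : Side) (he : IsLabel (plus w) e) :
    IsActive ((partitionTree w).vert (pHalf s (headAt hw he))) ↔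
      IsActiveAt (plus w) s w.length (opening (plus w) s e) := by
  cases s
  · exact isActive_near_iff hw he
  · exact isActive_far_iff hw he

theorem active_and_color_iff (hw : IsPrefixShuffle w) (x : PVertex w) (l : (lambda₁ w).Leaf)
    (h : (isoTheta hw).onV x = l.vertex) :
    (IsActive x ↔ l.IsActive) ∧ (IsWhite x ↔ IsLeftSon l.1) ∧ (IsBlack x ↔ IsRightSon l.1) := by
  obtain ⟨s, e, he, hl, rfl⟩ := exists_label_of_onV_eq_vertex hw h
  rw [leaf_isActive_iff_isActiveAt hw he hl, isActive_vert_pHalf_iff, isWhite_vert_pHalf_iff hw,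
    isBlack_vert_pHalf_iff hw, hl, IsLeftSon, IsRightSon, List.head?_cons, Option.some_inj,
    Option.some_inj]
  exact ⟨Iff.rfl, Iff.rfl, Iff.rfl⟩

/-! ### The orders on the active vertices -/

theorem pairwise_actives (B : BinTree) :
    B.actives.Pairwise (fun p q => B.leafList.idxOf p < B.leafList.idxOf q) :=
  (pairwise_idxOf_of_nodup (nodup_leafList B)).sublist (actives_sublist B)

theorem leaf_precedes_iff_of_left (hw : IsPrefixShuffle w) {l m : (lambda₁ w).Leaf}
    (he : IsLabel (plus w) e) (hf : IsLabel (plus w) f)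
    (hl : l.1 = .left :: nodeAddr (plus w) e) (hm : m.1 = .left :: nodeAddr (plus w) f)
    (hl_active : l.IsActive) (hm_active : m.IsActive) :
    l.Precedes m ↔ opening (plus w) .left e < opening (plus w) .left f := by
  have hpairwise := pairwise_actives (lambda₁ w)
  rw [actives_lambda₁ hw, stackLeaves, List.pairwise_append, List.pairwise_reverse,
    List.pairwise_map] at hpairwise
  rw [Leaf.Precedes, hl, hm]
  exact iff_of_pairwise_of_asymm hpairwise.1
    (activeStack_pairwise (isPrefixShuffle_plus hw) .left w.length)
    (fun _ _ => lt_asymm) (fun _ _ => lt_asymm)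
    _ ((leaf_isActive_iff_mem_activeStack hw hf hm).1 hm_active)
    _ ((leaf_isActive_iff_mem_activeStack hw he hl).1 hl_active)

theorem leaf_precedes_iff_of_right (hw : IsPrefixShuffle w) {l m : (lambda₁ w).Leaf}
    (he : IsLabel (plus w) e) (hf : IsLabel (plus w) f)
    (hl : l.1 = .right :: nodeAddr (plus w) e) (hm : m.1 = .right :: nodeAddr (plus w) f)
    (hl_active : l.IsActive) (hm_active : m.IsActive) :
    l.Precedes m ↔ opening (plus w) .right f < opening (plus w) .right e := by
  have hpairwise := pairwise_actives (lambda₁ w)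
  rw [actives_lambda₁ hw, stackLeaves, List.pairwise_append,
    List.pairwise_map (l := activeStack _ .right _)] at hpairwise
  rw [Leaf.Precedes, hl, hm]
  exact iff_of_pairwise_of_asymm hpairwise.2.1
    (activeStack_pairwise (isPrefixShuffle_plus hw) .right w.length)
    (fun _ _ => lt_asymm) (fun _ _ => lt_asymm)
    _ ((leaf_isActive_iff_mem_activeStack hw he hl).1 hl_active)
    _ ((leaf_isActive_iff_mem_activeStack hw hf hm).1 hm_active)

theorem whiteRank_near (hw : IsPrefixShuffle w) (he : IsLabel (plus w) e)
    (h : IsActiveAt (plus w) .left (plus w).length (opening (plus w) .left e)) :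
    whiteRank (pvert (near (headAt hw he))) = rank (old (tour w (opening (plus w) .left e))) := by
  have hk := isLabel_opening (isPrefixShuffle_plus hw) .left e
  rw [pvert_near_opening hw he hk]
  generalize opening (plus w) .left e = k at h hk
  rcases eq_or_ne k 0 with rfl | h0
  · rw [pvert_near_zero hw, tour_zero, rank_root]
    rfl
  · rw [pvert_near_of_isDangling hw hk ((isDangling_tour hw hk.le_length).2 ⟨h0, h⟩)]
    rfl

theorem strictMonoOn_rank (hw : IsPrefixShuffle w) :
    StrictMonoOn (fun k => rank (old (tour w k)))
      {k | IsLabel (plus w) k ∧ IsActiveAt (plus w) .left (plus w).length k} :=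
  fun _ hk _ hk' => rank_lt_rank hw hk.1 hk'.1 hk.2 hk'.2

theorem whitePrecedes_near_iff (hw : IsPrefixShuffle w) (he : IsLabel (plus w) e)
    (hf : IsLabel (plus w) f) (hx : IsActive (pvert (near (headAt hw he))))
    (hy : IsActive (pvert (near (headAt hw hf)))) :
    WhitePrecedes (pvert (near (headAt hw he))) (pvert (near (headAt hw hf))) ↔
      opening (plus w) .left e < opening (plus w) .left f := by
  have hu := isPrefixShuffle_plus hw
  have he_active := (isActiveAt_left_length_plus w _).2 ((isActive_near_iff hw he).1 hx)
  have hf_active := (isActiveAt_left_length_plus w _).2 ((isActive_near_iff hw hf).1 hy)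
  rw [← (strictMonoOn_rank hw).lt_iff_lt ⟨isLabel_opening hu _ _, he_active⟩
    ⟨isLabel_opening hu _ _, hf_active⟩, ← whiteRank_near hw he he_active,
    ← whiteRank_near hw hf hf_active]
  have isWhite (h : Head w) : IsWhite (pvert (near h)) := (isWhite_vert_pHalf_iff hw .left h).2 rfl
  exact ⟨fun h => h.2.2, fun h => ⟨⟨isWhite _, hx⟩, ⟨isWhite _, hy⟩, h⟩⟩

theorem firstVisit_le_headLabel_succ (hw : IsPrefixShuffle w) (h : Head w) :
    firstVisit w h.1 ≤ headLabel h + 1 :=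
  calc firstVisit w h.1 ≤ (ccw w h.1).val := Nat.sInf_le ⟨_, ⟨1, by simp⟩, rfl⟩
    _ = (tour w (headLabel h + 1)).val := by
      rw [← ccw_headAt hw (isLabel_headLabel hw h), headAt_headLabel]
    _ ≤ headLabel h + 1 := Nat.mod_le _ _

theorem opening_right_firstVisit (hw : IsPrefixShuffle w) (h : Head w) :
    opening (plus w) .right (firstVisit w h.1 - 1) = opening (plus w) .right (headLabel h) := by
  obtain ⟨d, hcycle, hval⟩ :
      firstVisit w h.1 ∈ {n | ∃ e : HalfEdge w, (ccw w).SameCycle h.1 e ∧ e.val = n} :=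
    Nat.sInf_mem ⟨_, _, Perm.SameCycle.refl _ _, rfl⟩
  rw [← opening_right_head hw, opening_right_of_sameCycle hw hcycle, hval]

theorem firstVisit_lt (hw : IsPrefixShuffle w) {h h' : Head w}
    (hopening : opening (plus w) .right (headLabel h') = headLabel h')
    (hlt : headLabel h < headLabel h') : firstVisit w h.1 < firstVisit w h'.1 := by
  have hle := firstVisit_le_headLabel_succ hw h
  have hle' := opening_le (isPrefixShuffle_plus hw) .right (firstVisit w h'.1 - 1)
  rw [opening_right_firstVisit hw, hopening] at hle'
  omega

theorem firstVisit_lt_iff (hw : IsPrefixShuffle w) {h h' : Head w}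
    (hopening : opening (plus w) .right (headLabel h) = headLabel h)
    (hopening' : opening (plus w) .right (headLabel h') = headLabel h') :
    firstVisit w h.1 < firstVisit w h'.1 ↔ headLabel h < headLabel h' := by
  refine ⟨fun hlt => ?_, firstVisit_lt hw hopening'⟩
  by_contra hle
  rcases (not_lt.1 hle).eq_or_lt with heq | hgt
  · rw [headLabel_injective hw heq] at hlt
    exact lt_irrefl _ hlt
  · exact lt_asymm hlt (firstVisit_lt hw hopening hgt)

theorem blackPrecedes_far_iff (hw : IsPrefixShuffle w) (he : IsLabel (plus w) e)
    (hf : IsLabel (plus w) f) (hx : IsActive (pvert (far (headAt hw he))))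
    (hy : IsActive (pvert (far (headAt hw hf)))) :
    BlackPrecedes (pvert (far (headAt hw he))) (pvert (far (headAt hw hf))) ↔
      opening (plus w) .right e < opening (plus w) .right f := by
  have hu := isPrefixShuffle_plus hw
  have hk := isLabel_opening hu .right e
  have hk' := isLabel_opening hu .right f
  rw [isActive_far_iff hw] at hx hy
  rw [pvert_far hw, pvert_far hw]
  constructor
  · rintro ⟨h, h', hr, hr', hcell, hcell', hlt⟩
    rw [opening_right_eq_headLabel_of_cell hw he hr (Sum.inl_injective hcell),
      opening_right_eq_headLabel_of_cell hw hf hr' (Sum.inl_injective hcell')]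
    exact (firstVisit_lt_iff hw ((isRooting_iff hw h).1 hr).1 ((isRooting_iff hw h').1 hr').1).1 hlt
  · intro hlt
    refine ⟨headAt hw hk, headAt hw hk', isRooting_headAt_opening hw hk hx,
      isRooting_headAt_opening hw hk' hy, congrArg Sum.inl (faceOf_far_opening hw he hk),
      congrArg Sum.inl (faceOf_far_opening hw hf hk'), firstVisit_lt hw ?_ ?_⟩
    · rw [headLabel_headAt, opening_opening hu]
    · rwa [headLabel_headAt, headLabel_headAt]

theorem whitePrecedes_iff (hw : IsPrefixShuffle w) (x y : PVertex w) (l m : (lambda₁ w).Leaf)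
    (hx : (isoTheta hw).onV x = l.vertex) (hy : (isoTheta hw).onV y = m.vertex)
    (hx_active : IsActive x) (hy_active : IsActive y) (hx_white : IsWhite x)
    (hy_white : IsWhite y) : WhitePrecedes x y ↔ l.Precedes m := by
  have hl_active := (active_and_color_iff hw x l hx).1.1 hx_active
  have hm_active := (active_and_color_iff hw y m hy).1.1 hy_active
  obtain ⟨s, e, he, hl, rfl⟩ := exists_label_of_onV_eq_vertex hw hx
  obtain ⟨t, f, hf, hm, rfl⟩ := exists_label_of_onV_eq_vertex hw hy
  obtain rfl := (isWhite_vert_pHalf_iff hw s _).1 hx_white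
  obtain rfl := (isWhite_vert_pHalf_iff hw t _).1 hy_white
  exact (whitePrecedes_near_iff hw he hf hx_active hy_active).trans
    (leaf_precedes_iff_of_left hw he hf hl hm hl_active hm_active).symm

theorem blackPrecedes_iff (hw : IsPrefixShuffle w) (x y : PVertex w) (l m : (lambda₁ w).Leaf)
    (hx : (isoTheta hw).onV x = l.vertex) (hy : (isoTheta hw).onV y = m.vertex)
    (hx_active : IsActive x) (hy_active : IsActive y) (hx_black : IsBlack x)
    (hy_black : IsBlack y) : BlackPrecedes x y ↔ m.Precedes l := by
  have hl_active := (active_and_color_iff hw x l hx).1.1 hx_active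
  have hm_active := (active_and_color_iff hw y m hy).1.1 hy_active
  obtain ⟨s, e, he, hl, rfl⟩ := exists_label_of_onV_eq_vertex hw hx
  obtain ⟨t, f, hf, hm, rfl⟩ := exists_label_of_onV_eq_vertex hw hy
  obtain rfl := (isBlack_vert_pHalf_iff hw s _).1 hx_black
  obtain rfl := (isBlack_vert_pHalf_iff hw t _).1 hy_black
  exact (blackPrecedes_far_iff hw he hf hx_active hy_active).trans
    (leaf_precedes_iff_of_right hw hf he hm hl hm_active hl_active).symm

end PrefixMap

open PrefixMap in
theorem mainTheorem6 (w : List Letter) (hw : IsPrefixShuffle w) :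
    (partitionTree w).IsTree ∧
    Function.Bijective (BinTree.Leaf.vertex (B := lambda₁ w)) ∧
    ∃ φ : (partitionTree w).Iso (lambda₁ w).theta,
      (∀ (x : PVertex w) (l : (lambda₁ w).Leaf), φ.onV x = l.vertex →
        (IsActive x ↔ l.IsActive) ∧
        (IsWhite x ↔ BinTree.IsLeftSon l.1) ∧
        (IsBlack x ↔ BinTree.IsRightSon l.1)) ∧
      (∀ (x y : PVertex w) (l m : (lambda₁ w).Leaf), φ.onV x = l.vertex → φ.onV y = m.vertex →
        (IsActive x → IsActive y → IsWhite x → IsWhite y → (WhitePrecedes x y ↔ l.Precedes m)) ∧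
        (IsActive x → IsActive y → IsBlack x → IsBlack y →
          (BlackPrecedes x y ↔ m.Precedes l))) :=
  ⟨partitionTree_isTree hw, ⟨BinTree.Leaf.vertex_injective, BinTree.Leaf.vertex_surjective⟩,
    isoTheta hw, active_and_color_iff hw, fun x y l m hx hy =>
      ⟨whitePrecedes_iff hw x y l m hx hy, blackPrecedes_iff hw x y l m hx hy⟩⟩
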